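/- Let $\mathcal K$ be a finite CAT(0) planar complex whose faces are Euclidean triangles: a finite complex of vertices, edges and nondegenerate Euclidean triangles glued along sides, which can be drawn in the plane so that its 2-cells are exactly the inner faces of its 1-skeleton, and which is a CAT(0) space for its intrinsic metric $d$. Write $\gamma(a,b)$ for the geodesic from $a$ to $b$, $\partial\mathcal K$ for the boundary (the union of the edges not lying in two triangles), and $\theta(v)$ for the sum of the angles at a vertex $v$ of the triangles containing $v$. A cone $\mathcal C(z;p,q)$ with apex $z\in\mathcal K$ and $p,q\in\partial\mathcal K$ is a region of $\mathcal K$ bounded by its two sides $\gamma(z,p)$ and $\gamma(z,q)$, that is, the union of the two sides with one connected component of $\mathcal K\setminus(\gamma(z,p)\cup\gamma(z,q))$, which near $z$ is a sector running from one side to the other with angle $\alpha$, $0<\alpha<\pi$. For $x\in\mathcal K$, a shortest path map SPM($x$) is a family of cones such that: - the cones cover $\mathcal K$, and two distinct cones meet only in points that lie on sides of both; - every vertex of $\mathcal K$ (boundary vertices included) lies on a side of some cone; a vertex $y$ with $\theta(y)=2\pi$ lies on sides of two distinct cones; a vertex $y$ with $\theta(y)>2\pi$ is the apex of some cone; - for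 every cone $\mathcal C(z;p,q)$ of the family, $z\in\gamma(x,p)\cap\gamma(x,q)$; - the sides are straight: at every point of a side $\gamma(z,p)$ or $\gamma(z,q)$ of a cone other than its two endpoints, the inner angle of the cone (the angle of the sector formed by the cone there, summed over the faces) equals $\pi$. Then every cone $\mathcal C(z;p,q)$ of every shortest path map SPM($x$) unfolds isometrically onto a triangle in the Euclidean plane with the angle of the cone at its apex: there is a map $f$ to $\mathbb E^2$ with $\|f(a)-f(b)\|=d(a,b)$ for all $a,b\in\mathcal C(z;p,q)$ such that $f(z),f(p),f(q)$ are not collinear, $f$ maps $\mathcal C(z;p,q)$ onto the full triangle with vertices $f(z),f(p),f(q)$ and maps the sides $\gamma(z,p)$ and $\gamma(z,q)$ onto the segments $[f(z),f(p)]$ and $[f(z),f(q)]$, and the angle of this triangle at $f(z)$ equals the inner angle of the cone at $z$ (which is less than $\pi$). -/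

import Mathlib

open Set Filter Topology

noncomputable section

/-- The Euclidean plane. -/
abbrev EPlane : Type := EuclideanSpace ℝ (Fin 2)

/-! ### Geodesics and CAT(0) spaces, for a distance function `d` on a type `X` -/

/-- `γ`, restricted to `[0, l]`, is a geodesic from `a` to `b`. -/
def IsGeodesicPath {X : Type*} (d : X → X → ℝ) (γ : ℝ → X) (l : ℝ) (a b : X) : Prop :=
  0 ≤ l ∧ γ 0 = a ∧ γ l = b ∧ ∀ s ∈ Icc (0 : ℝ) l, ∀ t ∈ Icc (0 : ℝ) l, d (γ s) (γ t) = |s - t|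

/-- `(X, d)` is a CAT(0) space: any two points are joined by a geodesic, and in every geodesic
triangle the distance from a vertex `x₃` to a point `y` of the opposite side is at most the
corresponding distance in a comparison triangle. -/
def IsCATZero {X : Type*} (d : X → X → ℝ) : Prop :=
  (∀ a b : X, ∃ (γ : ℝ → X) (l : ℝ), IsGeodesicPath d γ l a b) ∧
  ∀ (x₁ x₂ x₃ : X) (γ : ℝ → X) (l : ℝ), IsGeodesicPath d γ l x₁ x₂ →
    ∀ y ∈ γ '' Icc (0 : ℝ) l, ∀ x₁' x₂' x₃' y' : EPlane,
      dist x₁' x₂' = d x₁ x₂ → dist x₂' x₃' = d x₂ x₃ → dist x₁' x₃' = d x₁ x₃ →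
      y' ∈ segment ℝ x₁' x₂' → dist x₁' y' = d x₁ y → dist x₂' y' = d x₂ y →
      d x₃ y ≤ dist x₃' y'

/-- The angle between the sides of lengths `a` and `b` in a Euclidean triangle whose third side
has length `c`. -/
def triangleAngle (a b c : ℝ) : ℝ := Real.arccos ((a ^ 2 + b ^ 2 - c ^ 2) / (2 * a * b))

/-! ### Finite triangle complexes -/

/-- A finite cell complex whose cells are vertices, edges and nondegenerate Euclidean triangles,
glued along their sides. A cell is given by its set of vertices, and the shape of the cells
by the lengths of the edges. -/
structure TriangleComplex (V : Type*) where
  cells : Set (Finset V)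
  down_closed : ∀ s ∈ cells, ∀ t ⊆ s, t ∈ cells
  card_le : ∀ s ∈ cells, s.card ≤ 3
  len : V → V → ℝ
  len_self : ∀ u, len u u = 0
  len_symm : ∀ u v, len u v = len v u
  len_pos : ∀ s ∈ cells, ∀ u ∈ s, ∀ v ∈ s, u ≠ v → 0 < len u v
  len_triangle : ∀ s ∈ cells, ∀ u ∈ s, ∀ v ∈ s, ∀ w ∈ s, u ≠ v → v ≠ w → u ≠ w →
    len u w < len u v + len v w

namespace TriangleComplex

variable {V : Type*} [Fintype V] (K : TriangleComplex V)

/-- The points of the complex, in barycentric coordinates. They carry the topology of `V → ℝ`. -/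
abbrev Point : Type _ :=
  {w : V → ℝ // (∀ v, 0 ≤ w v) ∧ ∑ v, w v = 1 ∧ ∃ s ∈ K.cells, ∀ v, v ∉ s → w v = 0}

/-- The closed cell with vertex set `s`. -/
def cell (s : Finset V) : Set K.Point := {w | ∀ v, v ∉ s → w.1 v = 0}

/-- The open cell with vertex set `s`. -/
def openCell (s : Finset V) : Set K.Point := {w | w ∈ K.cell s ∧ ∀ v ∈ s, 0 < w.1 v}

/-- The 1-skeleton: the union of the vertices and edges. -/
def skeleton : Set K.Point := {w | ∃ s ∈ K.cells, s.card ≤ 2 ∧ w ∈ K.cell s}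

/-- `y` is the vertex `v` of the complex. -/
def IsVertexAt (v : V) (y : K.Point) : Prop := y.1 v = 1

/-- The boundary of the complex: the union of the edges that do not lie in two triangles. -/
def boundary : Set K.Point :=
  {w | ∃ e ∈ K.cells, e.card = 2 ∧ w ∈ K.cell e ∧
    ¬ ∃ s ∈ K.cells, ∃ t ∈ K.cells, s.card = 3 ∧ t.card = 3 ∧ s ≠ t ∧ e ⊆ s ∧ e ⊆ t}

/-- The Euclidean distance between two points of a common cell, with
`|∑ δ_u P_u|² = -½ ∑ |P_u - P_v|² δ_u δ_v` for `∑ δ_u = 0`. -/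
def cellDist (a b : K.Point) : ℝ :=
  Real.sqrt (-(∑ u, ∑ v, K.len u v ^ 2 * (a.1 u - b.1 u) * (a.1 v - b.1 v)) / 2)

/-- The intrinsic metric: the infimum of the lengths of the finite paths `c 0, …, c n` from `a` to
`b` whose consecutive points lie in a common cell. -/
def pathDist (a b : K.Point) : ℝ :=
  sInf {L | ∃ (n : ℕ) (c : ℕ → K.Point), c 0 = a ∧ c n = b ∧
    (∀ i < n, ∃ s ∈ K.cells, c i ∈ K.cell s ∧ c (i + 1) ∈ K.cell s) ∧
    L = ∑ i ∈ Finset.range n, K.cellDist (c i) (c (i + 1))}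

/-- The complex is CAT(0) for its intrinsic metric. -/
def IsCAT0 : Prop := IsCATZero K.pathDist

/-- The complex can be drawn in the plane so that its 2-cells are exactly the inner (bounded)
faces of the drawing of the 1-skeleton. -/
def IsPlanar : Prop :=
  ∃ φ : K.Point → EPlane, Continuous φ ∧ Function.Injective φ ∧
    ∀ U : Set EPlane, (∃ t ∈ K.cells, t.card = 3 ∧ U = φ '' K.openCell t) ↔
      (Bornology.IsBounded U ∧
        ∃ y ∈ (φ '' K.skeleton)ᶜ, U = connectedComponentIn (φ '' K.skeleton)ᶜ y)

/-- The geodesic segment `γ(a, b)`. In a CAT(0) space geodesics are unique, and the geodesic from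
`a` to `b` consists of the points between `a` and `b`. -/
def geod (a b : K.Point) : Set K.Point :=
  {y | K.pathDist a y + K.pathDist y b = K.pathDist a b}

open scoped Classical in
/-- `θ(v)`: the sum of the angles at the vertex `v` of all triangles `{v, a, b}` of the complex
(every triangle occurs twice in the double sum). -/
def totalAngle (v : V) : ℝ :=
  (∑ a, ∑ b, if (∃ s ∈ K.cells, v ∈ s ∧ a ∈ s ∧ b ∈ s) ∧ v ≠ a ∧ v ≠ b ∧ a ≠ b then
    triangleAngle (K.len v a) (K.len v b) (K.len a b) else 0) / 2

/-! ### Angles inside a region -/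

/-- The Euclidean triangle (possibly degenerate) with vertices `v, a, b` in a common cell. -/
def smallTriangle (v a b : K.Point) : Set K.Point :=
  {w | w.1 ∈ convexHull ℝ ({v.1, a.1, b.1} : Set (V → ℝ))}

/-- The points `c 0, …, c n` form a fan around `v` that fills the region `C` near `v`: the
triangles `v, c i, c (i + 1)` lie in cells, have an angle less than `π` at `v`, are contained in
`C`, and cover `C` near `v`. -/
def IsFan (C : Set K.Point) (v : K.Point) (n : ℕ) (c : ℕ → K.Point) : Prop :=
  (∀ i ≤ n, c i ≠ v) ∧
  (∀ i < n, (∃ s ∈ K.cells, v ∈ K.cell s ∧ c i ∈ K.cell s ∧ c (i + 1) ∈ K.cell s) ∧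
    triangleAngle (K.cellDist v (c i)) (K.cellDist v (c (i + 1)))
      (K.cellDist (c i) (c (i + 1))) < Real.pi ∧
    K.smallTriangle v (c i) (c (i + 1)) ⊆ C) ∧
  ∀ᶠ w in 𝓝 v, w ∈ C → ∃ i < n, w ∈ K.smallTriangle v (c i) (c (i + 1))

/-- Near `v` the region `C` is a sector that runs from the geodesic `A` to the geodesic `B`
(both starting at `v`), and its angle, summed over the faces at `v`, is `α`. The angle may
exceed `π`. It is the least angle sum of a fan in `C` around `v` from `A` to `B`. -/
def HasInnerAngle (C : Set K.Point) (v : K.Point) (A B : Set K.Point) (α : ℝ) : Prop :=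
  IsLeast {S | ∃ (n : ℕ) (c : ℕ → K.Point), K.IsFan C v n c ∧ c 0 ∈ A ∧ c n ∈ B ∧
    S = ∑ i ∈ Finset.range n, triangleAngle (K.cellDist v (c i)) (K.cellDist v (c (i + 1)))
      (K.cellDist (c i) (c (i + 1)))} α

/-! ### Cones and the shortest path map -/

/-- A cone `C(z; p, q)`: a region bounded by two geodesics `γ(z, p)` and `γ(z, q)` from the apex `z`
to boundary points `p` and `q`, namely the two geodesics together with one of the connected
components that they cut out of the complex, which has an angle `0 < α < π` at `z`. -/
structure Cone where
  apex : K.Point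
  fst : K.Point
  snd : K.Point
  region : Set K.Point
  fst_mem : fst ∈ K.boundary
  snd_mem : snd ∈ K.boundary
  region_eq : ∃ y ∈ (K.geod apex fst ∪ K.geod apex snd)ᶜ,
    region = (K.geod apex fst ∪ K.geod apex snd) ∪
      connectedComponentIn (K.geod apex fst ∪ K.geod apex snd)ᶜ y
  angle_apex : ∃ α : ℝ, 0 < α ∧ α < Real.pi ∧
    K.HasInnerAngle region apex (K.geod apex fst) (K.geod apex snd) α

variable {K}

/-- The union of the two sides of a cone. -/
def Cone.sides (c : K.Cone) : Set K.Point := K.geod c.apex c.fst ∪ K.geod c.apex c.snd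

variable (K)

/-- `M` is a shortest path map SPM(`x`). -/
structure IsShortestPathMap (x : K.Point) (M : Set K.Cone) : Prop where
  /-- the cones cover the complex -/
  cover : ∀ y : K.Point, ∃ c ∈ M, y ∈ c.region
  /-- distinct cones meet only along their sides -/
  inter : ∀ c ∈ M, ∀ c' ∈ M, c ≠ c' → c.region ∩ c'.region ⊆ c.sides ∩ c'.sides
  /-- every vertex lies on a side of a cone, hence on one of the geodesics from `x` to the boundary
  that make up the map -/
  vertex : ∀ (v : V) (y : K.Point), K.IsVertexAt v y → ∃ c ∈ M, y ∈ c.sides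
  /-- a vertex with `θ = 2π` lies on sides of two cones -/
  flat_vertex : ∀ (v : V) (y : K.Point), K.IsVertexAt v y → K.totalAngle v = 2 * Real.pi →
    ∃ c ∈ M, ∃ c' ∈ M, c ≠ c' ∧ y ∈ c.sides ∧ y ∈ c'.sides
  /-- a vertex of negative curvature is the apex of a cone -/
  negative_vertex : ∀ (v : V) (y : K.Point), K.IsVertexAt v y → 2 * Real.pi < K.totalAngle v →
    ∃ c ∈ M, c.apex = y
  /-- the apex of a cone lies on the geodesics from `x` to the ends of its sides -/
  apex_mem : ∀ c ∈ M, c.apex ∈ K.geod x c.fst ∧ c.apex ∈ K.geod x c.snd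
  /-- the sides of a cone are straight: their inner angles in the cone are equal to `π` -/
  straight_fst : ∀ c ∈ M, ∀ v ∈ K.geod c.apex c.fst, v ≠ c.apex → v ≠ c.fst →
    K.HasInnerAngle c.region v (K.geod v c.apex) (K.geod v c.fst) Real.pi
  straight_snd : ∀ c ∈ M, ∀ v ∈ K.geod c.apex c.snd, v ≠ c.apex → v ≠ c.snd →
    K.HasInnerAngle c.region v (K.geod v c.apex) (K.geod v c.snd) Real.pi

end TriangleComplex

end

open Set Filter Topology

noncomputable section

/-! The cone `C` with apex `z` and ends `p`, `q` is unfolded by the inverse of the exponential map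
at `z`: `f x` is the vector of length `d z x` in the direction in which the geodesic from `z` to `x`
starts. This makes sense because `C` is star-shaped about `z` and is a sector of a single cell near
`z`. For the latter, no vertex of the complex lies in `C` off the sides. Hence a segment from a
point inside `C` towards a vertex meets a side, and this forces the direction of every inner point
to lie between the directions of the two sides, in one cell (`direction_between`, `exists_sector`).
The CAT(0) inequality in the form of Thales' theorem shows that `f` does not expand distances
(`exists_log`).

Except possibly at `p` and `q`, the set `C` is locally isometric to a subset of the plane. At the
apex it is a sector of a cell. At a point inside a side there is a fan with angle sum `π`, and its
unrolling is isometric: unrolled paths bound distances from above, and the CAT(0) inequality at the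
midpoint of a diameter bounds them from below (`exists_halfDisc`). Elsewhere the point is not a
vertex, and an edge through it lies in at most two triangles (`not_three_triangles`), which unfold
across that edge. Flatness along the geodesic from `z` to `y` makes `f` isometric near `y`: the
squared distance between two neighbouring radial geodesics is a quadratic polynomial in the radial
parameter, so it keeps the homogeneous form that it has near `z` (`isometric_near`).

It remains to pass from local to global (`FlatCone.base`). The chord joining the points at ratio `s`
on the two sides is followed from `s = 0` to `s = 1` by continuous induction: it stays in `C`, and
its image is a local geodesic of the plane, hence straight. At `s = 1` the geodesic from `p` to `q`
lies in `C` and has the length of its image, so `f z, f p, f q` is a comparison triangle for `z, p,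
q`. On the union of the geodesics from `z` to this base, the CAT(0) upper bound for distances meets
the lower bound given by the nonexpanding map, and `f` is an isometry onto the full triangle
(`isom_fill`, `image_fill`). This union is closed and convex, and it is a neighbourhood of each of
its points off the sides, so by connectedness it is all of `C` (`eq_fill`).

The abstract CAT(0) argument needs the cells to be isometrically embedded (`pathDist_eq_cellDist`).
This follows because straight segments are locally shortest, and a local geodesic in a CAT(0) space
is a geodesic (`of_local`). The inner angle is attained by a one-triangle fan at the apex, and no
fan between the sides has a smaller sum (`angle_le`). -/

/-- `d` is a metric on `X` and `σ a b` is the constant speed geodesic from `a` to `b`, such that the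
CAT(0) inequality holds. -/
structure CATMetric {X : Type*} (d : X → X → ℝ) (σ : X → X → ℝ → X) : Prop where
  self : ∀ a, d a a = 0
  eq_of : ∀ a b, d a b = 0 → a = b
  comm : ∀ a b, d a b = d b a
  tri : ∀ a b c, d a c ≤ d a b + d b c
  zero : ∀ a b, σ a b 0 = a
  one : ∀ a b, σ a b 1 = b
  seg : ∀ a b, ∀ s ∈ Icc (0 : ℝ) 1, ∀ t ∈ Icc (0 : ℝ) 1, d (σ a b s) (σ a b t) = |s - t| * d a b
  cn : ∀ a b c, ∀ t ∈ Icc (0 : ℝ) 1,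
    d c (σ a b t) ^ 2 ≤ (1 - t) * d c a ^ 2 + t * d c b ^ 2 - t * (1 - t) * d a b ^ 2

/-! ### Geodesics in CAT(0) spaces -/

namespace CATMetric

variable {X : Type*} {d : X → X → ℝ} {σ : X → X → ℝ → X} (h : CATMetric d σ)

include h

theorem nonneg (a b : X) : 0 ≤ d a b := by
  have := h.tri a b a
  rw [h.self, h.comm b a] at this
  linarith

theorem pos {a b : X} (hab : a ≠ b) : 0 < d a b :=
  lt_of_le_of_ne (h.nonneg a b) fun e => hab (h.eq_of a b e.symm)

theorem dist_left (a b : X) {t : ℝ} (ht : t ∈ Icc (0 : ℝ) 1) : d a (σ a b t) = t * d a b := by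
  have := h.seg a b 0 ⟨le_rfl, zero_le_one⟩ t ht
  rwa [h.zero, zero_sub, abs_neg, abs_of_nonneg ht.1] at this

theorem dist_right (a b : X) {t : ℝ} (ht : t ∈ Icc (0 : ℝ) 1) :
    d (σ a b t) b = (1 - t) * d a b := by
  have := h.seg a b t ht 1 ⟨zero_le_one, le_rfl⟩
  rwa [h.one, abs_sub_comm, abs_of_nonneg (by linarith [ht.2])] at this

/-- With the two bounds inserted, `cn` bounds the squared distance from `x` to `σ a b t` by
`t(1-t)(t + (1-t) - 1) d(a,b)² = 0`. This is the uniqueness of geodesics in the form used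
throughout. -/
theorem eq_seg {a b x : X} {t : ℝ} (ht : t ∈ Icc (0 : ℝ) 1) (h1 : d a x ≤ t * d a b)
    (h2 : d x b ≤ (1 - t) * d a b) : x = σ a b t := by
  apply h.eq_of
  have h3 := h.cn a b x t ht
  have h4 : d x a ^ 2 ≤ (t * d a b) ^ 2 := by
    rw [h.comm x a]; exact pow_le_pow_left₀ (h.nonneg _ _) h1 2
  have h5 : d x b ^ 2 ≤ ((1 - t) * d a b) ^ 2 := pow_le_pow_left₀ (h.nonneg _ _) h2 2
  have h6 := mul_le_mul_of_nonneg_left h4 (sub_nonneg.2 ht.2)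
  have h7 := mul_le_mul_of_nonneg_left h5 ht.1
  have h8 : d x (σ a b t) ^ 2 ≤ 0 := by nlinarith
  have := sq_nonneg (d x (σ a b t))
  exact pow_eq_zero_iff two_ne_zero |>.1 (le_antisymm h8 this)

theorem exists_of_between {a b x : X} (hx : d a x + d x b = d a b) :
    ∃ t ∈ Icc (0 : ℝ) 1, x = σ a b t := by
  have n1 := h.nonneg a x
  have n2 := h.nonneg x b
  rcases eq_or_lt_of_le (h.nonneg a b) with h0 | h0
  · refine ⟨0, ⟨le_rfl, zero_le_one⟩, ?_⟩
    rw [h.zero]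
    exact (h.eq_of a x (by linarith)).symm
  · refine ⟨d a x / d a b, ⟨by positivity, ?_⟩, ?_⟩
    · rw [div_le_one h0]; linarith
    · apply h.eq_seg ⟨by positivity, by rw [div_le_one h0]; linarith⟩
      · rw [div_mul_cancel₀ _ h0.ne']
      · rw [sub_mul, div_mul_cancel₀ _ h0.ne']; linarith

theorem between_seg (a b : X) {t : ℝ} (ht : t ∈ Icc (0 : ℝ) 1) :
    d a (σ a b t) + d (σ a b t) b = d a b := by
  rw [h.dist_left a b ht, h.dist_right a b ht]; ring

theorem seg_symm (a b : X) {t : ℝ} (ht : t ∈ Icc (0 : ℝ) 1) : σ b a (1 - t) = σ a b t := by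
  have ht' : 1 - t ∈ Icc (0 : ℝ) 1 := ⟨by linarith [ht.2], by linarith [ht.1]⟩
  apply h.eq_seg ht
  · rw [h.comm, h.dist_right b a ht', h.comm b a]; linarith
  · rw [h.comm, h.dist_left b a ht', h.comm b a]

theorem seg_seg (a b : X) {s t : ℝ} (hs : s ∈ Icc (0 : ℝ) 1) (ht : t ∈ Icc (0 : ℝ) 1) :
    σ a (σ a b s) t = σ a b (t * s) := by
  have hts : t * s ∈ Icc (0 : ℝ) 1 := ⟨mul_nonneg ht.1 hs.1, mul_le_one₀ ht.2 hs.1 hs.2⟩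
  symm
  apply h.eq_seg ht
  · rw [h.dist_left a b hts, h.dist_left a b hs]; linarith
  · rw [h.seg a b _ hts _ hs, h.dist_left a b hs, abs_sub_comm, abs_of_nonneg]
    · linarith
    · nlinarith [hs.1, ht.2]

/-- Two points on two sides of a triangle are at most as far apart as in the comparison
triangle. -/
theorem two_sides (z a b : X) {s t : ℝ} (hs : s ∈ Icc (0 : ℝ) 1) (ht : t ∈ Icc (0 : ℝ) 1) :
    d (σ z a s) (σ z b t) ^ 2 ≤
      s * (s - t) * d z a ^ 2 + t * (t - s) * d z b ^ 2 + s * t * d a b ^ 2 := by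
  -- `cn` is applied once along each side; the resulting bound is exactly the squared distance in
  -- the comparison triangle.
  have h1 := h.cn z b (σ z a s) t ht
  have h2 := h.cn z a b s hs
  rw [h.comm _ z, h.dist_left z a hs] at h1
  rw [h.comm b, h.comm b, h.comm b a] at h2
  have h3 := mul_le_mul_of_nonneg_left h2 ht.1
  nlinarith

theorem thales (z a b : X) {t : ℝ} (ht : t ∈ Icc (0 : ℝ) 1) :
    d (σ z a t) (σ z b t) ≤ t * d a b := by
  have h1 := h.two_sides z a b ht ht
  apply le_of_sq_le_sq _ (mul_nonneg ht.1 (h.nonneg _ _))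
  nlinarith

theorem seg_convex (a b a' b' : X) {t : ℝ} (ht : t ∈ Icc (0 : ℝ) 1) :
    d (σ a b t) (σ a' b' t) ≤ (1 - t) * d a a' + t * d b b' := by
  have ht' : 1 - t ∈ Icc (0 : ℝ) 1 := ⟨by linarith [ht.2], by linarith [ht.1]⟩
  have h1 := h.thales a b b' ht
  have h2 := h.thales b' a a' ht'
  rw [h.seg_symm a b' ht, h.seg_symm a' b' ht] at h2
  linarith [h.tri (σ a b t) (σ a b' t) (σ a' b' t)]

theorem ball_convex {c a b : X} {r : ℝ} (ha : d c a < r) (hb : d c b < r) {t : ℝ}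
    (ht : t ∈ Icc (0 : ℝ) 1) : d c (σ a b t) < r := by
  have h0 : c = σ c c t := by
    apply h.eq_seg ht <;> simp [h.self]
  have h1 := h.seg_convex c c a b ht
  rw [← h0] at h1
  rcases eq_or_lt_of_le ht.1 with h2 | h2
  · subst h2; rw [h.zero]; exact ha
  · nlinarith [mul_le_mul_of_nonneg_left ha.le (sub_nonneg.2 ht.2), mul_lt_mul_of_pos_left hb h2]

theorem between_of_between {a b x y : X} (hx : d a x + d x b = d a b)
    (hy : d a y + d y x = d a x) : d a y + d y b = d a b := by
  have h1 := h.tri y x b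
  have h2 := h.tri a y b
  linarith

theorem between_linear {a b x y : X} (hx : d a x + d x b = d a b)
    (hy : d a y + d y b = d a b) (hxy : d a y ≤ d a x) : d a y + d y x = d a x := by
  obtain ⟨s, hs, rfl⟩ := h.exists_of_between hx
  obtain ⟨t, ht, rfl⟩ := h.exists_of_between hy
  rw [h.dist_left a b hs, h.dist_left a b ht] at *
  rw [h.seg a b t ht s hs]
  rcases eq_or_lt_of_le (h.nonneg a b) with h0 | h0
  · rw [← h0]; ring
  · have : t ≤ s := le_of_mul_le_mul_right hxy h0
    rw [abs_sub_comm, abs_of_nonneg (by linarith)]; ring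

/-- A local geodesic is a geodesic. -/
theorem of_local {c : ℝ → X} {D : ℝ}
    (hc : ∀ u ∈ Icc (0 : ℝ) 1, ∃ ε > 0, ∀ s ∈ Icc (0 : ℝ) 1, ∀ t ∈ Icc (0 : ℝ) 1, |s - u| < ε →
      |t - u| < ε → d (c s) (c t) = |s - t| * D) : d (c 0) (c 1) = D := by
  set S : Set ℝ := {s | s ∈ Icc (0 : ℝ) 1 ∧ ∀ t ∈ Icc (0 : ℝ) s, d (c 0) (c t) = t * D} with hS
  have h0S : (0 : ℝ) ∈ S := by
    refine ⟨by simp, fun t ht => ?_⟩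
    have : t = 0 := le_antisymm ht.2 ht.1
    rw [this, h.self, zero_mul]
  have hbdd : BddAbove S := ⟨1, fun s hs => hs.1.2⟩
  set m := sSup S with hm
  have hm0 : 0 ≤ m := le_csSup hbdd h0S
  have hm1 : m ≤ 1 := csSup_le ⟨0, h0S⟩ fun s hs => hs.1.2
  have hlt : ∀ t, 0 ≤ t → t < m → d (c 0) (c t) = t * D := by
    intro t ht htm
    obtain ⟨s, hs, hts⟩ := exists_lt_of_lt_csSup ⟨0, h0S⟩ htm
    exact hs.2 t ⟨ht, hts.le⟩
  obtain ⟨ε, hε, H⟩ := hc m ⟨hm0, hm1⟩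
  -- extension past `m`
  have key : ∀ t ∈ Icc (0 : ℝ) 1, |t - m| < ε / 2 → m ≤ t → d (c 0) (c t) = t * D := by
    intro t ht htm hmt
    rcases eq_or_lt_of_le hm0 with hm00 | hm00
    · have := H 0 (by simp) t ht (by rw [← hm00]; simpa using hε) (by linarith)
      rw [this, zero_sub, abs_neg, abs_of_nonneg ht.1]
    · set s := max (m / 2) (m - ε / 4) with hs
      set r := max (3 * m / 4) (m - ε / 8) with hr
      have hs0 : 0 < s := lt_of_lt_of_le (by linarith) (le_max_left _ _)
      have hsm : s < r := by
        rw [hs, hr]; apply max_lt_max <;> linarith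
      have hrm : r < m := max_lt (by linarith) (by linarith)
      have hsε : |s - m| < ε := by
        rw [abs_sub_comm, abs_of_nonneg (by linarith)]
        linarith [le_max_right (m / 2) (m - ε / 4)]
      have hrε : |r - m| < ε := by
        rw [abs_sub_comm, abs_of_nonneg (by linarith)]
        linarith [le_max_right (3 * m / 4) (m - ε / 8)]
      have hsI : s ∈ Icc (0 : ℝ) 1 := ⟨hs0.le, by linarith⟩
      have hrI : r ∈ Icc (0 : ℝ) 1 := ⟨by linarith, by linarith⟩
      have e1 := hlt s hs0.le (by linarith)
      have e2 := hlt r (by linarith) hrm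
      have e3 := H s hsI r hrI hsε hrε
      have e4 := H s hsI t ht hsε (by linarith)
      have e5 := H r hrI t ht hrε (by linarith)
      rw [abs_sub_comm, abs_of_nonneg (by linarith)] at e3 e4 e5
      -- `c s` lies on the geodesic from `c 0` to `c r`
      have hrpos : 0 < r := by linarith
      have hτ : s / r ∈ Icc (0 : ℝ) 1 := ⟨by positivity, by rw [div_le_one hrpos]; linarith⟩
      have e6 : c s = σ (c 0) (c r) (s / r) := by
        apply h.eq_seg hτ
        · rw [e1, e2]; exact le_of_eq (by field_simp)
        · rw [e3, e2]; exact le_of_eq (by field_simp)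
      -- `cn` is read backwards: the distances of `c t` from `c s` and `c r` are known, so the
      -- inequality bounds the distance from `c 0` to `c t` from below. The triangle inequality
      -- gives the upper bound.
      have e7 := h.cn (c 0) (c r) (c t) (s / r) hτ
      rw [← e6, h.comm _ (c s), h.comm _ (c 0), h.comm _ (c r), e4, e5, e2] at e7
      have e8 : (t * D) ^ 2 ≤ d (c 0) (c t) ^ 2 := by
        have e9 := mul_le_mul_of_nonneg_left e7 hrpos.le
        have e10 : r * ((1 - s / r) * d (c 0) (c t) ^ 2 + s / r * ((t - r) * D) ^ 2 -
          s / r * (1 - s / r) * (r * D) ^ 2) = (r - s) * d (c 0) (c t) ^ 2 +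
            s * ((t - r) * D) ^ 2 - s * (r - s) * r * D ^ 2 := by field_simp
        rw [e10] at e9
        have : 0 < r - s := by linarith
        nlinarith
      have e11 : d (c 0) (c t) ≤ t * D := by
        have := h.tri (c 0) (c r) (c t)
        rw [e2, e5] at this; nlinarith
      exact le_antisymm e11 (le_of_sq_le_sq e8 (h.nonneg _ _))
  have hmS : ∀ t ∈ Icc (0 : ℝ) m, d (c 0) (c t) = t * D := by
    intro t ht
    rcases eq_or_lt_of_le ht.2 with rfl | hlt'
    · exact key _ ⟨hm0, hm1⟩ (by simpa using hε) le_rfl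
    · exact hlt t ht.1 hlt'
  by_cases hm1' : m = 1
  · have := hmS 1 ⟨zero_le_one, hm1'.ge⟩
    rwa [one_mul] at this
  · exfalso
    have hm1'' : m < 1 := lt_of_le_of_ne hm1 hm1'
    set t := min 1 (m + ε / 4) with ht
    have hmt : m < t := lt_min hm1'' (by linarith)
    have : t ∈ S := by
      refine ⟨⟨by linarith, min_le_left _ _⟩, fun u hu => ?_⟩
      by_cases hum : u ≤ m
      · exact hmS u ⟨hu.1, hum⟩
      · push Not at hum
        apply key u ⟨hu.1, hu.2.trans (min_le_left _ _)⟩ _ hum.le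
        rw [abs_of_nonneg (by linarith)]
        linarith [hu.2, min_le_right 1 (m + ε / 4)]
    linarith [le_csSup hbdd this]

end CATMetric

/-! ### The plane as a CAT(0) space, continuous induction and extrapolation -/

theorem Complex.catMetric :
    CATMetric (fun a b : ℂ => dist a b) (fun a b t => a + (t : ℂ) * (b - a)) where
  self := dist_self
  eq_of _ _ := eq_of_dist_eq_zero
  comm := dist_comm
  tri := dist_triangle
  zero a b := by simp
  one a b := by simp
  seg a b s _ t _ := by
    rw [dist_eq_norm, show a + (s : ℂ) * (b - a) - (a + (t : ℂ) * (b - a)) =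
      ((s - t : ℝ) : ℂ) * (b - a) by push_cast; ring, norm_mul, Complex.norm_real, dist_comm,
      dist_eq_norm, Real.norm_eq_abs]
  cn a b c t _ := by
    simp only [Complex.dist_eq, Complex.sq_norm, Complex.normSq_apply]
    simp
    apply le_of_eq
    ring

/-- Continuous induction on `[0, 1]`. -/
theorem forall_Icc_of_step {P : ℝ → Prop} (h0 : P 0)
    (hstep : ∀ t, 0 ≤ t → t < 1 → P t → ∃ ε > 0, ∀ s, t < s → s ≤ 1 → s < t + ε → P s)
    (hlim : ∀ t, 0 < t → t ≤ 1 → (∀ s, 0 ≤ s → s < t → P s) → P t) :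
    ∀ t ∈ Icc (0 : ℝ) 1, P t := by
  set S : Set ℝ := {s | s ∈ Icc (0 : ℝ) 1 ∧ ∀ t ∈ Icc (0 : ℝ) s, P t} with hS
  have h0S : (0 : ℝ) ∈ S := by
    refine ⟨by simp, fun t ht => ?_⟩
    rwa [le_antisymm ht.2 ht.1]
  have hbdd : BddAbove S := ⟨1, fun s hs => hs.1.2⟩
  set m := sSup S with hm
  have hm0 : 0 ≤ m := le_csSup hbdd h0S
  have hm1 : m ≤ 1 := csSup_le ⟨0, h0S⟩ fun s hs => hs.1.2
  have hlt : ∀ t, 0 ≤ t → t < m → P t := by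
    intro t ht htm
    obtain ⟨s, hs, hts⟩ := exists_lt_of_lt_csSup ⟨0, h0S⟩ htm
    exact hs.2 t ⟨ht, hts.le⟩
  have hPm : P m := by
    rcases eq_or_lt_of_le hm0 with h | h
    · rwa [← h]
    · exact hlim m h hm1 hlt
  have hmS : ∀ t ∈ Icc (0 : ℝ) m, P t := fun t ht => by
    rcases eq_or_lt_of_le ht.2 with rfl | h
    · exact hPm
    · exact hlt t ht.1 h
  by_cases hm1' : m = 1
  · rwa [hm1'] at hmS
  · exfalso
    have hm1'' : m < 1 := lt_of_le_of_ne hm1 hm1'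
    obtain ⟨ε, hε, H⟩ := hstep m hm0 hm1'' hPm
    have hmt : m < min 1 (m + ε / 2) := lt_min hm1'' (by linarith)
    have : min 1 (m + ε / 2) ∈ S := by
      refine ⟨⟨by linarith, min_le_left _ _⟩, fun u hu => ?_⟩
      by_cases hum : u ≤ m
      · exact hmS u ⟨hu.1, hum⟩
      · push Not at hum
        exact H u hum (hu.2.trans (min_le_left _ _)) (by linarith [hu.2.trans (min_le_right 1 _)])
    linarith [le_csSup hbdd this]

/-- Two quadratic polynomials in `x` agree at `0`, `η / 2` and `η`, hence also at `x = k`, where `l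
+ k = 1`. -/
theorem quadratic_extrapolate {l η k c A β G : ℝ} (hη : 0 < η) (hk : 0 < k) (hl : l + k = 1)
    (H : ∀ x ∈ Icc 0 η, A + x / k * β + (x / k) ^ 2 * G = ((l + x) * c) ^ 2) :
    A + β + G = c ^ 2 := by
  have q0 := H 0 ⟨le_rfl, hη.le⟩
  have q1 := H (η / 2) ⟨by linarith, by linarith⟩
  have q2 := H η ⟨hη.le, le_rfl⟩
  obtain ⟨u, rfl⟩ : ∃ u, β = u * k := ⟨β / k, by field_simp⟩
  obtain ⟨v, rfl⟩ : ∃ v, G = v * k ^ 2 := ⟨G / k ^ 2, by field_simp⟩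
  have e : ∀ x : ℝ, A + x / k * (u * k) + (x / k) ^ 2 * (v * k ^ 2) = A + x * u + x ^ 2 * v := by
    intro x; field_simp
  rw [e] at q0 q1 q2
  have hA : A = (l * c) ^ 2 := by linarith
  subst hA
  have r1 : u + η / 2 * v = (2 * l + η / 2) * c ^ 2 :=
    mul_left_cancel₀ (half_pos hη).ne' (by linarith)
  have r2 : u + η * v = (2 * l + η) * c ^ 2 := mul_left_cancel₀ hη.ne' (by linarith)
  have r3 : v = c ^ 2 := mul_left_cancel₀ (half_pos hη).ne' (by linarith)
  subst r3
  have r4 : u = 2 * l * c ^ 2 := by linarith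
  rw [r4, ← mul_one (c ^ 2), ← hl]
  have : k = 1 - l := by linarith
  rw [this]; ring

/-- The squared norm of an affine motion is a quadratic polynomial in `s`; if it is `s² c²` on an
interval, it is so at `s = 1`, where the motion reaches `W`. -/
theorem norm_eq_of_homogeneous {U W : ℂ} {l η c : ℝ} (hc : 0 ≤ c) (hl : l < 1) (hη : 0 < η)
    (H : ∀ s ∈ Icc l (l + η), ‖U + (((s - l) / (1 - l) : ℝ) : ℂ) * (W - U)‖ = s * c) :
    ‖W‖ = c := by
  have poly : ∀ τ : ℝ, ‖U + (τ : ℂ) * (W - U)‖ ^ 2 =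
      ‖U‖ ^ 2 + τ * (2 * (U.re * (W - U).re + U.im * (W - U).im)) + τ ^ 2 * ‖W - U‖ ^ 2 := by
    intro τ
    simp only [Complex.sq_norm, Complex.normSq_apply]
    simp
    ring
  have fin := quadratic_extrapolate (l := l) (k := 1 - l) (c := c) hη (by linarith) (by ring)
    (A := ‖U‖ ^ 2) (β := 2 * (U.re * (W - U).re + U.im * (W - U).im)) (G := ‖W - U‖ ^ 2)
    (fun x hx => by
      rw [← poly]
      have := H (l + x) ⟨by linarith [hx.1], by linarith [hx.2]⟩
      rw [add_sub_cancel_left] at this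
      rw [this])
  have p1 := poly 1
  rw [Complex.ofReal_one, one_mul, one_mul, one_pow, one_mul, fin,
    show U + (W - U) = W by ring] at p1
  exact (pow_left_inj₀ (norm_nonneg W) hc two_ne_zero).1 p1

/-! ### Homogeneous maps to the plane -/

namespace CATMetric

variable {X : Type*} {d : X → X → ℝ} {σ : X → X → ℝ → X} (h : CATMetric d σ)

include h

theorem abs_dist_sub_le (a b a' b' : X) : |d a b - d a' b'| ≤ d a a' + d b b' := by
  rw [abs_le]
  constructor
  · linarith [h.tri a' a b', h.tri a b b', h.comm a a']
  · linarith [h.tri a a' b, h.tri a' b' b, h.comm b b']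

/-- A map into the plane that is isometric on a segment maps it onto a segment. -/
theorem map_seg {f : X → ℂ} {a b : X} {t : ℝ} (ht : t ∈ Icc (0 : ℝ) 1)
    (h1 : dist (f a) (f (σ a b t)) ≤ d a (σ a b t))
    (h2 : dist (f (σ a b t)) (f b) ≤ d (σ a b t) b) (h3 : dist (f a) (f b) = d a b) :
    f (σ a b t) = f a + (t : ℂ) * (f b - f a) := by
  rw [h.dist_left a b ht, ← h3] at h1
  rw [h.dist_right a b ht, ← h3] at h2
  exact Complex.catMetric.eq_seg ht h1 h2

/-- Extension of a chart `κ` at `z` to a star-shaped set, homogeneous along the geodesics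
from `z`. -/
theorem exists_log {C : Set X} {z : X} {κ : X → ℂ} {ρ M : ℝ} (hρ : 0 < ρ) (hz : z ∈ C)
    (hstar : ∀ x ∈ C, ∀ t ∈ Icc (0 : ℝ) 1, σ z x t ∈ C) (hM : ∀ x ∈ C, d z x ≤ M)
    (hκz : κ z = 0)
    (hκ : ∀ a ∈ C, ∀ b ∈ C, d z a < ρ → d z b < ρ → dist (κ a) (κ b) = d a b) :
    ∃ f : X → ℂ, (∀ a ∈ C, ∀ b ∈ C, dist (f a) (f b) ≤ d a b) ∧
      (∀ x ∈ C, ∀ t ∈ Icc (0 : ℝ) 1, f (σ z x t) = (t : ℂ) * f x) ∧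
      (∀ x ∈ C, d z x < ρ → f x = κ x) ∧ ∀ x ∈ C, ‖f x‖ = d z x := by
  have hM0 : 0 ≤ M := (h.nonneg z z).trans (hM z hz)
  -- Contraction towards `z` by the factor `l` brings all of `C` into the ball of radius `ρ`, where
  -- `κ` is isometric.
  set l : ℝ := min 1 (ρ / (2 * (M + 1))) with hl
  have hl0 : 0 < l := lt_min one_pos (by positivity)
  have hlI : l ∈ Icc (0 : ℝ) 1 := ⟨hl0.le, min_le_left _ _⟩
  have hlM : ∀ x ∈ C, d z (σ z x l) < ρ := by
    intro x hx
    rw [h.dist_left z x hlI]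
    have h1 : l ≤ ρ / (2 * (M + 1)) := min_le_right _ _
    have h2 : l * (2 * (M + 1)) ≤ ρ := by rwa [le_div_iff₀ (by positivity)] at h1
    nlinarith [hM x hx, h.nonneg z x]
  have hκhom : ∀ x ∈ C, d z x < ρ → ∀ t ∈ Icc (0 : ℝ) 1, κ (σ z x t) = (t : ℂ) * κ x := by
    intro x hx hxρ t ht
    have hxt : d z (σ z x t) < ρ := by
      rw [h.dist_left z x ht]; nlinarith [ht.2, h.nonneg z x]
    have hzz : d z z < ρ := by rwa [h.self]
    have := h.map_seg (f := κ) (a := z) (b := x) ht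
      (hκ z hz _ (hstar x hx t ht) hzz hxt).le
      (hκ _ (hstar x hx t ht) x hx hxt hxρ).le (hκ z hz x hx hzz hxρ)
    rw [this, hκz, zero_add, sub_zero]
  have hl0' : (l : ℂ) ≠ 0 := by exact_mod_cast hl0.ne'
  have hnorm : ∀ x ∈ C, d z x < ρ → ‖κ x‖ = d z x := by
    intro x hx hxρ
    have := hκ z hz x hx (by rwa [h.self]) hxρ
    rwa [hκz, dist_zero_left] at this
  -- Contract, apply the chart, scale back. Thales' inequality makes this nonexpanding.
  refine ⟨fun x => κ (σ z x l) / l, ?_, ?_, ?_, ?_⟩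
  · intro a ha b hb
    have h1 := hκ _ (hstar a ha l hlI) _ (hstar b hb l hlI) (hlM a ha) (hlM b hb)
    rw [dist_eq_norm] at h1 ⊢
    rw [← sub_div, norm_div, h1, Complex.norm_real, Real.norm_eq_abs, abs_of_pos hl0,
      div_le_iff₀ hl0, mul_comm]
    exact h.thales z a b hlI
  · intro x hx t ht
    have h1 : σ z (σ z x t) l = σ z (σ z x l) t := by
      rw [h.seg_seg z x ht hlI, h.seg_seg z x hlI ht, mul_comm]
    simp only
    rw [h1, hκhom _ (hstar x hx l hlI) (hlM x hx) t ht, mul_div_assoc]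
  · intro x hx hxρ
    simp only
    rw [hκhom x hx hxρ l hlI, mul_div_cancel_left₀ _ hl0']
  · intro x hx
    simp only
    rw [norm_div, hnorm _ (hstar x hx l hlI) (hlM x hx), Complex.norm_real, Real.norm_eq_abs,
      abs_of_pos hl0, h.dist_left z x hlI, mul_div_cancel_left₀ _ hl0.ne']

/-- If every point of the geodesic from `z` to `y` has a planar neighbourhood in `C`, then a
homogeneous map that is isometric near `z` is isometric near `y`. -/
theorem isometric_near {C : Set X} {z : X} {f : X → ℂ}
    (hstar : ∀ x ∈ C, ∀ t ∈ Icc (0 : ℝ) 1, σ z x t ∈ C)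
    (hhom : ∀ x ∈ C, ∀ t ∈ Icc (0 : ℝ) 1, f (σ z x t) = (t : ℂ) * f x)
    (hz : ∃ r > 0, ∀ a ∈ C, ∀ b ∈ C, d z a < r → d z b < r → dist (f a) (f b) = d a b)
    {y : X} (hy : y ∈ C)
    (hplanar : ∀ t ∈ Icc (0 : ℝ) 1, ∃ r > 0, ∃ ψ : X → ℂ, ∀ a ∈ C, ∀ b ∈ C,
      d (σ z y t) a < r → d (σ z y t) b < r → dist (ψ a) (ψ b) = d a b) :
    ∃ r > 0, ∀ a ∈ C, ∀ b ∈ C, d y a < r → d y b < r → dist (f a) (f b) = d a b := by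
  suffices ∀ t ∈ Icc (0 : ℝ) 1, ∃ r > 0, ∀ a ∈ C, ∀ b ∈ C, d (σ z y t) a < r →
      d (σ z y t) b < r → dist (f a) (f b) = d a b by
    simpa [h.one] using this 1 (by simp)
  apply forall_Icc_of_step
  · simpa [h.zero] using hz
  · rintro t ht0 ht1 ⟨r, hr, H⟩
    refine ⟨r / (2 * (d z y + 1)), by have := h.nonneg z y; positivity, fun s hts hs1 hs => ?_⟩
    have hn := h.nonneg z y
    have h1 : d (σ z y t) (σ z y s) < r / 2 := by
      rw [h.seg z y t ⟨ht0, ht1.le⟩ s ⟨by linarith, hs1⟩, abs_sub_comm,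
        abs_of_nonneg (by linarith)]
      have h2 : s - t < r / (2 * (d z y + 1)) := by linarith
      rw [lt_div_iff₀ (by positivity)] at h2
      nlinarith
    refine ⟨r / 2, by linarith, fun a ha b hb hda hdb => H a ha b hb ?_ ?_⟩
    · linarith [h.tri (σ z y t) (σ z y s) a]
    · linarith [h.tri (σ z y t) (σ z y s) b]
  · intro t ht0 ht1 hI
    -- Limit step. The planar chart `ψ` at `y'` straightens the last parts of the radial geodesics
    -- to `a` and `b`, so the squared distance of their points at ratio `s` is quadratic in `s`. For
    -- `s` slightly below `1` it equals `s²` times the squared distance of `f a` and `f b`, by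
    -- homogeneity and the induction hypothesis; this persists up to `s = 1`.
    obtain ⟨r, hr, ψ, hψ⟩ := hplanar t ⟨ht0.le, ht1⟩
    set y' := σ z y t with hy'
    have hy'C : y' ∈ C := hstar y hy t ⟨ht0.le, ht1⟩
    set L := d z y' with hL
    have hL0 : 0 ≤ L := h.nonneg _ _
    have hI' : ∀ s, 0 ≤ s → s < 1 → ∃ r > 0, ∀ a ∈ C, ∀ b ∈ C, d (σ z y' s) a < r →
        d (σ z y' s) b < r → dist (f a) (f b) = d a b := by
      intro s hs0 hs1
      have := hI (s * t) (by positivity) (by nlinarith)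
      rwa [← h.seg_seg z y ⟨ht0.le, ht1⟩ ⟨hs0, hs1.le⟩] at this
    -- `l₁` is close enough to `1` for the radial pieces to stay in the domain of `ψ`; `δ` and `η`
    -- keep the pieces over `[l₂, l₁]` also in the ball of radius `r₁` where the induction
    -- hypothesis holds.
    set l₁ : ℝ := 1 - min (1 / 2) (r / (4 * (L + 1))) with hl₁
    have hm0 : 0 < min (1 / 2) (r / (4 * (L + 1))) := lt_min (by norm_num) (by positivity)
    have hm1 : min (1 / 2) (r / (4 * (L + 1))) ≤ 1 / 2 := min_le_left _ _
    have hm2 : (1 - l₁) * L ≤ r / 4 := by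
      have : min (1 / 2) (r / (4 * (L + 1))) ≤ r / (4 * (L + 1)) := min_le_right _ _
      rw [le_div_iff₀ (by positivity)] at this
      rw [hl₁]; nlinarith
    obtain ⟨r₁, hr₁, H⟩ := hI' l₁ (by linarith) (by linarith)
    set δ := min r₁ r / 4 with hδ
    have hδ0 : 0 < δ := by have := lt_min hr₁ hr; positivity
    have hδ1 : δ ≤ r₁ / 4 := by rw [hδ]; linarith [min_le_left r₁ r]
    have hδ2 : δ ≤ r / 4 := by rw [hδ]; linarith [min_le_right r₁ r]
    set η := min (1 / 4) (δ / (L + 1)) with hη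
    have hη0 : 0 < η := lt_min (by norm_num) (by positivity)
    have hη1 : η ≤ 1 / 4 := min_le_left _ _
    have hη2 : η * L ≤ δ := by
      have : η ≤ δ / (L + 1) := min_le_right _ _
      rw [le_div_iff₀ (by positivity)] at this
      nlinarith
    set l₂ := l₁ - η with hl₂
    have hl₂0 : 0 < l₂ := by rw [hl₂]; linarith
    have hl₂1 : l₂ < 1 := by linarith
    refine ⟨δ, hδ0, fun a ha b hb hda hdb => ?_⟩
    -- points between `l₂` and `l₁`
    have near₁ : ∀ x, d y' x < δ → ∀ s ∈ Icc l₂ l₁, d (σ z y' l₁) (σ z x s) < r₁ := by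
      intro x hx s hs
      have hsI : s ∈ Icc (0 : ℝ) 1 := ⟨by linarith [hs.1], by linarith [hs.2]⟩
      have e1 := h.tri (σ z y' l₁) (σ z y' s) (σ z x s)
      have e2 := h.thales z y' x hsI
      rw [h.seg z y' l₁ ⟨by linarith, by linarith⟩ s hsI, abs_of_nonneg (by linarith [hs.2])] at e1
      have e3 : (l₁ - s) * L ≤ η * L := mul_le_mul_of_nonneg_right (by linarith [hs.1]) hL0
      have e4 : s * d y' x ≤ d y' x := mul_le_of_le_one_left (h.nonneg _ _) hsI.2
      linarith
    have near₂ : ∀ x, d y' x < δ → ∀ s ∈ Icc l₂ 1, d y' (σ z x s) < r := by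
      intro x hx s hs
      have hsI : s ∈ Icc (0 : ℝ) 1 := ⟨by linarith [hs.1], hs.2⟩
      have e1 := h.tri y' (σ z y' s) (σ z x s)
      have e2 := h.thales z y' x hsI
      rw [h.comm y' (σ z y' s), h.dist_right z y' hsI] at e1
      have e3 : (1 - s) * L ≤ (1 - l₁) * L + η * L := by nlinarith [hs.1]
      have e4 : s * d y' x ≤ d y' x := mul_le_of_le_one_left (h.nonneg _ _) hsI.2
      linarith
    have aff : ∀ x ∈ C, d y' x < δ → ∀ s ∈ Icc l₂ 1, ψ (σ z x s) =
        ψ (σ z x l₂) + (((s - l₂) / (1 - l₂) : ℝ) : ℂ) * (ψ x - ψ (σ z x l₂)) := by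
      intro x hx hxd s hs
      have hsI : s ∈ Icc (0 : ℝ) 1 := ⟨by linarith [hs.1], hs.2⟩
      have hl₂I : l₂ ∈ Icc (0 : ℝ) 1 := ⟨hl₂0.le, hl₂1.le⟩
      have h12 : 0 < 1 - l₂ := by linarith
      have n0 := near₂ x hxd l₂ ⟨le_rfl, hl₂1.le⟩
      have n1 := near₂ x hxd s hs
      have n2 := near₂ x hxd 1 ⟨hl₂1.le, le_rfl⟩
      rw [h.one] at n2
      have c0 := hstar x hx l₂ hl₂I
      have c1 := hstar x hx s hsI
      have e0 := hψ _ c0 x hx n0 n2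
      have e1 := hψ _ c0 _ c1 n0 n1
      have e2 := hψ _ c1 x hx n1 n2
      rw [h.dist_right z x hl₂I] at e0
      rw [h.seg z x _ hl₂I _ hsI, abs_sub_comm, abs_of_nonneg (by linarith [hs.1])] at e1
      rw [h.dist_right z x hsI] at e2
      apply Complex.catMetric.eq_seg (t := (s - l₂) / (1 - l₂))
      · exact ⟨div_nonneg (by linarith [hs.1]) h12.le, by rw [div_le_one h12]; linarith [hs.2]⟩
      · rw [e0, e1]; apply le_of_eq; field_simp
      · rw [e0, e2]; apply le_of_eq; field_simp; ring
    set c := dist (f a) (f b) with hc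
    have quad : ∀ s ∈ Icc l₂ l₁, dist (ψ (σ z a s)) (ψ (σ z b s)) = s * c := by
      intro s hs
      have hsI : s ∈ Icc (0 : ℝ) 1 := ⟨by linarith [hs.1], by linarith [hs.2]⟩
      have hs' : s ∈ Icc l₂ 1 := ⟨hs.1, hsI.2⟩
      have ca := hstar a ha s hsI
      have cb := hstar b hb s hsI
      rw [hψ _ ca _ cb (near₂ a hda s hs') (near₂ b hdb s hs'),
        ← H _ ca _ cb (near₁ a hda s hs) (near₁ b hdb s hs), hhom a ha s hsI, hhom b hb s hsI,
        dist_eq_norm, ← mul_sub, norm_mul, Complex.norm_real, Real.norm_eq_abs,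
        abs_of_nonneg hsI.1, hc, dist_eq_norm]
    -- the square of the distance is a quadratic polynomial
    set U := ψ (σ z a l₂) - ψ (σ z b l₂) with hU
    set W := ψ a - ψ b with hW
    have sq : ∀ s ∈ Icc l₂ 1, dist (ψ (σ z a s)) (ψ (σ z b s)) =
        ‖U + (((s - l₂) / (1 - l₂) : ℝ) : ℂ) * (W - U)‖ := by
      intro s hs
      rw [aff a ha hda s hs, aff b hb hdb s hs, dist_eq_norm]
      congr 1
      rw [hU, hW]; ring
    have n2a := near₂ a hda 1 ⟨hl₂1.le, le_rfl⟩
    have n2b := near₂ b hdb 1 ⟨hl₂1.le, le_rfl⟩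
    rw [h.one] at n2a n2b
    rw [← hψ a ha b hb n2a n2b, dist_eq_norm, ← hW]
    exact (norm_eq_of_homogeneous dist_nonneg hl₂1 hη0 fun s hs => by
      rw [← sq s ⟨hs.1, by linarith [hs.2]⟩, quad s ⟨hs.1, by linarith [hs.2]⟩]).symm

end CATMetric

/-! ### Flat cones, swept out by chords -/

theorem Complex.eq_zero_of_indep {P Q : ℂ} (hPQ : P.re * Q.im - P.im * Q.re ≠ 0) {a b : ℝ}
    (hab : (a : ℂ) * P + (b : ℂ) * Q = 0) : a = 0 ∧ b = 0 := by
  have h1 : a * P.re + b * Q.re = 0 := by simpa using congrArg Complex.re hab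
  have h2 : a * P.im + b * Q.im = 0 := by simpa using congrArg Complex.im hab
  constructor
  · refine (mul_eq_zero.1 (?_ : a * (P.re * Q.im - P.im * Q.re) = 0)).resolve_right hPQ
    linear_combination Q.im * h1 - Q.re * h2
  · refine (mul_eq_zero.1 (?_ : b * (P.re * Q.im - P.im * Q.re) = 0)).resolve_right hPQ
    linear_combination P.re * h2 - P.im * h1

/-- A star-shaped region `C` with apex `z`, and a homogeneous nonexpanding map `f` of `C` to the
plane that is isometric near the points that are not behind `p` or `q`. -/
structure FlatCone {X : Type*} (d : X → X → ℝ) (σ : X → X → ℝ → X) (C : Set X) (z p q : X)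
    (f : X → ℂ) : Prop where
  cat : CATMetric d σ
  fst_mem : p ∈ C
  snd_mem : q ∈ C
  star : ∀ x ∈ C, ∀ t ∈ Icc (0 : ℝ) 1, σ z x t ∈ C
  closed : ∀ x, (∀ ε > 0, ∃ y ∈ C, d x y < ε) → x ∈ C
  lip : ∀ a ∈ C, ∀ b ∈ C, dist (f a) (f b) ≤ d a b
  hom : ∀ x ∈ C, ∀ t ∈ Icc (0 : ℝ) 1, f (σ z x t) = (t : ℂ) * f x
  norm_eq : ∀ x ∈ C, ‖f x‖ = d z x
  isom : ∀ y ∈ C, (∀ t ∈ Icc (0 : ℝ) 1, σ z y t ≠ p ∧ σ z y t ≠ q) →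
    ∃ r > 0, ∀ a ∈ C, ∀ b ∈ C, d y a < r → d y b < r → dist (f a) (f b) = d a b
  convex : ∀ y ∈ C, y ≠ p → y ≠ q → ∃ r > 0, ∀ a ∈ C, ∀ b ∈ C, d y a < r → d y b < r →
    ∀ t ∈ Icc (0 : ℝ) 1, σ a b t ∈ C
  opn : ∀ y ∈ C, (∀ t ∈ Icc (0 : ℝ) 1, y ≠ σ z p t) → (∀ t ∈ Icc (0 : ℝ) 1, y ≠ σ z q t) →
    ∃ r > 0, ∀ a, d y a < r → a ∈ C
  indep : (f p).re * (f q).im - (f p).im * (f q).re ≠ 0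

namespace FlatCone

variable {X : Type*} {d : X → X → ℝ} {σ : X → X → ℝ → X} {C : Set X} {z p q : X} {f : X → ℂ}
  (H : FlatCone d σ C z p q f)

include H

theorem symm : FlatCone d σ C z q p f where
  cat := H.cat
  fst_mem := H.snd_mem
  snd_mem := H.fst_mem
  star := H.star
  closed := H.closed
  lip := H.lip
  hom := H.hom
  norm_eq := H.norm_eq
  isom y hy hy' := H.isom y hy fun t ht => (hy' t ht).symm
  convex y hy hp hq := H.convex y hy hq hp
  opn y hy hp hq := H.opn y hy hq hp
  indep := fun e => H.indep (by linarith)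

theorem apex_mem : z ∈ C := by
  have := H.star p H.fst_mem 0 (by simp)
  rwa [H.cat.zero] at this

theorem map_apex : f z = 0 := by
  have := H.hom p H.fst_mem 0 (by simp)
  rwa [H.cat.zero, Complex.ofReal_zero, zero_mul] at this

theorem dist_chord_le (s s' τ τ' : ℝ) (hs : s ∈ Icc (0 : ℝ) 1) (hs' : s' ∈ Icc (0 : ℝ) 1)
    (hτ : τ ∈ Icc (0 : ℝ) 1) (hτ' : τ' ∈ Icc (0 : ℝ) 1) :
    d (σ (σ z p s) (σ z q s) τ) (σ (σ z p s') (σ z q s') τ') ≤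
      |s - s'| * (d z p + d z q) + |τ - τ'| * d (σ z p s) (σ z q s) := by
  have h := H.cat
  have h1 := h.tri (σ (σ z p s) (σ z q s) τ) (σ (σ z p s) (σ z q s) τ')
    (σ (σ z p s') (σ z q s') τ')
  rw [h.seg _ _ τ hτ τ' hτ'] at h1
  have h2 := h.seg_convex (σ z p s) (σ z q s) (σ z p s') (σ z q s') hτ'
  rw [h.seg z p s hs s' hs', h.seg z q s hs s' hs'] at h2
  have h3 : 0 ≤ |s - s'| * d z p := mul_nonneg (abs_nonneg _) (h.nonneg _ _)
  have h4 : 0 ≤ |s - s'| * d z q := mul_nonneg (abs_nonneg _) (h.nonneg _ _)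
  nlinarith [hτ'.1, hτ'.2, mul_le_of_le_one_left h3 (by linarith [hτ'.1] : 1 - τ' ≤ 1),
    mul_le_of_le_one_left h4 hτ'.2]

/-- The points of a chord, in the plane. -/
theorem map_chord {s : ℝ} (hs : s ∈ Icc (0 : ℝ) 1)
    (hC : ∀ τ ∈ Icc (0 : ℝ) 1, σ (σ z p s) (σ z q s) τ ∈ C)
    (hD : d (σ z p s) (σ z q s) = s * dist (f p) (f q)) {τ : ℝ} (hτ : τ ∈ Icc (0 : ℝ) 1) :
    f (σ (σ z p s) (σ z q s) τ) = (((1 - τ) * s : ℝ) : ℂ) * f p + ((τ * s : ℝ) : ℂ) * f q := by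
  have h := H.cat
  have ca := H.star p H.fst_mem s hs
  have cb := H.star q H.snd_mem s hs
  have := h.map_seg (f := f) hτ (H.lip _ ca _ (hC τ hτ)) (H.lip _ (hC τ hτ) _ cb) (by
    rw [hD, H.hom p H.fst_mem s hs, H.hom q H.snd_mem s hs, dist_eq_norm, ← mul_sub, norm_mul,
      Complex.norm_real, Real.norm_eq_abs, abs_of_nonneg hs.1, dist_eq_norm])
  rw [this, H.hom p H.fst_mem s hs, H.hom q H.snd_mem s hs]
  push_cast; ring

/-- A point of a chord is not behind `p`. -/
theorem chord_front {s : ℝ} (hs0 : 0 ≤ s) (hs1 : s < 1)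
    (hC : ∀ τ ∈ Icc (0 : ℝ) 1, σ (σ z p s) (σ z q s) τ ∈ C)
    (hD : d (σ z p s) (σ z q s) = s * dist (f p) (f q)) {τ : ℝ} (hτ : τ ∈ Icc (0 : ℝ) 1)
    {t : ℝ} (ht : t ∈ Icc (0 : ℝ) 1) : σ z (σ (σ z p s) (σ z q s) τ) t ≠ p := by
  intro e
  have h1 := H.hom _ (hC τ hτ) t ht
  rw [e, H.map_chord ⟨hs0, hs1.le⟩ hC hD hτ] at h1
  -- Compare the coefficients of `f p`: on the radial geodesic to the chord point it is at most `s <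
  -- 1`, while at `p` it is `1`.
  have h2 := (Complex.eq_zero_of_indep H.indep (a := t * ((1 - τ) * s) - 1) (b := t * (τ * s)) (by
    push_cast at h1 ⊢; linear_combination -h1)).1
  have : t * ((1 - τ) * s) ≤ s := by
    have h3 : (1 - τ) * s ≤ s := mul_le_of_le_one_left hs0 (by linarith [hτ.1])
    have h4 : 0 ≤ (1 - τ) * s := mul_nonneg (by linarith [hτ.2]) hs0
    exact (mul_le_of_le_one_left h4 ht.2).trans h3
  linarith

/-- The image of the chord point has the positive coefficient `τ s` at `f q`; the image of a point
of the side to `p` has none. -/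
theorem chord_not_side {s : ℝ} (hs0 : 0 < s) (hs1 : s ≤ 1)
    (hC : ∀ τ ∈ Icc (0 : ℝ) 1, σ (σ z p s) (σ z q s) τ ∈ C)
    (hD : d (σ z p s) (σ z q s) = s * dist (f p) (f q)) {τ : ℝ} (hτ0 : 0 < τ) (hτ1 : τ ≤ 1)
    {t : ℝ} (ht : t ∈ Icc (0 : ℝ) 1) : σ (σ z p s) (σ z q s) τ ≠ σ z p t := by
  intro e
  have h1 := H.hom p H.fst_mem t ht
  rw [← e, H.map_chord ⟨hs0.le, hs1⟩ hC hD ⟨hτ0.le, hτ1⟩] at h1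
  have h2 := (Complex.eq_zero_of_indep H.indep (a := (1 - τ) * s - t) (b := τ * s) (by
    push_cast at h1 ⊢; linear_combination h1)).2
  have := mul_pos hτ0 hs0
  linarith

/-- The point `p` lies on the geodesic from `z` to `y` exactly when the triangle inequality through
`p` is an equality. A strict inequality persists near `y`, here within half of the gap. -/
theorem front_near {y : X} (hy : ∀ t ∈ Icc (0 : ℝ) 1, σ z y t ≠ p) :
    ∃ r > 0, ∀ a, d y a < r → ∀ t ∈ Icc (0 : ℝ) 1, σ z a t ≠ p := by
  have h := H.cat
  have hgap : d z y < d z p + d p y := by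
    refine lt_of_le_of_ne (h.tri z p y) fun e => ?_
    obtain ⟨t, ht, e'⟩ := h.exists_of_between e.symm
    exact hy t ht e'.symm
  refine ⟨(d z p + d p y - d z y) / 2, by linarith, fun a ha t ht e => ?_⟩
  have h1 := h.between_seg z a ht
  rw [e] at h1
  linarith [h.tri p a y, h.tri z y a, h.comm a y]

/-- The chords near a given one start in `C`. -/
theorem chord_start {S : ℝ} (hS0 : 0 < S) (hS1 : S < 1)
    (hC : ∀ τ ∈ Icc (0 : ℝ) 1, σ (σ z p S) (σ z q S) τ ∈ C)
    (hD : d (σ z p S) (σ z q S) = S * dist (f p) (f q))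
    (hint : ∀ τ, 0 < τ → τ < 1 → ∃ ε > 0, ∀ s ∈ Icc (0 : ℝ) 1, |s - S| < ε →
      σ (σ z p s) (σ z q s) τ ∈ C) :
    ∃ ε > 0, ∀ s ∈ Icc (0 : ℝ) 1, |s - S| < ε → ∀ τ ∈ Icc (0 : ℝ) 1, τ < ε →
      σ (σ z p s) (σ z q s) τ ∈ C := by
  have h := H.cat
  have hSI : S ∈ Icc (0 : ℝ) 1 := ⟨hS0.le, hS1.le⟩
  have h0I : (0 : ℝ) ∈ Icc (0 : ℝ) 1 := by simp
  have hp : σ z p S ≠ p := by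
    have := H.chord_front hS0.le hS1 hC hD h0I (t := 1) (by simp)
    rwa [h.one, h.zero] at this
  have hq : σ z p S ≠ q := by
    have hC' : ∀ τ ∈ Icc (0 : ℝ) 1, σ (σ z q S) (σ z p S) τ ∈ C := fun τ hτ => by
      have hτ' : 1 - τ ∈ Icc (0 : ℝ) 1 := ⟨by linarith [hτ.2], by linarith [hτ.1]⟩
      rw [← h.seg_symm _ _ hτ]; exact hC _ hτ'
    have := H.symm.chord_front hS0.le hS1 hC' (by rw [h.comm, hD, dist_comm]) (τ := 1) (by simp)
      (t := 1) (by simp)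
    rwa [h.one, h.one] at this
  obtain ⟨r, hr, hconv⟩ := H.convex _ (H.star p H.fst_mem S hSI) hp hq
  have hnp := h.nonneg z p
  have hnq := h.nonneg z q
  have hnD := h.nonneg (σ z p S) (σ z q S)
  set D := d (σ z p S) (σ z q S) with hDdef
  -- The chord point at ratio `η` lies in `C` by `hint`, and it is still in the ball around the foot
  -- of the chord in which `C` is convex. So the piece from the foot to that point lies in `C`.
  set η := min (1 / 2) (r / (4 * (D + 1))) with hη
  have hη0 : 0 < η := lt_min (by norm_num) (by positivity)
  have hη1 : η ≤ 1 / 2 := min_le_left _ _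
  have hη2 : η * D ≤ r / 4 := by
    have : η ≤ r / (4 * (D + 1)) := min_le_right _ _
    rw [le_div_iff₀ (by positivity)] at this
    nlinarith
  obtain ⟨ε, hε, hmem⟩ := hint η hη0 (by linarith)
  set k := r / (4 * (d z p + d z q + 1)) with hk
  have hk0 : 0 < k := by positivity
  have hk1 : k * (d z p + d z q) ≤ r / 4 := by
    have : k * (4 * (d z p + d z q + 1)) = r := by rw [hk]; field_simp
    nlinarith
  have hηI : η ∈ Icc (0 : ℝ) 1 := ⟨hη0.le, by linarith⟩
  refine ⟨min η (min ε k), lt_min hη0 (lt_min hε hk0), fun s hs hsS τ hτ hτε => ?_⟩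
  have e1 : |s - S| < ε := hsS.trans_le ((min_le_right _ _).trans (min_le_left _ _))
  have e2 : |s - S| < k := hsS.trans_le ((min_le_right _ _).trans (min_le_right _ _))
  have e3 : τ < η := hτε.trans_le (min_le_left _ _)
  have e4 : |S - s| * (d z p + d z q) ≤ r / 4 := by
    rw [abs_sub_comm]
    exact (mul_le_mul_of_nonneg_right e2.le (by linarith)).trans hk1
  have b1 := H.dist_chord_le S s 0 0 hSI hs h0I h0I
  have b2 := H.dist_chord_le S s 0 η hSI hs h0I hηI
  rw [h.zero] at b1 b2
  rw [h.zero] at b1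
  rw [sub_self, abs_zero, zero_mul, add_zero] at b1
  rw [zero_sub, abs_neg, abs_of_pos hη0] at b2
  have := hconv _ (H.star p H.fst_mem s hs) _ (hmem s hs e1) (by linarith) (by linarith) (τ / η)
    ⟨div_nonneg hτ.1 hη0.le, by rw [div_le_one hη0]; exact e3.le⟩
  rwa [h.seg_seg _ _ hηI ⟨div_nonneg hτ.1 hη0.le, by rw [div_le_one hη0]; exact e3.le⟩,
    div_mul_cancel₀ _ hη0.ne'] at this

/-- If a chord consists of points of `C` that are not behind `p` or `q`, its image in the plane
is straight. -/
theorem chord_eq {s : ℝ} (hs : s ∈ Icc (0 : ℝ) 1)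
    (hC : ∀ τ ∈ Icc (0 : ℝ) 1, σ (σ z p s) (σ z q s) τ ∈ C)
    (hfr : ∀ τ ∈ Icc (0 : ℝ) 1, ∀ t ∈ Icc (0 : ℝ) 1, σ z (σ (σ z p s) (σ z q s) τ) t ≠ p ∧
      σ z (σ (σ z p s) (σ z q s) τ) t ≠ q) :
    d (σ z p s) (σ z q s) = s * dist (f p) (f q) := by
  have h := H.cat
  set a := σ z p s with ha
  set b := σ z q s with hb
  have hn := h.nonneg a b
  -- The image of the chord is a local geodesic of the plane with speed `d a b`, so its ends are at
  -- distance `d a b`.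
  have := Complex.catMetric.of_local (c := fun τ => f (σ a b τ)) (D := d a b) (by
    intro u hu
    obtain ⟨r, hr, hiso⟩ := H.isom _ (hC u hu) (hfr u hu)
    refine ⟨r / (d a b + 1), by positivity, fun t ht t' ht' htu htu' => ?_⟩
    have key : ∀ t ∈ Icc (0 : ℝ) 1, |t - u| < r / (d a b + 1) → d (σ a b u) (σ a b t) < r := by
      intro t ht htu
      rw [h.seg a b u hu t ht, abs_sub_comm]
      rw [lt_div_iff₀ (by positivity)] at htu
      nlinarith [abs_nonneg (t - u)]
    rw [hiso _ (hC t ht) _ (hC t' ht') (key t ht htu) (key t' ht' htu'), h.seg a b t ht t' ht'])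
  simp only [h.zero, h.one] at this
  rw [← this, ha, hb, H.hom p H.fst_mem s hs, H.hom q H.snd_mem s hs, dist_eq_norm, ← mul_sub,
    norm_mul, Complex.norm_real, Real.norm_eq_abs, abs_of_nonneg hs.1, dist_eq_norm]

/-- The geodesic from `p` to `q` lies in `C` and has the same length as its image in the plane. -/
theorem base : (∀ τ ∈ Icc (0 : ℝ) 1, σ p q τ ∈ C) ∧ d p q = dist (f p) (f q) := by
  have h := H.cat
  have hnp := h.nonneg z p
  have hnq := h.nonneg z q
  -- The chords are swept from the apex to the base by continuous induction on `s`; both properties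
  -- are carried together because the second one locates the image of the chord in the plane.
  suffices ∀ s ∈ Icc (0 : ℝ) 1, (∀ τ ∈ Icc (0 : ℝ) 1, σ (σ z p s) (σ z q s) τ ∈ C) ∧
      d (σ z p s) (σ z q s) = s * dist (f p) (f q) by
    have := this 1 (by simp)
    rwa [h.one, h.one, one_mul] at this
  have hpz : z ≠ p := fun e => H.indep (by rw [← e, H.map_apex]; simp)
  have hqz : z ≠ q := fun e => H.indep (by rw [← e, H.map_apex]; simp)
  have hzz : ∀ t ∈ Icc (0 : ℝ) 1, σ z z t = z := fun t ht =>
    (h.eq_seg ht (by simp [h.self]) (by simp [h.self])).symm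
  apply forall_Icc_of_step
  · rw [h.zero, h.zero, h.self, zero_mul]
    exact ⟨fun τ hτ => by rw [hzz τ hτ]; exact H.apex_mem, rfl⟩
  · rintro S hS0 hS1 ⟨hC, hD⟩
    rcases eq_or_lt_of_le hS0 with rfl | hS0
    · -- near the apex
      obtain ⟨r, hr, hconv⟩ := H.convex z H.apex_mem hpz hqz
      obtain ⟨r', hr', hiso⟩ := H.isom z H.apex_mem fun t ht => by
        rw [hzz t ht]; exact ⟨hpz, hqz⟩
      refine ⟨min r r' / (d z p + d z q + 1), by positivity, fun s hs0 hs1 hs => ?_⟩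
      have hsI : s ∈ Icc (0 : ℝ) 1 := ⟨hs0.le, hs1⟩
      rw [zero_add, lt_div_iff₀ (by positivity)] at hs
      have e1 : d z (σ z p s) < min r r' := by rw [h.dist_left z p hsI]; nlinarith
      have e2 : d z (σ z q s) < min r r' := by rw [h.dist_left z q hsI]; nlinarith
      have ca := H.star p H.fst_mem s hsI
      have cb := H.star q H.snd_mem s hsI
      refine ⟨hconv _ ca _ cb (e1.trans_le (min_le_left _ _)) (e2.trans_le (min_le_left _ _)), ?_⟩
      rw [← hiso _ ca _ cb (e1.trans_le (min_le_right _ _)) (e2.trans_le (min_le_right _ _)),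
        H.hom p H.fst_mem s hsI, H.hom q H.snd_mem s hsI, dist_eq_norm, ← mul_sub, norm_mul,
        Complex.norm_real, Real.norm_eq_abs, abs_of_nonneg hsI.1, dist_eq_norm]
    have hSI : S ∈ Icc (0 : ℝ) 1 := ⟨hS0.le, hS1.le⟩
    have hsymm : ∀ s, ∀ τ ∈ Icc (0 : ℝ) 1,
        σ (σ z q s) (σ z p s) (1 - τ) = σ (σ z p s) (σ z q s) τ := fun s τ hτ =>
      h.seg_symm _ _ hτ
    have hI' : ∀ τ ∈ Icc (0 : ℝ) 1, 1 - τ ∈ Icc (0 : ℝ) 1 := fun τ hτ =>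
      ⟨by linarith [hτ.2], by linarith [hτ.1]⟩
    have hC' : ∀ τ ∈ Icc (0 : ℝ) 1, σ (σ z q S) (σ z p S) τ ∈ C := fun τ hτ => by
      have := hC _ (hI' τ hτ)
      rwa [← hsymm S _ (hI' τ hτ), sub_sub_cancel] at this
    have hD' : d (σ z q S) (σ z p S) = S * dist (f q) (f p) := by rw [h.comm, hD, dist_comm]
    have hnD := h.nonneg (σ z p S) (σ z q S)
    set D := d (σ z p S) (σ z q S) with hDdef
    have near : ∀ r > 0, ∃ ε > 0, ∀ s ∈ Icc (0 : ℝ) 1, ∀ τ ∈ Icc (0 : ℝ) 1,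
        ∀ τ' ∈ Icc (0 : ℝ) 1, |s - S| < ε → |τ' - τ| < ε →
        d (σ (σ z p S) (σ z q S) τ) (σ (σ z p s) (σ z q s) τ') < r := by
      intro r hr
      refine ⟨r / (d z p + d z q + D + 1), by positivity, fun s hs τ hτ τ' hτ' h1 h2 => ?_⟩
      have h3 := H.dist_chord_le S s τ τ' hSI hs hτ hτ'
      rw [abs_sub_comm S, abs_sub_comm τ] at h3
      rw [lt_div_iff₀ (by positivity)] at h1 h2
      set K := d z p + d z q + D + 1 with hK
      have hKp : 0 < K := by positivity
      have h4 : |s - S| < r / K := by rwa [lt_div_iff₀ hKp]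
      have h5 : |τ' - τ| < r / K := by rwa [lt_div_iff₀ hKp]
      have h6 : |s - S| * (d z p + d z q) ≤ r / K * (d z p + d z q) :=
        mul_le_mul_of_nonneg_right h4.le (by linarith)
      have h7 : |τ' - τ| * D ≤ r / K * D := mul_le_mul_of_nonneg_right h5.le hnD
      have h8 : r / K * (d z p + d z q) + r / K * D + r / K = r := by
        rw [← mul_add, ← mul_add_one, ← hK]; field_simp
      have h9 : 0 < r / K := by positivity
      linarith
    -- An inner point of the chord is off the sides, as its image shows, so it is an interior point
    -- of `C`.
    have hint : ∀ τ, 0 < τ → τ < 1 → ∃ ε > 0, ∀ s ∈ Icc (0 : ℝ) 1, |s - S| < ε →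
        ∀ τ' ∈ Icc (0 : ℝ) 1, |τ' - τ| < ε → σ (σ z p s) (σ z q s) τ' ∈ C := by
      intro τ hτ0 hτ1
      have hτ : τ ∈ Icc (0 : ℝ) 1 := ⟨hτ0.le, hτ1.le⟩
      obtain ⟨r, hr, hmem⟩ := H.opn _ (hC τ hτ)
        (fun t ht => H.chord_not_side hS0 hS1.le hC hD hτ0 hτ1.le ht)
        (fun t ht => by
          rw [← hsymm S τ hτ]
          exact H.symm.chord_not_side hS0 hS1.le hC' hD' (by linarith) (by linarith) ht)
      obtain ⟨ε, hε, hn⟩ := near r hr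
      exact ⟨ε, hε, fun s hs hsS τ' hτ' hττ => hmem _ (hn s hs τ hτ τ' hτ' hsS hττ)⟩
    obtain ⟨ε₀, hε₀, hst₀⟩ := H.chord_start hS0 hS1 hC hD (fun τ h0 h1 => by
      obtain ⟨ε, hε, hh⟩ := hint τ h0 h1
      exact ⟨ε, hε, fun s hs hsS => hh s hs hsS τ ⟨h0.le, h1.le⟩ (by simpa using hε)⟩)
    obtain ⟨ε₁, hε₁, hst₁⟩ := H.symm.chord_start hS0 hS1 hC' hD' (fun τ h0 h1 => by
      obtain ⟨ε, hε, hh⟩ := hint (1 - τ) (by linarith) (by linarith)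
      refine ⟨ε, hε, fun s hs hsS => ?_⟩
      have := hh s hs hsS (1 - τ) ⟨by linarith, by linarith⟩ (by simpa using hε)
      rwa [← hsymm s _ ⟨by linarith, by linarith⟩, sub_sub_cancel] at this)
    have hfr : ∀ τ ∈ Icc (0 : ℝ) 1, ∃ ε > 0, ∀ s ∈ Icc (0 : ℝ) 1, |s - S| < ε →
        ∀ τ' ∈ Icc (0 : ℝ) 1, |τ' - τ| < ε → ∀ t ∈ Icc (0 : ℝ) 1,
          σ z (σ (σ z p s) (σ z q s) τ') t ≠ p ∧ σ z (σ (σ z p s) (σ z q s) τ') t ≠ q := by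
      intro τ hτ
      obtain ⟨r, hr, h1⟩ := H.front_near fun t ht => H.chord_front hS0.le hS1 hC hD hτ ht
      obtain ⟨r', hr', h2⟩ := H.symm.front_near fun t ht =>
        H.symm.chord_front hS0.le hS1 hC' hD' (hI' τ hτ) ht
      rw [hsymm S τ hτ] at h2
      obtain ⟨ε, hε, hn⟩ := near (min r r') (lt_min hr hr')
      refine ⟨ε, hε, fun s hs hsS τ' hτ' hττ t ht => ?_⟩
      have := hn s hs τ hτ τ' hτ' hsS hττ
      exact ⟨h1 _ (this.trans_le (min_le_left _ _)) t ht,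
        h2 _ (this.trans_le (min_le_right _ _)) t ht⟩
    -- Membership in `C` and not being behind `p` or `q` are open conditions along the chord, at its
    -- two ends by local convexity; compactness of `[0, 1]` gives a uniform `ε`.
    have hall : ∃ ε > 0, ∀ s ∈ Icc (0 : ℝ) 1, |s - S| < ε → ∀ τ ∈ Icc (0 : ℝ) 1,
        σ (σ z p s) (σ z q s) τ ∈ C ∧ ∀ t ∈ Icc (0 : ℝ) 1,
          σ z (σ (σ z p s) (σ z q s) τ) t ≠ p ∧ σ z (σ (σ z p s) (σ z q s) τ) t ≠ q := by
      refine (isCompact_Icc (a := (0 : ℝ)) (b := 1)).induction_on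
        (p := fun T => ∃ ε > 0, ∀ s ∈ Icc (0 : ℝ) 1, |s - S| < ε → ∀ τ ∈ T, τ ∈ Icc (0 : ℝ) 1 →
          σ (σ z p s) (σ z q s) τ ∈ C ∧ ∀ t ∈ Icc (0 : ℝ) 1,
            σ z (σ (σ z p s) (σ z q s) τ) t ≠ p ∧ σ z (σ (σ z p s) (σ z q s) τ) t ≠ q)
        ?_ ?_ ?_ ?_ |>.imp fun ε hε => ⟨hε.1, fun s hs hsS τ hτ => hε.2 s hs hsS τ hτ hτ⟩
      · exact ⟨1, one_pos, fun _ _ _ _ h => h.elim⟩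
      · rintro T T' hTT ⟨ε, hε, hh⟩
        exact ⟨ε, hε, fun s hs hsS τ hτ => hh s hs hsS τ (hTT hτ)⟩
      · rintro T T' ⟨ε, hε, hh⟩ ⟨ε', hε', hh'⟩
        refine ⟨min ε ε', lt_min hε hε', fun s hs hsS τ hτ => ?_⟩
        rcases hτ with hτ | hτ
        · exact hh s hs (hsS.trans_le (min_le_left _ _)) τ hτ
        · exact hh' s hs (hsS.trans_le (min_le_right _ _)) τ hτ
      · intro τ hτ
        obtain ⟨ε, hε, hf⟩ := hfr τ hτ
        have hmem : ∃ ε > 0, ∀ s ∈ Icc (0 : ℝ) 1, |s - S| < ε →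
            ∀ τ' ∈ Icc (0 : ℝ) 1, |τ' - τ| < ε → σ (σ z p s) (σ z q s) τ' ∈ C := by
          rcases eq_or_lt_of_le hτ.1 with rfl | hτ0
          · refine ⟨ε₀, hε₀, fun s hs hsS τ' hτ' hττ => hst₀ s hs hsS τ' hτ' ?_⟩
            rw [sub_zero] at hττ
            exact (le_abs_self _).trans_lt hττ
          rcases eq_or_lt_of_le hτ.2 with rfl | hτ1
          · refine ⟨ε₁, hε₁, fun s hs hsS τ' hτ' hττ => ?_⟩
            rw [← hsymm s τ' hτ']
            apply hst₁ s hs hsS _ (hI' τ' hτ')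
            rw [abs_sub_comm] at hττ
            exact (le_abs_self _).trans_lt hττ
          · exact hint τ hτ0 hτ1
        obtain ⟨ε', hε', hm⟩ := hmem
        refine ⟨_, mem_nhdsWithin_of_mem_nhds (Metric.ball_mem_nhds τ (lt_min hε hε')),
          min ε ε', lt_min hε hε', fun s hs hsS τ' hττ hτ' => ?_⟩
        rw [Metric.mem_ball, Real.dist_eq] at hττ
        exact ⟨hm s hs (hsS.trans_le (min_le_right _ _)) τ' hτ' (hττ.trans_le (min_le_right _ _)),
          hf s hs (hsS.trans_le (min_le_left _ _)) τ' hτ' (hττ.trans_le (min_le_left _ _))⟩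
    obtain ⟨ε, hε, hall⟩ := hall
    refine ⟨ε, hε, fun s hSs hs1 hs => ?_⟩
    have hsI : s ∈ Icc (0 : ℝ) 1 := ⟨by linarith, hs1⟩
    have := hall s hsI (by rw [abs_of_pos (by linarith)]; linarith)
    exact ⟨fun τ hτ => (this τ hτ).1,
      H.chord_eq hsI (fun τ hτ => (this τ hτ).1) fun τ hτ => (this τ hτ).2⟩
  -- The limit chord lies in `C` since `C` is closed, and its length is the limit of the lengths.
  · intro t ht0 ht1 hlim
    have htI : t ∈ Icc (0 : ℝ) 1 := ⟨ht0.le, ht1⟩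
    have small : ∀ ε > 0, ∃ s, 0 ≤ s ∧ s < t ∧ (t - s) * (d z p + d z q + dist (f p) (f q)) < ε := by
      intro ε hε
      have hd : 0 ≤ dist (f p) (f q) := dist_nonneg
      set K := d z p + d z q + dist (f p) (f q) + 1 with hK
      have hKp : 0 < K := by positivity
      refine ⟨max 0 (t - ε / K), le_max_left _ _, max_lt ht0 (by linarith [div_pos hε hKp]), ?_⟩
      have h1 : t - max 0 (t - ε / K) ≤ ε / K := by linarith [le_max_right 0 (t - ε / K)]
      have h2 := mul_le_mul_of_nonneg_right h1 (by linarith : 0 ≤ d z p + d z q + dist (f p) (f q))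
      have h3 : ε / K * (d z p + d z q + dist (f p) (f q)) + ε / K = ε := by
        rw [← mul_add_one, ← hK]; field_simp
      linarith [div_pos hε hKp]
    constructor
    · intro τ hτ
      apply H.closed
      intro ε hε
      obtain ⟨s, hs0, hst, hs⟩ := small ε hε
      have hsI : s ∈ Icc (0 : ℝ) 1 := ⟨hs0, by linarith⟩
      refine ⟨_, (hlim s hs0 hst).1 τ hτ, ?_⟩
      have h1 := H.dist_chord_le t s τ τ htI hsI hτ hτ
      rw [sub_self, abs_zero, zero_mul, add_zero, abs_of_pos (by linarith)] at h1
      have : 0 ≤ (t - s) * dist (f p) (f q) := mul_nonneg (by linarith) dist_nonneg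
      nlinarith
    · refine eq_of_abs_sub_eq_zero (le_antisymm (le_of_forall_pos_lt_add fun ε hε => ?_)
        (abs_nonneg _))
      obtain ⟨s, hs0, hst, hs⟩ := small ε hε
      have hsI : s ∈ Icc (0 : ℝ) 1 := ⟨hs0, by linarith⟩
      have h1 := h.abs_dist_sub_le (σ z p t) (σ z q t) (σ z p s) (σ z q s)
      rw [h.seg z p t htI s hsI, h.seg z q t htI s hsI, (hlim s hs0 hst).2,
        abs_of_pos (by linarith : 0 < t - s)] at h1
      have h2 : |d (σ z p t) (σ z q t) - t * dist (f p) (f q)| ≤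
          |d (σ z p t) (σ z q t) - s * dist (f p) (f q)| + (t - s) * dist (f p) (f q) := by
        have h3 := abs_sub_le (d (σ z p t) (σ z q t)) (s * dist (f p) (f q)) (t * dist (f p) (f q))
        rw [← sub_mul, abs_mul, abs_of_nonneg (dist_nonneg (x := f p) (y := f q)),
          abs_sub_comm s, abs_of_pos (by linarith : 0 < t - s)] at h3
        exact h3
      linarith

/-- The union of the geodesics from `z` to the geodesic from `p` to `q`. -/
def fill {X : Type*} (σ : X → X → ℝ → X) (z p q : X) : Set X :=
  {x | ∃ τ ∈ Icc (0 : ℝ) 1, ∃ s ∈ Icc (0 : ℝ) 1, x = σ z (σ p q τ) s}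

theorem fill_subset : fill σ z p q ⊆ C := by
  rintro x ⟨τ, hτ, s, hs, rfl⟩
  exact H.star _ (H.base.1 τ hτ) s hs

theorem map_base {τ : ℝ} (hτ : τ ∈ Icc (0 : ℝ) 1) :
    f (σ p q τ) = f p + (τ : ℂ) * (f q - f p) :=
  H.cat.map_seg hτ (H.lip _ H.fst_mem _ (H.base.1 τ hτ)) (H.lip _ (H.base.1 τ hτ) _ H.snd_mem)
    H.base.2.symm

/-- The triangle formed by `z` and two points of the base has the same side lengths as its image. So
the upper bound of `two_sides` is the planar distance of the images, and `f` does not expand. -/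
theorem isom_fill {a b : X} (ha : a ∈ fill σ z p q) (hb : b ∈ fill σ z p q) :
    dist (f a) (f b) = d a b := by
  apply le_antisymm (H.lip _ (H.fill_subset ha) _ (H.fill_subset hb))
  obtain ⟨τ, hτ, s, hs, rfl⟩ := ha
  obtain ⟨τ', hτ', t, ht, rfl⟩ := hb
  have h := H.cat
  apply le_of_sq_le_sq _ dist_nonneg
  refine (h.two_sides z (σ p q τ) (σ p q τ') hs ht).trans ?_
  have e : d (σ p q τ) (σ p q τ') = dist (f (σ p q τ)) (f (σ p q τ')) := by
    rw [h.seg p q τ hτ τ' hτ', H.map_base hτ, H.map_base hτ', dist_eq_norm,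
      show f p + (τ : ℂ) * (f q - f p) - (f p + (τ' : ℂ) * (f q - f p)) =
        ((τ - τ' : ℝ) : ℂ) * (f q - f p) by push_cast; ring, norm_mul, Complex.norm_real,
      Real.norm_eq_abs, H.base.2, dist_comm, dist_eq_norm]
  rw [e, ← H.norm_eq _ (H.base.1 τ hτ), ← H.norm_eq _ (H.base.1 τ' hτ'),
    H.hom _ (H.base.1 τ hτ) s hs, H.hom _ (H.base.1 τ' hτ') t ht, Complex.dist_eq,
    Complex.dist_eq]
  simp only [Complex.sq_norm, Complex.normSq_apply]
  simp
  apply le_of_eq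
  ring

theorem image_fill : f '' fill σ z p q = convexHull ℝ {f z, f p, f q} := by
  rw [convexHull_insert (by simp), convexHull_pair, H.map_apex]
  ext w
  simp only [mem_image, mem_convexJoin, mem_singleton_iff, exists_eq_left]
  constructor
  · rintro ⟨x, ⟨τ, hτ, s, hs, rfl⟩, rfl⟩
    refine ⟨f (σ p q τ), ?_, ?_⟩
    · rw [H.map_base hτ, segment_eq_image']
      exact ⟨τ, hτ, by simp⟩
    · rw [H.hom _ (H.base.1 τ hτ) s hs, segment_eq_image']
      exact ⟨s, hs, by simp⟩
  · rintro ⟨y, hy, hw⟩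
    rw [segment_eq_image'] at hy hw
    obtain ⟨τ, hτ, rfl⟩ := hy
    obtain ⟨s, hs, rfl⟩ := hw
    refine ⟨_, ⟨τ, hτ, s, hs, rfl⟩, ?_⟩
    rw [H.hom _ (H.base.1 τ hτ) s hs, H.map_base hτ]
    simp
    ring

/-- The image is a planar triangle, hence convex. The preimage of a point of the planar segment
divides the distance from `a` to `b` in the right ratio, so it is the point of the geodesic by
uniqueness. -/
theorem fill_convex {a b : X} (ha : a ∈ fill σ z p q) (hb : b ∈ fill σ z p q) {t : ℝ}
    (ht : t ∈ Icc (0 : ℝ) 1) : σ a b t ∈ fill σ z p q := by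
  have h1 : f a + t • (f b - f a) ∈ f '' fill σ z p q := by
    rw [H.image_fill]
    apply (convex_convexHull ℝ _).segment_subset (H.image_fill ▸ mem_image_of_mem f ha)
      (H.image_fill ▸ mem_image_of_mem f hb)
    rw [segment_eq_image']
    exact ⟨t, ht, rfl⟩
  obtain ⟨y, hy, e⟩ := h1
  have e1 := H.isom_fill ha hy
  have e2 := H.isom_fill hy hb
  rw [e] at e1 e2
  have e3 := H.isom_fill ha hb
  have e4 := Complex.catMetric.dist_left (f a) (f b) ht
  have e5 := Complex.catMetric.dist_right (f a) (f b) ht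
  rw [Complex.real_smul] at e1 e2
  rw [← H.cat.eq_seg ht (by rw [← e1, e4, e3]) (by rw [← e2, e5, e3])]
  exact hy

end FlatCone

/-- The third vertex of a Euclidean triangle with given sides. -/
theorem exists_triangle_apex {l a b : ℝ} (hl : 0 < l) (ha : 0 ≤ a) (hb : 0 ≤ b) (h1 : l ≤ a + b)
    (h2 : a ≤ l + b) (h3 : b ≤ l + a) :
    ∃ w : ℂ, w.re = (a ^ 2 + l ^ 2 - b ^ 2) / (2 * l) ∧ 0 ≤ w.im ∧ ‖w‖ = a ∧ ‖w - l‖ = b ∧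
      (l < a + b → a < l + b → b < l + a → 0 < w.im) := by
  set x := (a ^ 2 + l ^ 2 - b ^ 2) / (2 * l) with hx
  have hx' : x * (2 * l) = a ^ 2 + l ^ 2 - b ^ 2 := by rw [hx]; field_simp
  -- Heron's factorization: the square of the height is nonnegative, or positive, by the triangle
  -- inequalities.
  have e1 : (2 * l) ^ 2 * (a ^ 2 - x ^ 2) = (b + a - l) * (b - a + l) * ((a + l - b) * (a + l + b)) := by
    have : (2 * l) ^ 2 * (a ^ 2 - x ^ 2) = (2 * l * a) ^ 2 - (x * (2 * l)) ^ 2 := by ring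
    rw [this, hx']; ring
  have hnn : 0 ≤ a ^ 2 - x ^ 2 := by
    have : 0 ≤ (2 * l) ^ 2 * (a ^ 2 - x ^ 2) := by
      rw [e1]
      apply mul_nonneg (mul_nonneg _ _) (mul_nonneg _ _) <;> linarith
    exact nonneg_of_mul_nonneg_right this (by positivity)
  have hs := Real.sq_sqrt hnn
  refine ⟨⟨x, Real.sqrt (a ^ 2 - x ^ 2)⟩, rfl, Real.sqrt_nonneg _, ?_, ?_, fun s1 s2 s3 => ?_⟩
  · rw [← pow_left_inj₀ (norm_nonneg _) ha two_ne_zero, Complex.sq_norm, Complex.normSq_apply]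
    simp only
    nlinarith
  · rw [← pow_left_inj₀ (norm_nonneg _) hb two_ne_zero, Complex.sq_norm, Complex.normSq_apply]
    simp only [Complex.sub_re, Complex.sub_im, Complex.ofReal_re, Complex.ofReal_im]
    nlinarith
  · apply Real.sqrt_pos.2
    have : 0 < (2 * l) ^ 2 * (a ^ 2 - x ^ 2) := by
      rw [e1]
      apply mul_pos (mul_pos _ _) (mul_pos _ _) <;> linarith
    exact pos_of_mul_pos_right this (by positivity)

theorem exists_comparison_triangle {l a b : ℝ} (hl : 0 ≤ l) (ha : 0 ≤ a) (hb : 0 ≤ b)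
    (h1 : l ≤ a + b) (h2 : a ≤ l + b) (h3 : b ≤ l + a) :
    ∃ w : ℂ, ‖w‖ = a ∧ ‖w - l‖ = b := by
  rcases eq_or_lt_of_le hl with rfl | hl
  · exact ⟨a, by rw [Complex.norm_real, Real.norm_eq_abs, abs_of_nonneg ha],
      by rw [Complex.ofReal_zero, sub_zero, Complex.norm_real, Real.norm_eq_abs, abs_of_nonneg ha]
         linarith⟩
  · obtain ⟨w, -, -, h4, h5, -⟩ := exists_triangle_apex hl ha hb h1 h2 h3
    exact ⟨w, h4, h5⟩

set_option linter.unusedSectionVars false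

namespace TriangleComplex

variable {V : Type*} [Fintype V] {K : TriangleComplex V}

/-! ### Charts of cells -/

/-- `Z` places the vertices of the cell `s` in the plane. -/
def IsChart (K : TriangleComplex V) (s : Finset V) (Z : V → ℂ) : Prop :=
  ∀ u ∈ s, ∀ v ∈ s, ‖Z u - Z v‖ = K.len u v

/-- The affine extension of `Z` to the points of the complex. -/
def develop (Z : V → ℂ) (w : V → ℝ) : ℂ := ∑ v, (w v : ℂ) * Z v

theorem develop_add (Z : V → ℂ) (a b : V → ℝ) : develop Z (a + b) = develop Z a + develop Z b := by
  simp [develop, add_mul, Finset.sum_add_distrib]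

theorem develop_smul (Z : V → ℂ) (t : ℝ) (a : V → ℝ) :
    develop Z (t • a) = (t : ℂ) * develop Z a := by
  simp [develop, Finset.mul_sum, mul_assoc]

theorem develop_sub (Z : V → ℂ) (a b : V → ℝ) : develop Z (a - b) = develop Z a - develop Z b := by
  simp [develop, sub_mul, Finset.sum_sub_distrib]

theorem cellDist_symm (a b : K.Point) : K.cellDist a b = K.cellDist b a := by
  unfold cellDist
  congr 4
  ext u
  congr 1
  ext v
  ring

theorem cellDist_nonneg (a b : K.Point) : 0 ≤ K.cellDist a b := Real.sqrt_nonneg _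

/-- For coefficients `δ` of sum zero, the sum of `(x u - x v)² δ u δ v` is `-2 (∑ δ v x v)²`; this
is applied to the real and the imaginary parts of `Z`. -/
theorem IsChart.cellDist_eq {s : Finset V} {Z : V → ℂ} (h : K.IsChart s Z) {a b : K.Point}
    (ha : a ∈ K.cell s) (hb : b ∈ K.cell s) :
    K.cellDist a b = ‖develop Z a.1 - develop Z b.1‖ := by
  rw [← develop_sub]
  set δ : V → ℝ := a.1 - b.1 with hδ
  have hδ0 : ∑ v, δ v = 0 := by
    simp only [hδ, Pi.sub_apply, Finset.sum_sub_distrib, a.2.2.1, b.2.2.1, sub_self]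
  have hδs : ∀ v, v ∉ s → δ v = 0 := fun v hv => by simp [hδ, ha v hv, hb v hv]
  have e1 : ∀ u v, K.len u v ^ 2 * (a.1 u - b.1 u) * (a.1 v - b.1 v) =
      ‖Z u - Z v‖ ^ 2 * δ u * δ v := by
    intro u v
    by_cases hu : u ∈ s
    · by_cases hv : v ∈ s
      · rw [h u hu v hv]; rfl
      · have := hδs v hv
        simp only [hδ, Pi.sub_apply] at this ⊢
        rw [this, mul_zero, mul_zero]
    · have := hδs u hu
      simp only [hδ, Pi.sub_apply] at this ⊢
      rw [this, mul_zero, zero_mul, mul_zero, zero_mul]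
  have key : ∀ x : V → ℝ, ∑ u, ∑ v, (x u - x v) ^ 2 * δ u * δ v = -2 * (∑ v, δ v * x v) ^ 2 := by
    intro x
    have e2 : ∀ u v, (x u - x v) ^ 2 * δ u * δ v = (x u ^ 2 * δ u) * δ v + δ u * (x v ^ 2 * δ v) -
        2 * ((δ u * x u) * (δ v * x v)) := by intro u v; ring
    simp_rw [e2, Finset.sum_sub_distrib, Finset.sum_add_distrib, ← Finset.mul_sum, hδ0,
      ← Finset.sum_mul, hδ0]
    ring
  have e3 : ∀ u v, ‖Z u - Z v‖ ^ 2 * δ u * δ v = ((Z u).re - (Z v).re) ^ 2 * δ u * δ v +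
      ((Z u).im - (Z v).im) ^ 2 * δ u * δ v := by
    intro u v
    rw [Complex.sq_norm, Complex.normSq_apply, Complex.sub_re, Complex.sub_im]; ring
  unfold cellDist
  simp_rw [e1, e3, Finset.sum_add_distrib]
  rw [key, key, ← Real.sqrt_sq (norm_nonneg _), Complex.sq_norm, Complex.normSq_apply]
  congr 1
  have re : (develop Z δ).re = ∑ v, δ v * (Z v).re := by simp [develop]
  have im : (develop Z δ).im = ∑ v, δ v * (Z v).im := by simp [develop]
  rw [re, im]; ring

/-- The third vertex of a triangle `a, b, c` drawn in the upper half plane, with `a` at the origin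
and `b` on the positive real axis. -/
theorem exists_apex [DecidableEq V] {a b c : V} (hs : ({a, b, c} : Finset V) ∈ K.cells)
    (hab : a ≠ b) (hac : a ≠ c) (hbc : b ≠ c) : ∃ w : ℂ, w.re = (K.len a c ^ 2 + K.len a b ^ 2 - K.len b c ^ 2) /
      (2 * K.len a b) ∧ 0 < w.im ∧ ‖w‖ = K.len a c ∧ ‖w - K.len a b‖ = K.len b c := by
  have t1 := K.len_triangle _ hs a (by simp) c (by simp) b (by simp) hac hbc.symm hab
  have t2 := K.len_triangle _ hs a (by simp) b (by simp) c (by simp) hab hbc hac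
  have t3 := K.len_triangle _ hs b (by simp) a (by simp) c (by simp) hab.symm hac hbc
  rw [K.len_symm c b] at t1
  rw [K.len_symm b a] at t3
  have p1 := K.len_pos _ hs a (by simp) b (by simp) hab
  have p2 := K.len_pos _ hs a (by simp) c (by simp) hac
  have p3 := K.len_pos _ hs b (by simp) c (by simp) hbc
  obtain ⟨w, e1, -, e2, e3, e4⟩ := exists_triangle_apex p1 p2.le p3.le t1.le t2.le t3.le
  exact ⟨w, e1, e4 t1 t2 t3, e2, e3⟩

theorem isChart_edge {a b : V} {Z : V → ℂ} (ha : Z a = 0) (hb : Z b = K.len a b)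
    (hpos : 0 ≤ K.len a b) [DecidableEq V] : K.IsChart {a, b} Z := by
  intro u hu v hv
  simp only [Finset.mem_insert, Finset.mem_singleton] at hu hv
  rcases hu with rfl | rfl <;> rcases hv with rfl | rfl
  · simp [K.len_self]
  · rw [ha, hb, zero_sub, norm_neg, Complex.norm_real, Real.norm_eq_abs, abs_of_nonneg hpos]
  · rw [ha, hb, sub_zero, Complex.norm_real, Real.norm_eq_abs, abs_of_nonneg hpos, K.len_symm]
  · simp [K.len_self]

theorem isChart_triangle {a b c : V} {Z : V → ℂ} (ha : Z a = 0) (hb : Z b = K.len a b)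
    (hpos : 0 ≤ K.len a b) (hc : ‖Z c‖ = K.len a c) (hc' : ‖Z c - K.len a b‖ = K.len b c)
    [DecidableEq V] : K.IsChart {a, b, c} Z := by
  intro u hu v hv
  simp only [Finset.mem_insert, Finset.mem_singleton] at hu hv
  have e0 : ‖(K.len a b : ℂ)‖ = K.len a b := by
    rw [Complex.norm_real, Real.norm_eq_abs, abs_of_nonneg hpos]
  rcases hu with rfl | rfl | rfl <;> rcases hv with rfl | rfl | rfl
  · simp [K.len_self]
  · rw [ha, hb, zero_sub, norm_neg, e0]
  · rw [ha, zero_sub, norm_neg, hc]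
  · rw [ha, hb, sub_zero, e0, K.len_symm]
  · simp [K.len_self]
  · rw [hb, norm_sub_rev, hc']
  · rw [ha, sub_zero, hc, K.len_symm]
  · rw [hb, hc', K.len_symm]
  · simp [K.len_self]

/-- Every cell has a chart, and charts are injective on cells. -/
theorem exists_chart {s : Finset V} (hs : s ∈ K.cells) : ∃ Z : V → ℂ, K.IsChart s Z ∧
    ∀ δ : V → ℝ, (∀ v, v ∉ s → δ v = 0) → ∑ v, δ v = 0 → develop Z δ = 0 → δ = 0 := by
  classical
  have hsum : ∀ δ : V → ℝ, (∀ v, v ∉ s → δ v = 0) → ∑ v, δ v = ∑ v ∈ s, δ v := fun δ hδ =>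
    (Finset.sum_subset (Finset.subset_univ s) fun v _ hv => hδ v hv).symm
  have hdev : ∀ (Z : V → ℂ) (δ : V → ℝ), (∀ v, v ∉ s → δ v = 0) →
      develop Z δ = ∑ v ∈ s, (δ v : ℂ) * Z v := fun Z δ hδ =>
    (Finset.sum_subset (Finset.subset_univ s) fun v _ hv => by simp [hδ v hv]).symm
  have hcard := K.card_le s hs
  interval_cases hc : s.card
  · rw [Finset.card_eq_zero] at hc
    subst hc
    exact ⟨0, by simp [IsChart], fun δ hδ _ _ => funext fun v => hδ v (by simp)⟩
  · obtain ⟨a, rfl⟩ := Finset.card_eq_one.1 hc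
    refine ⟨0, by simp [IsChart, K.len_self], fun δ hδ h0 _ => funext fun v => ?_⟩
    rw [hsum δ hδ, Finset.sum_singleton] at h0
    by_cases hv : v = a
    · rw [hv, h0]; rfl
    · exact hδ v (by simpa using hv)
  · obtain ⟨a, b, hab, rfl⟩ := Finset.card_eq_two.1 hc
    have hp := K.len_pos _ hs a (by simp) b (by simp) hab
    refine ⟨fun v => if v = b then K.len a b else 0, isChart_edge (by simp [hab]) (by simp) hp.le,
      fun δ hδ h0 h1 => ?_⟩
    rw [hsum δ hδ, Finset.sum_pair hab] at h0
    rw [hdev _ δ hδ, Finset.sum_pair hab] at h1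
    simp [hab, hp.ne'] at h1
    rw [h1, add_zero] at h0
    funext v
    by_cases hva : v = a
    · rw [hva, h0]; rfl
    · by_cases hvb : v = b
      · rw [hvb, h1]; rfl
      · exact hδ v (by simp [hva, hvb])
  · obtain ⟨a, b, c, hab, hac, hbc, rfl⟩ := Finset.card_eq_three.1 hc
    obtain ⟨w, -, hw, hw1, hw2⟩ := K.exists_apex hs hab hac hbc
    have hp := K.len_pos _ hs a (by simp) b (by simp) hab
    refine ⟨fun v => if v = c then w else if v = b then K.len a b else 0,
      isChart_triangle (by simp [hab, hac]) (by simp [hbc]) hp.le (by simpa using hw1)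
        (by simpa using hw2), fun δ hδ h0 h1 => ?_⟩
    have hsum3 : ∀ {M : Type} [AddCommMonoid M] (g : V → M),
        ∑ v ∈ ({a, b, c} : Finset V), g v = g a + (g b + g c) := fun g => by
      rw [Finset.sum_insert (by simp [hab, hac]), Finset.sum_pair hbc]
    rw [hsum δ hδ, hsum3] at h0
    rw [hdev _ δ hδ, hsum3] at h1
    simp [hab, hac, hbc] at h1
    have him := congrArg Complex.im h1
    have hre := congrArg Complex.re h1
    simp [hw.ne'] at him
    simp [him, hp.ne'] at hre
    rw [him, hre] at h0
    simp at h0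
    funext v
    by_cases hva : v = a
    · rw [hva, h0]; rfl
    · by_cases hvb : v = b
      · rw [hvb, hre]; rfl
      · by_cases hvc : v = c
        · rw [hvc, him]; rfl
        · exact hδ v (by simp [hva, hvb, hvc])

/-- Barycentric coordinates are Lipschitz on the cells. -/
theorem exists_coord_lipschitz (K : TriangleComplex V) : ∃ L > 0, ∀ s ∈ K.cells, ∀ a ∈ K.cell s,
    ∀ b ∈ K.cell s, ∀ v, |a.1 v - b.1 v| ≤ L * K.cellDist a b := by
  have one : ∀ s : Finset V, ∃ L > 0, s ∈ K.cells → ∀ a ∈ K.cell s, ∀ b ∈ K.cell s, ∀ v,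
      |a.1 v - b.1 v| ≤ L * K.cellDist a b := by
    intro s
    by_cases hs : s ∈ K.cells
    · obtain ⟨Z, hZ, hinj⟩ := K.exists_chart hs
      -- Differences of points of the cell lie in `W`, on which `develop Z` is injective; an
      -- injective linear map on a finite-dimensional space is bounded below.
      let W : Submodule ℝ (V → ℝ) :=
        { carrier := {δ | (∀ v, v ∉ s → δ v = 0) ∧ ∑ v, δ v = 0}
          add_mem' := fun {a b} ha hb => ⟨fun v hv => by simp [ha.1 v hv, hb.1 v hv],
            by simp [Finset.sum_add_distrib, ha.2, hb.2]⟩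
          zero_mem' := ⟨fun _ _ => rfl, by simp⟩
          smul_mem' := fun c a ha => ⟨fun v hv => by simp [ha.1 v hv],
            by simp [← Finset.mul_sum, ha.2]⟩ }
      let φ : W →ₗ[ℝ] ℂ :=
        { toFun := fun δ => develop Z δ.1
          map_add' := fun a b => develop_add Z a.1 b.1
          map_smul' := fun c a => by simpa using develop_smul Z c a.1 }
      have hφ : LinearMap.ker φ = ⊥ := by
        rw [LinearMap.ker_eq_bot']
        intro δ hδ
        exact Subtype.ext (hinj δ.1 δ.2.1 δ.2.2 hδ)
      obtain ⟨L, hL, hanti⟩ := φ.exists_antilipschitzWith hφ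
      refine ⟨L, hL, fun _ a ha b hb v => ?_⟩
      have hmem : a.1 - b.1 ∈ W := ⟨fun v hv => by simp [ha v hv, hb v hv], by
        simp [Finset.sum_sub_distrib, a.2.2.1, b.2.2.1]⟩
      have h1 := hanti.le_mul_dist ⟨_, hmem⟩ 0
      rw [dist_zero_right, map_zero, dist_zero_right] at h1
      rw [hZ.cellDist_eq ha hb, ← develop_sub]
      refine le_trans ?_ h1
      exact norm_le_pi_norm (a.1 - b.1) v
    · exact ⟨1, one_pos, fun h => (hs h).elim⟩
  choose L hL h using one
  refine ⟨1 + ∑ s, L s, by have := Finset.sum_nonneg fun s (_ : s ∈ Finset.univ) => (hL s).le; positivity, fun s hs a ha b hb v => ?_⟩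
  refine (h s hs a ha b hb v).trans (mul_le_mul_of_nonneg_right ?_ (cellDist_nonneg a b))
  have := Finset.single_le_sum (f := L) (fun s _ => (hL s).le) (Finset.mem_univ s)
  linarith

end TriangleComplex

namespace TriangleComplex

variable {V : Type*} [Fintype V] {K : TriangleComplex V}

/-! ### The intrinsic metric -/

/-- There is a path of length `L` from `a` to `b`. -/
def PathLen (K : TriangleComplex V) (a b : K.Point) (L : ℝ) : Prop :=
  ∃ (n : ℕ) (c : ℕ → K.Point), c 0 = a ∧ c n = b ∧
    (∀ i < n, ∃ s ∈ K.cells, c i ∈ K.cell s ∧ c (i + 1) ∈ K.cell s) ∧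
    L = ∑ i ∈ Finset.range n, K.cellDist (c i) (c (i + 1))

theorem PathLen.nonneg {a b : K.Point} {L : ℝ} (h : K.PathLen a b L) : 0 ≤ L := by
  obtain ⟨n, c, -, -, -, rfl⟩ := h
  exact Finset.sum_nonneg fun _ _ => cellDist_nonneg _ _

theorem pathLen_refl (a : K.Point) : K.PathLen a a 0 := ⟨0, fun _ => a, rfl, rfl, by simp, by simp⟩

theorem pathLen_single {a b : K.Point} {s : Finset V} (hs : s ∈ K.cells) (ha : a ∈ K.cell s)
    (hb : b ∈ K.cell s) : K.PathLen a b (K.cellDist a b) :=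
  ⟨1, fun i => if i = 0 then a else b, by simp, by simp, by
    intro i hi
    obtain rfl : i = 0 := by omega
    exact ⟨s, hs, by simpa using ha, by simpa using hb⟩, by simp⟩

theorem PathLen.symm {a b : K.Point} {L : ℝ} (h : K.PathLen a b L) : K.PathLen b a L := by
  obtain ⟨n, c, h0, hn, hc, rfl⟩ := h
  refine ⟨n, fun i => c (n - i), by simpa, by simpa, fun i hi => ?_, ?_⟩
  · obtain ⟨s, hs, h1, h2⟩ := hc (n - 1 - i) (by omega)
    refine ⟨s, hs, ?_, ?_⟩
    · rwa [show n - 1 - i + 1 = n - i by omega] at h2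
    · rwa [show n - 1 - i = n - (i + 1) by omega] at h1
  · rw [← Finset.sum_range_reflect]
    apply Finset.sum_congr rfl
    intro i hi
    rw [Finset.mem_range] at hi
    rw [cellDist_symm, show n - 1 - i + 1 = n - i by omega, show n - 1 - i = n - (i + 1) by omega]

theorem PathLen.trans {a b c : K.Point} {L M : ℝ} (h : K.PathLen a b L) (h' : K.PathLen b c M) :
    K.PathLen a c (L + M) := by
  obtain ⟨n, u, h0, hn, hu, rfl⟩ := h
  obtain ⟨m, w, h0', hm, hw, rfl⟩ := h'
  have e1 : ∀ i, i ≤ n → (fun i => if i ≤ n then u i else w (i - n)) i = u i := fun i hi => by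
    simp [hi]
  have e2 : ∀ i, (fun i => if i ≤ n then u i else w (i - n)) (n + i) = w i := fun i => by
    rcases Nat.eq_zero_or_pos i with rfl | hi
    · simp [hn, h0']
    · simp [show ¬ n + i ≤ n by omega]
  refine ⟨n + m, fun i => if i ≤ n then u i else w (i - n), ?_, ?_, fun i hi => ?_, ?_⟩
  · rw [← h0]; exact e1 0 (Nat.zero_le _)
  · rw [← hm]; exact e2 m
  · by_cases hin : i < n
    · rw [e1 i hin.le, e1 (i + 1) hin]
      exact hu i hin
    · obtain ⟨j, rfl⟩ := Nat.exists_eq_add_of_le (not_lt.1 hin)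
      rw [add_assoc, e2 j, e2 (j + 1)]
      exact hw j (by omega)
  · rw [Finset.sum_range_add]
    congr 1
    · apply Finset.sum_congr rfl
      intro i hi
      rw [Finset.mem_range] at hi
      rw [e1 i hi.le, e1 (i + 1) hi]
    · apply Finset.sum_congr rfl
      intro i _
      rw [add_assoc, e2 i, e2 (i + 1)]

theorem pathDist_eq_sInf (a b : K.Point) : K.pathDist a b = sInf {L | K.PathLen a b L} := rfl

theorem PathLen.pathDist_le {a b : K.Point} {L : ℝ} (h : K.PathLen a b L) : K.pathDist a b ≤ L :=
  csInf_le ⟨0, fun _ h => PathLen.nonneg h⟩ h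

theorem pathDist_le_cellDist {a b : K.Point} {s : Finset V} (hs : s ∈ K.cells) (ha : a ∈ K.cell s)
    (hb : b ∈ K.cell s) : K.pathDist a b ≤ K.cellDist a b :=
  (pathLen_single hs ha hb).pathDist_le

theorem pathDist_nonneg (a b : K.Point) : 0 ≤ K.pathDist a b :=
  Real.sInf_nonneg fun _ h => PathLen.nonneg h

theorem pathDist_self (a : K.Point) : K.pathDist a a = 0 :=
  le_antisymm (pathLen_refl a).pathDist_le (pathDist_nonneg _ _)

theorem pathDist_symm (a b : K.Point) : K.pathDist a b = K.pathDist b a := by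
  rw [pathDist_eq_sInf, pathDist_eq_sInf]
  congr 1
  ext L
  exact ⟨PathLen.symm, PathLen.symm⟩

theorem IsCAT0.eq_of_pathDist (h : K.IsCAT0) {a b : K.Point} (hab : K.pathDist a b = 0) :
    a = b := by
  obtain ⟨γ, l, hl, rfl, rfl, hγ⟩ := h.1 a b
  have := hγ 0 ⟨le_rfl, hl⟩ l ⟨hl, le_rfl⟩
  rw [hab, zero_sub, abs_neg, abs_of_nonneg hl] at this
  rw [← this]

/-- Without a path, `pathDist` takes the default value `sInf ∅ = 0`. This forces `a = b`, and then
there is the constant path. So CAT(0) implies connectedness. -/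
theorem IsCAT0.exists_path (h : K.IsCAT0) (a b : K.Point) : {L | K.PathLen a b L}.Nonempty := by
  by_contra hne
  rw [not_nonempty_iff_eq_empty] at hne
  have h0 : K.pathDist a b = 0 := by rw [pathDist_eq_sInf, hne, Real.sInf_empty]
  have := h.eq_of_pathDist h0
  subst this
  have h1 : (0 : ℝ) ∈ {L | K.PathLen a a L} := pathLen_refl a
  rw [hne] at h1
  exact h1

theorem IsCAT0.pathDist_triangle (h : K.IsCAT0) (a b c : K.Point) :
    K.pathDist a c ≤ K.pathDist a b + K.pathDist b c := by
  apply le_of_forall_pos_lt_add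
  intro ε hε
  obtain ⟨L, hL, hL'⟩ := exists_lt_of_csInf_lt (h.exists_path a b)
    (show K.pathDist a b < K.pathDist a b + ε / 2 by linarith)
  obtain ⟨M, hM, hM'⟩ := exists_lt_of_csInf_lt (h.exists_path b c)
    (show K.pathDist b c < K.pathDist b c + ε / 2 by linarith)
  linarith [(PathLen.trans hL hM).pathDist_le]

/-- The geodesics are reparametrized on `[0, 1]`, and the comparison inequality becomes `cn` by
computing the distance in a comparison triangle, built in `ℂ` and carried to `EPlane` by an
isometry. -/
theorem IsCAT0.exists_catMetric (h : K.IsCAT0) :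
    ∃ σ : K.Point → K.Point → ℝ → K.Point, CATMetric K.pathDist σ := by
  choose γ l hγ using h.1
  have hl : ∀ a b, l a b = K.pathDist a b := by
    intro a b
    obtain ⟨h0, h1, h2, h3⟩ := hγ a b
    have := h3 0 ⟨le_rfl, h0⟩ _ ⟨h0, le_rfl⟩
    rw [h1, h2, zero_sub, abs_neg, abs_of_nonneg h0] at this
    exact this.symm
  have hmem : ∀ a b, ∀ t ∈ Icc (0 : ℝ) 1, t * l a b ∈ Icc 0 (l a b) := fun a b t ht =>
    ⟨mul_nonneg ht.1 (hγ a b).1, mul_le_of_le_one_left (hγ a b).1 ht.2⟩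
  refine ⟨fun a b t => γ a b (t * l a b), pathDist_self, fun a b => h.eq_of_pathDist,
    pathDist_symm, h.pathDist_triangle, fun a b => ?_, fun a b => ?_, fun a b s hs t ht => ?_,
    fun a b c t ht => ?_⟩
  · rw [zero_mul, (hγ a b).2.1]
  · rw [one_mul, (hγ a b).2.2.1]
  · rw [(hγ a b).2.2.2 _ (hmem a b s hs) _ (hmem a b t ht), ← sub_mul, abs_mul,
      abs_of_nonneg (hγ a b).1, hl]
  · obtain ⟨h0, h1, h2, h3⟩ := hγ a b
    set y := γ a b (t * l a b) with hy
    have ey1 : K.pathDist a y = t * l a b := by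
      have := h3 0 ⟨le_rfl, h0⟩ _ (hmem a b t ht)
      rwa [h1, zero_sub, abs_neg, abs_of_nonneg (hmem a b t ht).1] at this
    have ey2 : K.pathDist b y = (1 - t) * l a b := by
      have := h3 _ ⟨h0, le_rfl⟩ _ (hmem a b t ht)
      rw [h2, abs_of_nonneg (by linarith [(hmem a b t ht).2])] at this
      rw [this]; ring
    have t1 := h.pathDist_triangle a c b
    have t2 := h.pathDist_triangle a b c
    have t3 := h.pathDist_triangle b a c
    rw [pathDist_symm c b] at t1
    rw [pathDist_symm b a] at t3
    obtain ⟨w, hw1, hw2⟩ := exists_comparison_triangle (pathDist_nonneg a b) (pathDist_nonneg a c)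
      (pathDist_nonneg b c) t1 t2 t3
    set e := Complex.orthonormalBasisOneI.repr with he
    set B : ℂ := ((K.pathDist a b : ℝ) : ℂ) with hB
    have nB : ‖B‖ = K.pathDist a b := by
      rw [hB, Complex.norm_real, Real.norm_eq_abs, abs_of_nonneg (pathDist_nonneg a b)]
    have hY : dist B ((t : ℂ) * B) = (1 - t) * l a b := by
      rw [dist_eq_norm, show B - (t : ℂ) * B = ((1 - t : ℝ) : ℂ) * B by push_cast; ring, norm_mul,
        Complex.norm_real, Real.norm_eq_abs, abs_of_nonneg (by linarith [ht.2]), nB, hl]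
    have hY0 : dist 0 ((t : ℂ) * B) = t * l a b := by
      rw [dist_zero_left, norm_mul, Complex.norm_real, Real.norm_eq_abs, abs_of_nonneg ht.1, nB, hl]
    have := h.2 a b c (γ a b) (l a b) (hγ a b) y ⟨_, hmem a b t ht, rfl⟩ (e 0) (e B) (e w)
      (e ((t : ℂ) * B))
      (by rw [e.dist_map, dist_zero_left, nB])
      (by rw [e.dist_map, dist_comm, dist_eq_norm, hw2])
      (by rw [e.dist_map, dist_zero_left, hw1])
      (by
        rw [segment_eq_image']
        refine ⟨t, ht, ?_⟩
        simp only
        rw [← map_sub, ← map_smul, ← map_add, zero_add, sub_zero, Complex.real_smul])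
      (by rw [e.dist_map, hY0, ey1])
      (by rw [e.dist_map, hY, ey2])
    rw [e.dist_map] at this
    have c1 := Complex.catMetric.cn 0 B w t ht
    simp only [zero_add, sub_zero, dist_zero_right, dist_zero_left] at c1
    rw [hw1, nB, dist_eq_norm w B, hw2] at c1
    rw [pathDist_symm c a, pathDist_symm c b]
    exact (pow_le_pow_left₀ (pathDist_nonneg _ _) this 2).trans c1

/-! ### Segments in cells -/

/-- The straight segment between two points of a common cell. -/
def lineIn (a b : K.Point) (t : ℝ) : K.Point :=
  open scoped Classical in
  if h : (∃ s ∈ K.cells, a ∈ K.cell s ∧ b ∈ K.cell s) ∧ t ∈ Icc (0 : ℝ) 1 then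
    ⟨a.1 + t • (b.1 - a.1), by
      obtain ⟨⟨s, hs, ha, hb⟩, ht⟩ := h
      refine ⟨fun v => ?_, ?_, s, hs, fun v hv => ?_⟩
      · simp only [Pi.add_apply, Pi.smul_apply, Pi.sub_apply, smul_eq_mul]
        nlinarith [a.2.1 v, b.2.1 v, ht.1, ht.2, mul_nonneg ht.1 (b.2.1 v),
          mul_nonneg (sub_nonneg.2 ht.2) (a.2.1 v)]
      · simp [Finset.sum_add_distrib, ← Finset.mul_sum, Finset.sum_sub_distrib, a.2.2.1, b.2.2.1]
      · simp [ha v hv, hb v hv]⟩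
  else a

theorem lineIn_val {a b : K.Point} {s : Finset V} (hs : s ∈ K.cells) (ha : a ∈ K.cell s)
    (hb : b ∈ K.cell s) {t : ℝ} (ht : t ∈ Icc (0 : ℝ) 1) :
    (lineIn a b t).1 = a.1 + t • (b.1 - a.1) := by
  rw [lineIn, dif_pos ⟨⟨s, hs, ha, hb⟩, ht⟩]

theorem lineIn_mem_cell {a b : K.Point} {s : Finset V} (hs : s ∈ K.cells) (ha : a ∈ K.cell s)
    (hb : b ∈ K.cell s) {t : ℝ} (ht : t ∈ Icc (0 : ℝ) 1) : lineIn a b t ∈ K.cell s := by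
  intro v hv
  rw [lineIn_val hs ha hb ht]
  simp [ha v hv, hb v hv]

theorem cellDist_of_sub {a b a' b' : K.Point} {s : Finset V} (hs : s ∈ K.cells) (ha : a ∈ K.cell s)
    (hb : b ∈ K.cell s) (ha' : a' ∈ K.cell s) (hb' : b' ∈ K.cell s) {t : ℝ}
    (h : a'.1 - b'.1 = t • (a.1 - b.1)) : K.cellDist a' b' = |t| * K.cellDist a b := by
  obtain ⟨Z, hZ, -⟩ := K.exists_chart hs
  rw [hZ.cellDist_eq ha' hb', hZ.cellDist_eq ha hb, ← develop_sub, ← develop_sub, h, develop_smul,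
    norm_mul, Complex.norm_real, Real.norm_eq_abs]

theorem cellDist_lineIn {a b : K.Point} {s : Finset V} (hs : s ∈ K.cells) (ha : a ∈ K.cell s)
    (hb : b ∈ K.cell s) {t u : ℝ} (ht : t ∈ Icc (0 : ℝ) 1) (hu : u ∈ Icc (0 : ℝ) 1) :
    K.cellDist (lineIn a b t) (lineIn a b u) = |t - u| * K.cellDist a b := by
  rw [cellDist_of_sub (t := u - t) hs ha hb (lineIn_mem_cell hs ha hb ht)
    (lineIn_mem_cell hs ha hb hu), abs_sub_comm]
  rw [lineIn_val hs ha hb ht, lineIn_val hs ha hb hu]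
  module

/-- A linear function that does not increase distances in the cells containing `t` bounds the
length of short paths from below. -/
theorem path_lower_bound {L : ℝ} (hL : 0 < L) (hLip : ∀ s ∈ K.cells, ∀ a ∈ K.cell s,
      ∀ b ∈ K.cell s, ∀ v, |a.1 v - b.1 v| ≤ L * K.cellDist a b)
    {n : ℕ} {c : ℕ → K.Point}
    (hc : ∀ i < n, ∃ s ∈ K.cells, c i ∈ K.cell s ∧ c (i + 1) ∈ K.cell s) {t : Finset V} {η : ℝ}
    (hη : ∀ v ∈ t, η ≤ (c 0).1 v)
    (hlen : L * ∑ i ∈ Finset.range n, K.cellDist (c i) (c (i + 1)) < η) {F : V → ℝ}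
    (hF : ∀ s ∈ K.cells, t ⊆ s → ∀ a ∈ K.cell s, ∀ b ∈ K.cell s,
      ∑ v, b.1 v * F v - ∑ v, a.1 v * F v ≤ K.cellDist a b) :
    ∑ v, (c n).1 v * F v - ∑ v, (c 0).1 v * F v ≤
      ∑ i ∈ Finset.range n, K.cellDist (c i) (c (i + 1)) := by
  have h1 : ∀ j ≤ n, ∀ v, |(c j).1 v - (c 0).1 v| ≤
      L * ∑ i ∈ Finset.range j, K.cellDist (c i) (c (i + 1)) := by
    intro j
    induction j with
    | zero => intro _ v; simp
    | succ j ih =>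
      intro hj v
      obtain ⟨s, hs, ha, hb⟩ := hc j hj
      have e1 := ih (by omega) v
      have e2 := hLip s hs _ hb _ ha v
      rw [cellDist_symm] at e2
      rw [Finset.sum_range_succ, mul_add]
      have := abs_sub_le ((c (j + 1)).1 v) ((c j).1 v) ((c 0).1 v)
      linarith
  have h2 : ∀ j ≤ n, ∑ v, (c j).1 v * F v - ∑ v, (c 0).1 v * F v ≤
      ∑ i ∈ Finset.range j, K.cellDist (c i) (c (i + 1)) := by
    intro j
    induction j with
    | zero => intro _; simp
    | succ j ih =>
      intro hj
      obtain ⟨s, hs, ha, hb⟩ := hc j hj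
      rw [Finset.sum_range_succ]
      -- A path of length less than `η / L` changes every coordinate by less than `η`, so the
      -- coordinates in `t` stay positive and only cells containing `t` are visited.
      have hts : t ⊆ s := by
        intro v hv
        by_contra hvs
        have e1 := h1 j (by omega) v
        rw [ha v hvs, zero_sub, abs_neg] at e1
        have e2 := hη v hv
        have e3 : ∑ i ∈ Finset.range j, K.cellDist (c i) (c (i + 1)) ≤
            ∑ i ∈ Finset.range n, K.cellDist (c i) (c (i + 1)) :=
          Finset.sum_le_sum_of_subset_of_nonneg (Finset.range_subset_range.2 (by omega))
            fun _ _ _ => cellDist_nonneg _ _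
        have e4 := le_abs_self ((c 0).1 v)
        nlinarith
      have := hF s hs hts _ ha _ hb
      linarith [ih (by omega)]
  exact h2 n le_rfl

/-- In every cell there is a linear function with prescribed direction that is nonexpanding in the
adjacent cells. -/
theorem exists_linear_function {t : Finset V} (ht : t ∈ K.cells) {a b : K.Point}
    (ha : a ∈ K.cell t) (hb : b ∈ K.cell t) (hab : a ≠ b) : ∃ F : V → ℝ,
      (∀ s ∈ K.cells, t ⊆ s → ∀ a ∈ K.cell s, ∀ b ∈ K.cell s,
        ∑ v, b.1 v * F v - ∑ v, a.1 v * F v ≤ K.cellDist a b) ∧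
      ∑ v, b.1 v * F v - ∑ v, a.1 v * F v = K.cellDist a b := by
  classical
  have bound : ∀ (s : Finset V) (Z : V → ℂ), K.IsChart s Z → ∀ e : ℂ, ‖e‖ ≤ 1 → ∀ a ∈ K.cell s,
      ∀ b ∈ K.cell s, ∀ F : V → ℝ, (∀ v ∈ s, F v = (e * Z v).re) →
      ∑ v, b.1 v * F v - ∑ v, a.1 v * F v = (e * (develop Z b.1 - develop Z a.1)).re ∧
      ∑ v, b.1 v * F v - ∑ v, a.1 v * F v ≤ K.cellDist a b := by
    intro s Z hZ e he a ha b hb F hF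
    have key : ∀ x ∈ K.cell s, ∑ v, x.1 v * F v = (e * develop Z x.1).re := by
      intro x hx
      rw [develop, Finset.mul_sum, Complex.re_sum]
      apply Finset.sum_congr rfl
      intro v _
      by_cases hv : v ∈ s
      · rw [hF v hv, mul_left_comm, Complex.re_ofReal_mul]
      · simp [hx v hv]
    have e1 : ∑ v, b.1 v * F v - ∑ v, a.1 v * F v = (e * (develop Z b.1 - develop Z a.1)).re := by
      rw [key a ha, key b hb, mul_sub, Complex.sub_re]
    refine ⟨e1, ?_⟩
    rw [e1, hZ.cellDist_eq ha hb, norm_sub_rev]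
    refine (Complex.re_le_norm _).trans ?_
    rw [norm_mul]
    exact mul_le_of_le_one_left (norm_nonneg _) he
  have hcard := K.card_le t ht
  have hunit : ∀ w : ℂ, ∃ e : ℂ, ‖e‖ ≤ 1 ∧ (e * w).re = ‖w‖ := by
    intro w
    by_cases hw : w = 0
    · exact ⟨0, by simp, by simp [hw]⟩
    · refine ⟨(starRingEnd ℂ) w / ‖w‖, ?_, ?_⟩
      · rw [norm_div, RCLike.norm_conj, Complex.norm_real, norm_norm, div_self (norm_ne_zero_iff.2 hw)]
      · rw [div_mul_eq_mul_div, mul_comm, Complex.mul_conj, Complex.normSq_eq_norm_sq,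
          ← Complex.ofReal_div, Complex.ofReal_re, pow_two, mul_div_assoc,
          div_self (norm_ne_zero_iff.2 hw), mul_one]
  interval_cases hc : t.card
  · rw [Finset.card_eq_zero] at hc
    have := a.2.2.1
    rw [Finset.sum_eq_zero fun v _ => ha v (by simp [hc])] at this
    norm_num at this
  · obtain ⟨r, rfl⟩ := Finset.card_eq_one.1 hc
    exfalso
    apply hab
    have : ∀ x ∈ K.cell {r}, x.1 = Pi.single r 1 := by
      intro x hx
      funext v
      by_cases hv : v = r
      · subst hv
        have := x.2.2.1
        rw [Finset.sum_eq_single v (fun u _ hu => hx u (by simpa using hu)) (by simp)] at this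
        simpa using this
      · rw [hx v (by simpa using hv)]; simp [hv]
    exact Subtype.ext ((this a ha).trans (this b hb).symm)
  · obtain ⟨p, q, hpq, rfl⟩ := Finset.card_eq_two.1 hc
    have hp := K.len_pos _ ht p (by simp) q (by simp) hpq
    -- The coordinate along the edge of the orthogonal projection to its line. It depends only on
    -- the lengths, so one function serves all triangles at the edge.
    set F : V → ℝ := fun v => if v = p then 0 else if v = q then K.len p q else
      (K.len p v ^ 2 + K.len p q ^ 2 - K.len q v ^ 2) / (2 * K.len p q) with hFdef
    have hch : ∀ s ∈ K.cells, {p, q} ⊆ s → ∃ Z : V → ℂ, K.IsChart s Z ∧ ∀ v ∈ s, F v = (Z v).re := by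
      intro s hs hsub
      by_cases hs2 : s = {p, q}
      · subst hs2
        refine ⟨fun v => if v = q then K.len p q else 0,
          isChart_edge (by simp [hpq]) (by simp) hp.le, fun v hv => ?_⟩
        simp only [Finset.mem_insert, Finset.mem_singleton] at hv
        rcases hv with rfl | rfl
        · simp [hFdef, hpq]
        · simp [hFdef, hpq.symm]
      · obtain ⟨r, hr, hr'⟩ := Finset.exists_of_ssubset (hsub.ssubset_of_ne (Ne.symm hs2))
        simp only [Finset.mem_insert, Finset.mem_singleton, not_or] at hr'
        have hs3 : s = {p, q, r} := by
          symm
          apply Finset.eq_of_subset_of_card_le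
          · intro v hv
            simp only [Finset.mem_insert, Finset.mem_singleton] at hv
            rcases hv with rfl | rfl | rfl
            · exact hsub (by simp)
            · exact hsub (by simp)
            · exact hr
          · refine (K.card_le s hs).trans ?_
            rw [Finset.card_insert_of_notMem (by simp [hpq, Ne.symm hr'.1]),
              Finset.card_pair (Ne.symm hr'.2)]
        subst hs3
        obtain ⟨w, hw, -, hw1, hw2⟩ := K.exists_apex hs hpq (Ne.symm hr'.1) (Ne.symm hr'.2)
        refine ⟨fun v => if v = r then w else if v = q then K.len p q else 0,
          isChart_triangle (by simp [hpq, Ne.symm hr'.1]) (by simp [Ne.symm hr'.2]) hp.le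
            (by simpa using hw1) (by simpa using hw2), fun v hv => ?_⟩
        simp only [Finset.mem_insert, Finset.mem_singleton] at hv
        by_cases hvr : v = r
        · subst hvr
          simp [hFdef, hr'.1, hr'.2, hw]
        · rcases hv with rfl | rfl | rfl
          · simp [hFdef, hpq, hvr]
          · simp [hFdef, hpq.symm, hvr]
          · exact (hvr rfl).elim
    obtain ⟨Z, hZ, hFZ⟩ := hch _ ht (Finset.Subset.refl _)
    have h1 := (bound _ Z hZ 1 (by simp) a ha b hb F fun v hv => by rw [one_mul]; exact hFZ v hv).1
    -- The sign accounts for the order of `a` and `b` along the edge.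
    have h2 : ∃ ε : ℝ, |ε| = 1 ∧ ε * (∑ v, b.1 v * F v - ∑ v, a.1 v * F v) = K.cellDist a b := by
      have him : ∀ x ∈ K.cell {p, q}, (develop Z x.1).im = x.1 p * (Z p).im + x.1 q * (Z q).im := by
        intro x hx
        rw [develop, Complex.im_sum, ← Finset.sum_subset (Finset.subset_univ {p, q})
          (fun v _ hv => by simp [hx v hv]), Finset.sum_pair hpq]
        simp
      have hre : ∀ x ∈ K.cell {p, q}, x.1 p + x.1 q = 1 := by
        intro x hx
        have := x.2.2.1
        rwa [← Finset.sum_subset (Finset.subset_univ {p, q})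
          (fun v _ hv => hx v hv), Finset.sum_pair hpq] at this
      have hpq' : ‖Z p - Z q‖ = K.len p q := hZ p (by simp) q (by simp)
      have hFp : (Z p).re = 0 := by rw [← hFZ p (by simp)]; simp [hFdef]
      have hFq : (Z q).re = K.len p q := by rw [← hFZ q (by simp)]; simp [hFdef, hpq.symm]
      have hzim : (Z p).im = (Z q).im := by
        have := congrArg (· ^ 2) hpq'
        simp only [Complex.sq_norm, Complex.normSq_apply, Complex.sub_re, Complex.sub_im] at this
        rw [hFp, hFq] at this
        nlinarith [sq_nonneg ((Z p).im - (Z q).im)]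
      have him0 : (develop Z b.1 - develop Z a.1).im = 0 := by
        rw [Complex.sub_im, him a ha, him b hb, hzim, ← add_mul, ← add_mul, hre a ha, hre b hb,
          sub_self]
      have hn : K.cellDist a b = |(develop Z b.1 - develop Z a.1).re| := by
        rw [hZ.cellDist_eq ha hb, norm_sub_rev, Complex.norm_eq_sqrt_sq_add_sq, him0,
          zero_pow two_ne_zero, add_zero, Real.sqrt_sq_eq_abs]
      rw [h1, one_mul, hn]
      rcases le_total 0 (develop Z b.1 - develop Z a.1).re with h | h
      · exact ⟨1, by simp, by rw [abs_of_nonneg h, one_mul]⟩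
      · exact ⟨-1, by simp, by rw [abs_of_nonpos h]; ring⟩
    obtain ⟨ε, hε, h2⟩ := h2
    have hsum : ∀ x : V → ℝ, ∑ v, x v * (ε * F v) = ε * ∑ v, x v * F v := fun x => by
      rw [Finset.mul_sum]; exact Finset.sum_congr rfl fun v _ => by ring
    refine ⟨fun v => ε * F v, fun s hs hts a ha b hb => ?_, ?_⟩
    · obtain ⟨Z, hZ, hFZ⟩ := hch s hs hts
      refine (bound s Z hZ (ε : ℂ) ?_ a ha b hb _ fun v hv => ?_).2
      · rw [Complex.norm_real, Real.norm_eq_abs, hε]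
      · rw [Complex.re_ofReal_mul, hFZ v hv]
    · rw [hsum, hsum, ← mul_sub, h2]
  · obtain ⟨Z, hZ, -⟩ := K.exists_chart ht
    obtain ⟨e, he, hew⟩ := hunit (develop Z b.1 - develop Z a.1)
    refine ⟨fun v => (e * Z v).re, fun s hs hts a ha b hb => ?_, ?_⟩
    · have : t = s := Finset.eq_of_subset_of_card_le hts (by rw [hc]; exact K.card_le s hs)
      subst this
      exact (bound t Z hZ e he a ha b hb _ fun v _ => rfl).2
    · rw [(bound t Z hZ e he a ha b hb _ fun v _ => rfl).1, hew, hZ.cellDist_eq ha hb,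
        norm_sub_rev]

variable {σ : K.Point → K.Point → ℝ → K.Point}

theorem exists_pathLen (hσ : CATMetric K.pathDist σ) (a b : K.Point) :
    {L | K.PathLen a b L}.Nonempty := by
  by_contra hne
  rw [not_nonempty_iff_eq_empty] at hne
  have h0 : K.pathDist a b = 0 := by rw [pathDist_eq_sInf, hne, Real.sInf_empty]
  have := hσ.eq_of _ _ h0
  subst this
  have h1 : (0 : ℝ) ∈ {L | K.PathLen a a L} := pathLen_refl a
  rw [hne] at h1
  exact h1

/-- Along the segment the coordinates in `t` are at least `m > 0`, so a short competing path stays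
in cells containing `t`, where a nonexpanding linear function bounds its length from below. Thus the
segment is a local geodesic, and `of_local` applies. -/
theorem pathDist_eq_of_openCell (hσ : CATMetric K.pathDist σ) {t : Finset V} (ht : t ∈ K.cells)
    {a b : K.Point} (ha : a ∈ K.openCell t) (hb : b ∈ K.openCell t) :
    K.pathDist a b = K.cellDist a b := by
  obtain ⟨ha, hapos⟩ := ha
  obtain ⟨hb, hbpos⟩ := hb
  by_cases hab : a = b
  · subst hab
    refine le_antisymm (pathDist_le_cellDist ht ha ha) ?_
    obtain ⟨Z, hZ, -⟩ := K.exists_chart ht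
    rw [hZ.cellDist_eq ha ha, sub_self, norm_zero]
    exact pathDist_nonneg _ _
  obtain ⟨L, hL, hLip⟩ := K.exists_coord_lipschitz
  obtain ⟨F, hF, hFab⟩ := exists_linear_function ht ha hb hab
  obtain ⟨m, hm, hma⟩ : ∃ m > 0, ∀ v ∈ t, m ≤ a.1 v ∧ m ≤ b.1 v := by
    rcases t.eq_empty_or_nonempty with rfl | hne
    · exact ⟨1, one_pos, by simp⟩
    · obtain ⟨v, hv, hmin⟩ := t.exists_min_image (fun v => min (a.1 v) (b.1 v)) hne
      exact ⟨_, lt_min (hapos v hv) (hbpos v hv), fun u hu =>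
        ⟨(hmin u hu).trans (min_le_left _ _), (hmin u hu).trans (min_le_right _ _)⟩⟩
  have hD := cellDist_nonneg a b
  set D := K.cellDist a b with hDdef
  have h0 : (0 : ℝ) ∈ Icc (0 : ℝ) 1 := by simp
  have h1 : (1 : ℝ) ∈ Icc (0 : ℝ) 1 := by simp
  have key : ∀ s ∈ Icc (0 : ℝ) 1, ∀ u ∈ Icc (0 : ℝ) 1, s ≤ u → L * (|s - u| * D) < m →
      K.pathDist (lineIn a b s) (lineIn a b u) = |s - u| * D := by
    intro s hs u hu hsu hlt
    apply le_antisymm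
    · rw [← cellDist_lineIn ht ha hb hs hu]
      exact pathDist_le_cellDist ht (lineIn_mem_cell ht ha hb hs) (lineIn_mem_cell ht ha hb hu)
    · rw [pathDist_eq_sInf]
      apply le_csInf (exists_pathLen hσ _ _)
      rintro ℓ ⟨n, c, hc0, hcn, hc, rfl⟩
      by_cases hlen : L * ∑ i ∈ Finset.range n, K.cellDist (c i) (c (i + 1)) < m
      · have := path_lower_bound hL hLip hc (t := t) (η := m) (fun v hv => by
          rw [hc0, lineIn_val ht ha hb hs]
          simp only [Pi.add_apply, Pi.smul_apply, Pi.sub_apply, smul_eq_mul]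
          have e1 := mul_le_mul_of_nonneg_left (hma v hv).1 (sub_nonneg.2 hs.2)
          have e2 := mul_le_mul_of_nonneg_left (hma v hv).2 hs.1
          nlinarith) hlen hF
        refine le_trans (le_of_eq ?_) this
        rw [hc0, hcn, lineIn_val ht ha hb hs, lineIn_val ht ha hb hu]
        have e : ∀ x : ℝ, ∑ v, (a.1 + x • (b.1 - a.1)) v * F v = ∑ v, a.1 v * F v +
            x * (∑ v, b.1 v * F v - ∑ v, a.1 v * F v) := by
          intro x
          rw [← Finset.sum_sub_distrib, Finset.mul_sum, ← Finset.sum_add_distrib]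
          apply Finset.sum_congr rfl
          intro v _
          simp only [Pi.add_apply, Pi.smul_apply, Pi.sub_apply, smul_eq_mul]
          ring
        rw [e, e, hFab, abs_sub_comm, abs_of_nonneg (by linarith)]
        ring
      · push Not at hlen
        exact le_of_mul_le_mul_left (hlt.le.trans hlen) hL
  have := hσ.of_local (c := lineIn a b) (D := D) (by
    intro u hu
    refine ⟨m / (2 * L * (D + 1)), by positivity, fun s hs s' hs' h1 h2 => ?_⟩
    have h3 : L * (|s - s'| * D) < m := by
      have h4 : |s - s'| < m / (2 * L * (D + 1)) + m / (2 * L * (D + 1)) := by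
        have := abs_sub_le s u s'
        rw [abs_sub_comm u s'] at this
        linarith
      have h5 : m / (2 * L * (D + 1)) + m / (2 * L * (D + 1)) = m / (L * (D + 1)) := by
        field_simp; norm_num
      rw [h5, lt_div_iff₀ (by positivity)] at h4
      nlinarith [abs_nonneg (s - s')]
    rcases le_total s s' with h | h
    · exact key s hs s' hs' h h3
    · rw [pathDist_symm, abs_sub_comm]
      exact key s' hs' s hs h (by rwa [abs_sub_comm]))
  have e0 : lineIn a b 0 = a := Subtype.ext (by rw [lineIn_val ht ha hb h0]; simp)
  have e1 : lineIn a b 1 = b := Subtype.ext (by rw [lineIn_val ht ha hb h1]; simp)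
  rwa [e0, e1] at this

/-- Cells are isometrically embedded. -/
theorem pathDist_eq_cellDist (hσ : CATMetric K.pathDist σ) {s : Finset V} (hs : s ∈ K.cells)
    {a b : K.Point} (ha : a ∈ K.cell s) (hb : b ∈ K.cell s) :
    K.pathDist a b = K.cellDist a b := by
  classical
  apply le_antisymm (pathDist_le_cellDist hs ha hb)
  set t : Finset V := Finset.univ.filter fun v => 0 < a.1 v ∨ 0 < b.1 v with ht
  have hts : t ⊆ s := by
    intro v hv
    by_contra hvs
    simp only [ht, Finset.mem_filter, Finset.mem_univ, true_and, ha v hvs, hb v hvs,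
      lt_irrefl, or_self] at hv
  have htc := K.down_closed s hs t hts
  have hat : a ∈ K.cell t := by
    intro v hv
    simp only [ht, Finset.mem_filter, Finset.mem_univ, true_and, not_or, not_lt] at hv
    exact le_antisymm hv.1 (a.2.1 v)
  have hbt : b ∈ K.cell t := by
    intro v hv
    simp only [ht, Finset.mem_filter, Finset.mem_univ, true_and, not_or, not_lt] at hv
    exact le_antisymm hv.2 (b.2.1 v)
  have hopen : ∀ u : ℝ, 0 < u → u < 1 → lineIn a b u ∈ K.openCell t := by
    intro u hu0 hu1
    refine ⟨lineIn_mem_cell htc hat hbt ⟨hu0.le, hu1.le⟩, fun v hv => ?_⟩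
    rw [lineIn_val htc hat hbt ⟨hu0.le, hu1.le⟩]
    simp only [ht, Finset.mem_filter, Finset.mem_univ, true_and] at hv
    simp only [Pi.add_apply, Pi.smul_apply, Pi.sub_apply, smul_eq_mul]
    have e1 := a.2.1 v
    have e2 := b.2.1 v
    rcases hv with hv | hv
    · nlinarith [mul_pos (sub_pos.2 hu1) hv, mul_nonneg hu0.le e2]
    · nlinarith [mul_pos hu0 hv, mul_nonneg (sub_nonneg.2 hu1.le) e1]
  have h0 : (0 : ℝ) ∈ Icc (0 : ℝ) 1 := by simp
  have h1 : (1 : ℝ) ∈ Icc (0 : ℝ) 1 := by simp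
  have e0 : lineIn a b 0 = a := Subtype.ext (by rw [lineIn_val hs ha hb h0]; simp)
  have e1 : lineIn a b 1 = b := Subtype.ext (by rw [lineIn_val hs ha hb h1]; simp)
  have hD := cellDist_nonneg a b
  -- Between ratios `ε` and `1 - ε` the segment lies in the open cell of the joint support, where
  -- its length `1 - 2ε` times `cellDist` is a distance. The two end pieces cost at most `ε` times
  -- `cellDist` each.
  have key : ∀ ε : ℝ, 0 < ε → ε < 1 / 2 → (1 - 4 * ε) * K.cellDist a b ≤ K.pathDist a b := by
    intro ε hε hε2
    have hεI : ε ∈ Icc (0 : ℝ) 1 := ⟨hε.le, by linarith⟩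
    have hεI' : 1 - ε ∈ Icc (0 : ℝ) 1 := ⟨by linarith, by linarith⟩
    have k1 := pathDist_eq_of_openCell hσ htc (hopen ε hε (by linarith))
      (hopen (1 - ε) (by linarith) (by linarith))
    rw [cellDist_lineIn hs ha hb hεI hεI', abs_sub_comm, abs_of_nonneg (by linarith)] at k1
    have k2 := pathDist_le_cellDist hs (lineIn_mem_cell hs ha hb hεI) (lineIn_mem_cell hs ha hb h0)
    rw [cellDist_lineIn hs ha hb hεI h0, e0, sub_zero, abs_of_nonneg hε.le] at k2
    have k3 := pathDist_le_cellDist hs (lineIn_mem_cell hs ha hb h1)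
      (lineIn_mem_cell hs ha hb hεI')
    rw [cellDist_lineIn hs ha hb h1 hεI', e1, sub_sub_cancel, abs_of_nonneg hε.le] at k3
    have k4 := hσ.tri (lineIn a b ε) a (lineIn a b (1 - ε))
    have k5 := hσ.tri a b (lineIn a b (1 - ε))
    nlinarith
  by_contra hlt
  push Not at hlt
  have hpos : 0 < K.cellDist a b := (pathDist_nonneg a b).trans_lt hlt
  -- With this `ε` the loss is at most half of the supposed gap.
  have := key (min (1 / 4) ((K.cellDist a b - K.pathDist a b) / (8 * K.cellDist a b)))
    (lt_min (by norm_num) (div_pos (by linarith) (by linarith)))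
    ((min_le_left _ _).trans_lt (by norm_num))
  have h2 : min (1 / 4) ((K.cellDist a b - K.pathDist a b) / (8 * K.cellDist a b)) ≤
    (K.cellDist a b - K.pathDist a b) / (8 * K.cellDist a b) := min_le_right _ _
  rw [le_div_iff₀ (by linarith)] at h2
  nlinarith

theorem lineIn_eq_seg (hσ : CATMetric K.pathDist σ) {s : Finset V} (hs : s ∈ K.cells)
    {a b : K.Point} (ha : a ∈ K.cell s) (hb : b ∈ K.cell s) {t : ℝ} (ht : t ∈ Icc (0 : ℝ) 1) :
    lineIn a b t = σ a b t := by
  have h0 : (0 : ℝ) ∈ Icc (0 : ℝ) 1 := by simp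
  have h1 : (1 : ℝ) ∈ Icc (0 : ℝ) 1 := by simp
  have e0 : lineIn a b 0 = a := Subtype.ext (by rw [lineIn_val hs ha hb h0]; simp)
  have e1 : lineIn a b 1 = b := Subtype.ext (by rw [lineIn_val hs ha hb h1]; simp)
  have k1 := cellDist_lineIn hs ha hb h0 ht
  have k2 := cellDist_lineIn hs ha hb ht h1
  rw [e0, zero_sub, abs_neg, abs_of_nonneg ht.1] at k1
  rw [e1, abs_sub_comm, abs_of_nonneg (by linarith [ht.2])] at k2
  apply hσ.eq_seg ht
  · rw [pathDist_eq_cellDist hσ hs ha (lineIn_mem_cell hs ha hb ht), k1,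
      pathDist_eq_cellDist hσ hs ha hb]
  · rw [pathDist_eq_cellDist hσ hs (lineIn_mem_cell hs ha hb ht) hb, k2,
      pathDist_eq_cellDist hσ hs ha hb]

theorem seg_val (hσ : CATMetric K.pathDist σ) {s : Finset V} (hs : s ∈ K.cells)
    {a b : K.Point} (ha : a ∈ K.cell s) (hb : b ∈ K.cell s) {t : ℝ} (ht : t ∈ Icc (0 : ℝ) 1) :
    (σ a b t).1 = a.1 + t • (b.1 - a.1) := by
  rw [← lineIn_eq_seg hσ hs ha hb ht, lineIn_val hs ha hb ht]

theorem seg_mem_cell (hσ : CATMetric K.pathDist σ) {s : Finset V} (hs : s ∈ K.cells)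
    {a b : K.Point} (ha : a ∈ K.cell s) (hb : b ∈ K.cell s) {t : ℝ} (ht : t ∈ Icc (0 : ℝ) 1) :
    σ a b t ∈ K.cell s := by
  rw [← lineIn_eq_seg hσ hs ha hb ht]
  exact lineIn_mem_cell hs ha hb ht

/-! ### Topology -/

theorem exists_cell (w : K.Point) : ∃ s ∈ K.cells, w ∈ K.cell s := w.2.2.2

theorem eventually_pos (v : K.Point) : ∀ᶠ w in 𝓝 v, ∀ u, 0 < v.1 u → 0 < w.1 u := by
  rw [eventually_all]
  intro u
  by_cases hu : 0 < v.1 u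
  · have : Continuous fun w : K.Point => w.1 u := (continuous_apply u).comp continuous_subtype_val
    filter_upwards [this.continuousAt.eventually (lt_mem_nhds hu)] with w hw _ using hw
  · exact Eventually.of_forall fun w h => (hu h).elim

theorem mem_cell_of_pos {v w : K.Point} (h : ∀ u, 0 < v.1 u → 0 < w.1 u) {s : Finset V}
    (hw : w ∈ K.cell s) : v ∈ K.cell s := by
  intro u hu
  by_contra hne
  exact (h u (lt_of_le_of_ne (v.2.1 u) (Ne.symm hne))).ne' (hw u hu)

/-- Near `v` no positive coordinate of `v` vanishes, so every cell containing `w` contains `v`. -/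
theorem eventually_common_cell (v : K.Point) :
    ∀ᶠ w in 𝓝 v, ∃ s ∈ K.cells, v ∈ K.cell s ∧ w ∈ K.cell s := by
  filter_upwards [eventually_pos v] with w hw
  obtain ⟨s, hs, hws⟩ := exists_cell w
  exact ⟨s, hs, mem_cell_of_pos hw hws, hws⟩

theorem eventually_pathDist_lt (v : K.Point) {ε : ℝ} (hε : 0 < ε) :
    ∀ᶠ w in 𝓝 v, K.pathDist v w < ε := by
  have hcont : Continuous fun w : K.Point => K.cellDist v w := by
    unfold cellDist
    have : ∀ u, Continuous fun w : K.Point => w.1 u := fun u =>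
      (continuous_apply u).comp continuous_subtype_val
    refine Real.continuous_sqrt.comp (Continuous.div_const (Continuous.neg ?_) 2)
    refine continuous_finsetSum _ fun u _ => continuous_finsetSum _ fun u' _ => ?_
    exact (continuous_const.mul (continuous_const.sub (this u))).mul
      (continuous_const.sub (this u'))
  have h0 : K.cellDist v v = 0 := by simp [cellDist]
  filter_upwards [eventually_common_cell v, hcont.continuousAt.eventually
    (gt_mem_nhds (by rwa [h0] : K.cellDist v v < ε))] with w hw hw'
  obtain ⟨s, hs, h1, h2⟩ := hw
  exact (pathDist_le_cellDist hs h1 h2).trans_lt hw'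

theorem exists_coord_le_pathDist (hσ : CATMetric K.pathDist σ) :
    ∃ L > 0, ∀ (a b : K.Point) (v : V), |a.1 v - b.1 v| ≤ L * K.pathDist a b := by
  obtain ⟨L, hL, h⟩ := K.exists_coord_lipschitz
  refine ⟨L, hL, fun a b v => ?_⟩
  rw [← div_le_iff₀' hL, pathDist_eq_sInf]
  apply le_csInf (exists_pathLen hσ a b)
  rintro _ ⟨n, c, rfl, rfl, hc, rfl⟩
  rw [div_le_iff₀' hL]
  have : ∀ j ≤ n, |(c 0).1 v - (c j).1 v| ≤
      L * ∑ i ∈ Finset.range j, K.cellDist (c i) (c (i + 1)) := by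
    intro j
    induction j with
    | zero => intro _; simp
    | succ j ih =>
      intro hj
      obtain ⟨s, hs, h1, h2⟩ := hc j hj
      rw [Finset.sum_range_succ, mul_add]
      have e1 := h s hs _ h1 _ h2 v
      have := abs_sub_le ((c 0).1 v) ((c j).1 v) ((c (j + 1)).1 v)
      linarith [ih (by omega)]
  exact this n le_rfl

/-- Together with `eventually_pathDist_lt` this says that the topology of barycentric coordinates is
that of the intrinsic metric. -/
theorem exists_ball_subset (hσ : CATMetric K.pathDist σ) {v : K.Point} {U : Set K.Point}
    (hU : U ∈ 𝓝 v) : ∃ r > 0, ∀ w, K.pathDist v w < r → w ∈ U := by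
  obtain ⟨L, hL, h⟩ := exists_coord_le_pathDist hσ
  obtain ⟨ε, hε, hεU⟩ := Metric.mem_nhds_iff.1 hU
  refine ⟨ε / L, by positivity, fun w hw => hεU ?_⟩
  rw [Metric.mem_ball, Subtype.dist_eq, dist_pi_lt_iff hε]
  intro u
  rw [Real.dist_eq]
  refine (h w v u).trans_lt ?_
  rw [lt_div_iff₀' hL] at hw
  rwa [pathDist_symm]

theorem continuous_pathDist (hσ : CATMetric K.pathDist σ) (a : K.Point) :
    Continuous fun w => K.pathDist a w := by
  rw [continuous_iff_continuousAt]
  intro w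
  rw [ContinuousAt, Metric.tendsto_nhds]
  intro ε hε
  filter_upwards [eventually_pathDist_lt w hε] with w' hw'
  rw [Real.dist_eq]
  refine (hσ.abs_dist_sub_le a w' a w).trans_lt ?_
  rwa [hσ.self, zero_add, hσ.comm]

theorem continuousOn_of_pathDist (hσ : CATMetric K.pathDist σ) {Y : Type*} [TopologicalSpace Y]
    {g : Y → K.Point} {S : Set Y}
    (hg : ∀ y ∈ S, ∀ ε > 0, ∀ᶠ y' in 𝓝[S] y, K.pathDist (g y) (g y') < ε) : ContinuousOn g S := by
  intro y hy U hU
  obtain ⟨r, hr, h⟩ := exists_ball_subset hσ hU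
  rw [mem_map]
  filter_upwards [hg y hy r hr] with y' hy' using h _ hy'

theorem continuousOn_seg (hσ : CATMetric K.pathDist σ) (a b : K.Point) :
    ContinuousOn (σ a b) (Icc 0 1) := by
  refine continuousOn_of_pathDist hσ fun t ht ε hε => ?_
  have hn := pathDist_nonneg a b
  filter_upwards [self_mem_nhdsWithin, mem_nhdsWithin_of_mem_nhds
    (Metric.ball_mem_nhds t (show 0 < ε / (K.pathDist a b + 1) by positivity))] with s hs hst
  rw [hσ.seg a b t ht s hs, abs_sub_comm]
  rw [Metric.mem_ball, Real.dist_eq, lt_div_iff₀ (by positivity)] at hst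
  nlinarith [abs_nonneg (s - t)]

theorem mem_geod_iff (hσ : CATMetric K.pathDist σ) {a b y : K.Point} :
    y ∈ K.geod a b ↔ ∃ t ∈ Icc (0 : ℝ) 1, y = σ a b t :=
  ⟨fun h => hσ.exists_of_between h, fun ⟨t, ht, e⟩ => by
    rw [e]; exact hσ.between_seg a b ht⟩

theorem left_mem_geod (a b : K.Point) : a ∈ K.geod a b := by
  simp [geod, pathDist_self]

theorem right_mem_geod (a b : K.Point) : b ∈ K.geod a b := by
  simp [geod, pathDist_self]

theorem geod_symm (a b : K.Point) : K.geod a b = K.geod b a := by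
  ext y
  simp only [geod, Set.mem_ofPred_eq]
  rw [pathDist_symm a y, pathDist_symm y b, pathDist_symm a b, add_comm]

theorem isClosed_geod (hσ : CATMetric K.pathDist σ) (a b : K.Point) : IsClosed (K.geod a b) := by
  have h1 := continuous_pathDist hσ a
  have h2 : Continuous fun y => K.pathDist y b := by
    simp_rw [pathDist_symm _ b]; exact continuous_pathDist hσ b
  exact isClosed_eq (h1.add h2) continuous_const

theorem exists_pathDist_le (hσ : CATMetric K.pathDist σ) (z : K.Point) :
    ∃ M, ∀ x, K.pathDist z x ≤ M := by
  have hcomp : IsCompact {w : V → ℝ | (∀ v, 0 ≤ w v) ∧ ∑ v, w v = 1 ∧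
      ∃ s ∈ K.cells, ∀ v, v ∉ s → w v = 0} := by
    apply (isCompact_univ_pi fun _ : V => isCompact_Icc (a := (0 : ℝ)) (b := 1)).of_isClosed_subset
    · have h1 : IsClosed {w : V → ℝ | ∀ v, 0 ≤ w v} := by
        simp only [Set.ofPred_forall]
        exact isClosed_iInter fun v => isClosed_le continuous_const (continuous_apply v)
      have h2 : IsClosed {w : V → ℝ | ∑ v, w v = 1} :=
        isClosed_eq (continuous_finsetSum _ fun v _ => continuous_apply v) continuous_const
      have h3 : IsClosed {w : V → ℝ | ∃ s ∈ K.cells, ∀ v, v ∉ s → w v = 0} := by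
        have : {w : V → ℝ | ∃ s ∈ K.cells, ∀ v, v ∉ s → w v = 0} =
            ⋃ s ∈ K.cells, {w : V → ℝ | ∀ v, v ∉ s → w v = 0} := by ext; simp
        rw [this]
        apply (Set.toFinite K.cells).isClosed_biUnion
        intro s _
        simp only [Set.ofPred_forall]
        exact isClosed_iInter fun v => isClosed_iInter fun _ =>
          isClosed_eq (continuous_apply v) continuous_const
      exact h1.inter (h2.inter h3)
    · rintro w ⟨h0, h1, -⟩ v -
      refine ⟨h0 v, ?_⟩
      rw [← h1]
      exact Finset.single_le_sum (fun u _ => h0 u) (Finset.mem_univ v)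
  have : CompactSpace K.Point := isCompact_iff_compactSpace.1 hcomp
  obtain ⟨M, hM⟩ := (isCompact_range (continuous_pathDist hσ z)).bddAbove
  exact ⟨M, fun x => hM ⟨x, rfl⟩⟩

/-- The vertex `v` as a point of the complex. -/
def vertexPoint (v : V) (hv : ({v} : Finset V) ∈ K.cells) : K.Point :=
  open scoped Classical in
  ⟨Pi.single v 1, fun u => by by_cases h : u = v <;> simp [h], by simp, {v}, hv,
    fun u hu => by simp at hu; simp [hu]⟩

theorem singleton_mem {s : Finset V} (hs : s ∈ K.cells) {v : V} (hv : v ∈ s) :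
    ({v} : Finset V) ∈ K.cells := K.down_closed s hs _ (by simpa using hv)

theorem vertexPoint_mem_cell {v : V} (hv : ({v} : Finset V) ∈ K.cells) {s : Finset V}
    (hvs : v ∈ s) : vertexPoint v hv ∈ K.cell s := by
  intro u hu
  have : u ≠ v := fun h => hu (h ▸ hvs)
  simp [vertexPoint, this]

theorem isVertexAt_vertexPoint {v : V} (hv : ({v} : Finset V) ∈ K.cells) :
    K.IsVertexAt v (vertexPoint v hv) := by
  simp [IsVertexAt, vertexPoint]

/-! ### Regions bounded by two geodesics -/

/-- `C` is the union of the geodesics from `z` to `p` and to `q` with a component of their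
complement, and contains no vertices outside of these geodesics. -/
structure IsConeRegion (K : TriangleComplex V) (z p q : K.Point) (C : Set K.Point) : Prop where
  region_eq : ∃ y ∈ (K.geod z p ∪ K.geod z q)ᶜ,
    C = (K.geod z p ∪ K.geod z q) ∪ connectedComponentIn (K.geod z p ∪ K.geod z q)ᶜ y
  vertex : ∀ (v : V) (y : K.Point), K.IsVertexAt v y → y ∈ C → y ∈ K.geod z p ∪ K.geod z q

namespace IsConeRegion

variable {z p q : K.Point} {C : Set K.Point} (H : K.IsConeRegion z p q C)
  (hσ : CATMetric K.pathDist σ)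

include H

theorem symm : K.IsConeRegion z q p C where
  region_eq := by
    rw [union_comm (K.geod z q)]; exact H.region_eq
  vertex v y := by
    rw [union_comm (K.geod z q)]; exact H.vertex v y

theorem sides_subset : K.geod z p ∪ K.geod z q ⊆ C := by
  obtain ⟨y, -, h⟩ := H.region_eq
  rw [h]; exact subset_union_left

theorem mem_of_isPreconnected {T : Set K.Point} (hT : IsPreconnected T) {y a : K.Point}
    (hy : y ∈ C) (hyT : y ∈ T) (haT : a ∈ T) (hTS : T ⊆ (K.geod z p ∪ K.geod z q)ᶜ) : a ∈ C := by
  obtain ⟨y₀, -, h⟩ := H.region_eq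
  rw [h] at hy ⊢
  have hy' := hy.resolve_left (hTS hyT)
  right
  rw [connectedComponentIn_eq hy']
  exact hT.subset_connectedComponentIn hyT hTS haT

include hσ

theorem mem_of_seg {y a : K.Point} (hy : y ∈ C)
    (h : ∀ t ∈ Icc (0 : ℝ) 1, σ y a t ∉ K.geod z p ∪ K.geod z q) : a ∈ C := by
  refine H.mem_of_isPreconnected (isPreconnected_Icc.image _ (continuousOn_seg hσ y a)) hy
    ⟨0, by simp, hσ.zero y a⟩ ⟨1, by simp, hσ.one y a⟩ ?_
  rintro _ ⟨t, ht, rfl⟩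
  exact h t ht

theorem isClosed_sides : IsClosed (K.geod z p ∪ K.geod z q) :=
  (isClosed_geod hσ z p).union (isClosed_geod hσ z q)

theorem exists_ball_not_sides {y : K.Point} (hy : y ∉ K.geod z p ∪ K.geod z q) :
    ∃ r > 0, ∀ a, K.pathDist y a < r → a ∉ K.geod z p ∪ K.geod z q :=
  exists_ball_subset hσ ((H.isClosed_sides hσ).isOpen_compl.mem_nhds hy)

/-- Balls are geodesically convex, so every point of a ball that misses the sides is joined to `y`
off the sides. -/
theorem exists_ball {y : K.Point} (hy : y ∈ C) (hyS : y ∉ K.geod z p ∪ K.geod z q) :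
    ∃ r > 0, ∀ a, K.pathDist y a < r → a ∈ C ∧ a ∉ K.geod z p ∪ K.geod z q := by
  obtain ⟨r, hr, h⟩ := H.exists_ball_not_sides hσ hyS
  refine ⟨r, hr, fun a ha => ⟨H.mem_of_seg hσ hy fun t ht => h _ ?_, h a ha⟩⟩
  exact hσ.ball_convex (by rwa [hσ.self]) ha ht

theorem closed {x : K.Point} (hx : ∀ ε > 0, ∃ y ∈ C, K.pathDist x y < ε) : x ∈ C := by
  by_cases hxS : x ∈ K.geod z p ∪ K.geod z q
  · exact H.sides_subset hxS
  obtain ⟨r, hr, h⟩ := H.exists_ball_not_sides hσ hxS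
  obtain ⟨y, hy, hxy⟩ := hx r hr
  refine H.mem_of_seg hσ hy fun t ht => h _ ?_
  exact hσ.ball_convex hxy (by rwa [hσ.self]) ht

/-- The first point of a closed set on a geodesic. -/
theorem exists_first {S : Set K.Point} (hS : IsClosed S) {y a : K.Point} (hy : y ∉ S)
    (hex : ∃ t ∈ Icc (0 : ℝ) 1, σ y a t ∈ S) :
    ∃ t, 0 < t ∧ t ≤ 1 ∧ σ y a t ∈ S ∧ ∀ s, 0 ≤ s → s < t → σ y a s ∉ S := by
  have hcl : IsClosed (Icc (0 : ℝ) 1 ∩ σ y a ⁻¹' S) :=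
    (continuousOn_seg hσ y a).preimage_isClosed_of_isClosed isClosed_Icc hS
  have hne : (Icc (0 : ℝ) 1 ∩ σ y a ⁻¹' S).Nonempty := hex
  have hcomp : IsCompact (Icc (0 : ℝ) 1 ∩ σ y a ⁻¹' S) :=
    isCompact_Icc.of_isClosed_subset hcl inter_subset_left
  obtain ⟨t, ⟨ht, htS⟩, hmin⟩ := hcomp.exists_isLeast hne
  refine ⟨t, lt_of_le_of_ne ht.1 ?_, ht.2, htS, fun s hs hst hsS => ?_⟩
  · rintro rfl
    rw [mem_preimage, hσ.zero] at htS
    exact hy htS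
  · exact absurd (hmin ⟨⟨hs, hst.le.trans ht.2⟩, hsS⟩) (not_le.2 hst)

theorem first_hit {y a : K.Point} (hy : y ∈ C) (hyS : y ∉ K.geod z p ∪ K.geod z q)
    (ha : a ∈ C → a ∈ K.geod z p ∪ K.geod z q) :
    ∃ t, 0 < t ∧ t ≤ 1 ∧ σ y a t ∈ K.geod z p ∪ K.geod z q ∧
      ∀ s, 0 ≤ s → s < t → σ y a s ∈ C ∧ σ y a s ∉ K.geod z p ∪ K.geod z q := by
  have hex : ∃ t ∈ Icc (0 : ℝ) 1, σ y a t ∈ K.geod z p ∪ K.geod z q := by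
    by_contra hne
    push Not at hne
    have := ha (H.mem_of_seg hσ hy hne)
    have h1 := hne 1 (by simp)
    rw [hσ.one] at h1
    exact h1 this
  obtain ⟨t, ht0, ht1, htS, hlt⟩ := H.exists_first hσ (H.isClosed_sides hσ) hyS hex
  refine ⟨t, ht0, ht1, htS, fun s hs hst => ⟨?_, hlt s hs hst⟩⟩
  have hsI : s ∈ Icc (0 : ℝ) 1 := ⟨hs, by linarith⟩
  refine H.mem_of_seg hσ hy fun u hu => ?_
  rw [hσ.seg_seg y a hsI hu]
  exact hlt _ (mul_nonneg hu.1 hs) (by nlinarith [hu.2])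

/-- The use made of the hypothesis on vertices: since no vertex lies inside the region, a walk from
an inner point towards any vertex must meet a side. -/
theorem first_hit_vertex {y : K.Point} (hy : y ∈ C) (hyS : y ∉ K.geod z p ∪ K.geod z q) {v : V}
    (hv : ({v} : Finset V) ∈ K.cells) :
    ∃ t, 0 < t ∧ t ≤ 1 ∧ σ y (vertexPoint v hv) t ∈ K.geod z p ∪ K.geod z q ∧
      ∀ s, 0 ≤ s → s < t → σ y (vertexPoint v hv) s ∈ C ∧
        σ y (vertexPoint v hv) s ∉ K.geod z p ∪ K.geod z q :=
  H.first_hit hσ hy hyS (H.vertex v _ (isVertexAt_vertexPoint hv))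

theorem geod_subset_of_mem {a b y x : K.Point} (hy : y ∈ K.geod a b) (hx : x ∈ K.geod a y) :
    x ∈ K.geod a b := hσ.between_of_between hy hx

/-- The region is star-shaped. -/
theorem star {x : K.Point} (hx : x ∈ C) {t : ℝ} (ht : t ∈ Icc (0 : ℝ) 1) : σ z x t ∈ C := by
  by_contra hne
  have htS : σ z x t ∉ K.geod z p ∪ K.geod z q := fun h => hne (H.sides_subset h)
  -- no side point after `t`
  have h1 : ∀ u ∈ Icc (0 : ℝ) 1, t ≤ u → σ z x u ∉ K.geod z p ∪ K.geod z q := by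
    intro u hu htu hS
    -- If `σ z x u` is on a side, so is the whole geodesic from `z` to it.
    apply htS
    have : σ z x t ∈ K.geod z (σ z x u) := by
      rcases eq_or_lt_of_le hu.1 with h0 | h0
      · have : t = u := le_antisymm htu (by rw [← h0]; exact ht.1)
        rw [this]; exact right_mem_geod _ _
      · rw [mem_geod_iff hσ]
        refine ⟨t / u, ⟨div_nonneg ht.1 hu.1, by rw [div_le_one h0]; exact htu⟩, ?_⟩
        rw [hσ.seg_seg z x hu ⟨div_nonneg ht.1 hu.1, by rw [div_le_one h0]; exact htu⟩,
          div_mul_cancel₀ _ h0.ne']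
    exact hS.imp (fun h => H.geod_subset_of_mem hσ h this) (fun h => H.geod_subset_of_mem hσ h this)
  apply hne
  refine H.mem_of_isPreconnected ((isPreconnected_Icc (a := t) (b := 1)).image _
    ((continuousOn_seg hσ z x).mono (Icc_subset_Icc ht.1 le_rfl))) hx
    ⟨1, ⟨ht.2, le_rfl⟩, hσ.one z x⟩ ⟨t, ⟨le_rfl, ht.2⟩, rfl⟩ ?_
  rintro _ ⟨u, hu, rfl⟩
  exact h1 u ⟨ht.1.trans hu.1, hu.2⟩ hu.1

end IsConeRegion

/-! ### The structure at the apex -/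

/-- Two points of a geodesic that lie in cells at its origin are in the same direction. -/
theorem geod_direction (hσ : CATMetric K.pathDist σ) {z p y₁ y₂ : K.Point} {s₁ s₂ : Finset V}
    (hs₁ : s₁ ∈ K.cells) (hs₂ : s₂ ∈ K.cells) (hz₁ : z ∈ K.cell s₁) (hz₂ : z ∈ K.cell s₂)
    (hy₁ : y₁ ∈ K.cell s₁) (hy₂ : y₂ ∈ K.cell s₂) (h₁ : y₁ ∈ K.geod z p) (h₂ : y₂ ∈ K.geod z p)
    (hne₁ : y₁ ≠ z) (hne₂ : y₂ ≠ z) : ∃ c : ℝ, 0 < c ∧ y₂.1 - z.1 = c • (y₁.1 - z.1) := by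
  wlog hle : K.pathDist z y₁ ≤ K.pathDist z y₂ generalizing y₁ y₂ s₁ s₂
  · obtain ⟨c, hc, e⟩ := this hs₂ hs₁ hz₂ hz₁ hy₂ hy₁ h₂ h₁ hne₂ hne₁ (le_of_not_ge hle)
    exact ⟨c⁻¹, inv_pos.2 hc, by rw [e, smul_smul, inv_mul_cancel₀ hc.ne', one_smul]⟩
  have hb : y₁ ∈ K.geod z y₂ := hσ.between_linear h₂ h₁ hle
  obtain ⟨t, ht, e⟩ := (mem_geod_iff hσ).1 hb
  have e' := seg_val hσ hs₂ hz₂ hy₂ ht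
  rw [← e] at e'
  have ht0 : t ≠ 0 := by
    rintro rfl
    exact hne₁ (by rw [e, hσ.zero])
  have htpos : 0 < t := lt_of_le_of_ne ht.1 (Ne.symm ht0)
  refine ⟨t⁻¹, inv_pos.2 htpos, ?_⟩
  rw [e', add_sub_cancel_left, smul_smul, inv_mul_cancel₀ ht0, one_smul]

/-- If the geodesic meets the cell only at `z`, the choice `y₀ = z` serves as a zero direction. -/
theorem exists_geod_direction (hσ : CATMetric K.pathDist σ) (z p : K.Point) {u : Finset V}
    (hu : u ∈ K.cells) (hz : z ∈ K.cell u) : ∃ y₀ ∈ K.geod z p, y₀ ∈ K.cell u ∧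
      ∀ y ∈ K.geod z p, y ∈ K.cell u → ∃ c : ℝ, 0 ≤ c ∧ y.1 - z.1 = c • (y₀.1 - z.1) := by
  by_cases h : ∃ y₀ ∈ K.geod z p, y₀ ∈ K.cell u ∧ y₀ ≠ z
  · obtain ⟨y₀, h1, h2, h3⟩ := h
    refine ⟨y₀, h1, h2, fun y hy hyu => ?_⟩
    by_cases hyz : y = z
    · exact ⟨0, le_rfl, by simp [hyz]⟩
    · obtain ⟨c, hc, e⟩ := geod_direction hσ hu hu hz hz h2 hyu h1 hy h3 hyz
      exact ⟨c, hc.le, e⟩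
  · push Not at h
    refine ⟨z, left_mem_geod z p, hz, fun y hy hyu => ⟨0, le_rfl, ?_⟩⟩
    rw [h y hy hyu]; simp

theorem mem_geod_of_direction (hσ : CATMetric K.pathDist σ) {z p y w : K.Point} {u s : Finset V}
    (hu : u ∈ K.cells) (hs : s ∈ K.cells) (hz : z ∈ K.cell u) (hy : y ∈ K.cell u)
    (hyp : y ∈ K.geod z p) (hzs : z ∈ K.cell s) (hws : w ∈ K.cell s) {c t : ℝ} (hc : 0 ≤ c)
    (ht : t ∈ Icc (0 : ℝ) 1) (htc : t * c ≤ 1) (e : w.1 - z.1 = c • (y.1 - z.1)) :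
    σ z w t ∈ K.geod z p := by
  have htcI : t * c ∈ Icc (0 : ℝ) 1 := ⟨mul_nonneg ht.1 hc, htc⟩
  have : σ z w t = σ z y (t * c) := by
    apply Subtype.ext
    rw [seg_val hσ hs hzs hws ht, seg_val hσ hu hz hy htcI, e, smul_smul]
  rw [this]
  exact hσ.between_of_between hyp (hσ.between_seg z y htcI)

namespace IsConeRegion

variable {z p q : K.Point} {C : Set K.Point} (H : K.IsConeRegion z p q C)
  (hσ : CATMetric K.pathDist σ)

include H hσ

/-- A direction at the apex that points into the region lies in a cell between the directions of
the two sides. -/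
theorem direction_between {w : K.Point} {s : Finset V} (hs : s ∈ K.cells) (hzs : z ∈ K.cell s)
    (hws : w ∈ K.cell s) (hw : w ∈ C)
    (hray : ∀ t : ℝ, 0 < t → t ≤ 1 → σ z w t ∉ K.geod z p ∪ K.geod z q) :
    ∃ u ∈ K.cells, z ∈ K.cell u ∧ ∃ ya ∈ K.geod z p, ∃ yb ∈ K.geod z q, ya ∈ K.cell u ∧
      yb ∈ K.cell u ∧ ∃ l m : ℝ, 0 < l ∧ 0 < m ∧
        w.1 - z.1 = l • (ya.1 - z.1) + m • (yb.1 - z.1) := by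
  classical
  obtain ⟨ya, hya, hyau, hA⟩ := exists_geod_direction hσ z p hs hzs
  obtain ⟨yb, hyb, hybu, hB⟩ := exists_geod_direction hσ z q hs hzs
  have hwz : w ≠ z := by
    rintro rfl
    exact hray 1 one_pos le_rfl (by rw [hσ.one]; exact Or.inl (left_mem_geod _ _))
  have hwS : w ∉ K.geod z p ∪ K.geod z q := by
    have := hray 1 one_pos le_rfl
    rwa [hσ.one] at this
  -- first hits towards the vertices of `s`
  have hit : ∀ v ∈ s, ∃ τ : ℝ, 0 < τ ∧ ∃ y ∈ K.geod z p ∪ K.geod z q, y ∈ K.cell s ∧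
      y.1 - w.1 = τ • (Pi.single v 1 - w.1) := by
    intro v hv
    have hvc := singleton_mem hs hv
    obtain ⟨t, ht0, ht1, htS, -⟩ := H.first_hit_vertex hσ hw hwS hvc
    have hvs := vertexPoint_mem_cell hvc hv
    refine ⟨t, ht0, _, htS, seg_mem_cell hσ hs hws hvs ⟨ht0.le, ht1⟩, ?_⟩
    rw [seg_val hσ hs hws hvs ⟨ht0.le, ht1⟩, add_sub_cancel_left]
    rfl
  have : Nonempty K.Point := ⟨z⟩
  choose! τ hτ y hyS hys hyτ using hit
  set D : Set (V → ℝ) := {x | ∃ l m : ℝ, 0 ≤ l ∧ 0 ≤ m ∧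
    x = l • (ya.1 - z.1) + m • (yb.1 - z.1)} with hD
  have Dadd : ∀ a ∈ D, ∀ b ∈ D, a + b ∈ D := by
    rintro _ ⟨l, m, hl, hm, rfl⟩ _ ⟨l', m', hl', hm', rfl⟩
    exact ⟨l + l', m + m', by positivity, by positivity, by module⟩
  have Dsmul : ∀ k : ℝ, 0 ≤ k → ∀ a ∈ D, k • a ∈ D := by
    rintro k hk _ ⟨l, m, hl, hm, rfl⟩
    exact ⟨k * l, k * m, by positivity, by positivity, by module⟩
  have D0 : (0 : V → ℝ) ∈ D := ⟨0, 0, le_rfl, le_rfl, by simp⟩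
  have Dy : ∀ v ∈ s, (y v).1 - z.1 ∈ D := by
    intro v hv
    rcases hyS v hv with h | h
    · obtain ⟨c, hc, e⟩ := hA _ h (hys v hv)
      exact ⟨c, 0, hc, le_rfl, by rw [e]; simp⟩
    · obtain ⟨c, hc, e⟩ := hB _ h (hys v hv)
      exact ⟨0, c, le_rfl, hc, by rw [e]; simp⟩
  have hsum1 : ∑ v ∈ s, w.1 v = 1 := by
    have := w.2.2.1
    rwa [← Finset.sum_subset (Finset.subset_univ s) (fun v _ hv => hws v hv)] at this
  have hsingle : ∑ v ∈ s, w.1 v • (Pi.single v 1 : V → ℝ) = w.1 := by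
    funext x
    rw [Finset.sum_apply]
    by_cases hx : x ∈ s
    · rw [Finset.sum_eq_single x (fun b _ hb => by simp [Ne.symm hb])
        (fun h => (h hx).elim)]
      simp
    · rw [hws x hx]
      apply Finset.sum_eq_zero
      intro v hv
      have : x ≠ v := fun h => hx (h ▸ hv)
      simp [this]
  -- `w` is the barycentre of the vertices of `s` with weights `w v`, hence a positive combination
  -- of the hit points `y v` with weights `w v / τ v`. Since the directions of the hit points lie in
  -- the cone `D`, so does that of `w`.
  have hbal : ∑ v ∈ s, (w.1 v / τ v) • ((y v).1 - w.1) = 0 := by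
    have e : ∀ v ∈ s, (w.1 v / τ v) • ((y v).1 - w.1) = w.1 v • (Pi.single v 1 : V → ℝ) - w.1 v • w.1 := by
      intro v hv
      rw [hyτ v hv, smul_smul, div_mul_cancel₀ _ (hτ v hv).ne', smul_sub]
    rw [Finset.sum_congr rfl e, Finset.sum_sub_distrib, hsingle, ← Finset.sum_smul, hsum1, one_smul,
      sub_self]
  set k := ∑ v ∈ s, w.1 v / τ v with hk
  have hkpos : 0 < k := by
    have hnn : ∀ v ∈ s, 0 ≤ w.1 v / τ v := fun v hv => div_nonneg (w.2.1 v) (hτ v hv).le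
    apply lt_of_le_of_ne (Finset.sum_nonneg hnn)
    intro h0
    have := (Finset.sum_eq_zero_iff_of_nonneg hnn).1 h0.symm
    have h1 : ∑ v ∈ s, w.1 v = 0 := Finset.sum_eq_zero fun v hv => by
      have := this v hv
      rw [div_eq_zero_iff] at this
      exact this.resolve_right (hτ v hv).ne'
    linarith
  have hwD : w.1 - z.1 ∈ D := by
    have e : k • (w.1 - z.1) = ∑ v ∈ s, (w.1 v / τ v) • ((y v).1 - z.1) := by
      have e1 : ∀ v ∈ s, (w.1 v / τ v) • ((y v).1 - z.1) =
          (w.1 v / τ v) • ((y v).1 - w.1) + (w.1 v / τ v) • (w.1 - z.1) := fun v _ => by module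
      rw [Finset.sum_congr rfl e1, Finset.sum_add_distrib, hbal, ← Finset.sum_smul, zero_add]
    have e2 : w.1 - z.1 = k⁻¹ • ∑ v ∈ s, (w.1 v / τ v) • ((y v).1 - z.1) := by
      rw [← e, smul_smul, inv_mul_cancel₀ hkpos.ne', one_smul]
    rw [e2]
    apply Dsmul _ (by positivity)
    exact Finset.sum_induction _ (· ∈ D) (fun a b ha hb => Dadd a ha b hb) D0 fun v hv =>
      Dsmul _ (div_nonneg (w.2.1 v) (hτ v hv).le) _ (Dy v hv)
  obtain ⟨l, m, hl, hm, e⟩ := hwD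
  have small : ∀ c : ℝ, 0 ≤ c → ∃ t : ℝ, 0 < t ∧ t ≤ 1 ∧ t * c ≤ 1 := fun c hc =>
    ⟨1 / (c + 1), by positivity, by rw [div_le_one (by positivity)]; linarith, by
      rw [div_mul_eq_mul_div, one_mul, div_le_one (by positivity)]; linarith⟩
  -- If a coefficient vanished, a beginning of the ray to `w` would run along a side.
  refine ⟨s, hs, hzs, ya, hya, yb, hyb, hyau, hybu, l, m, lt_of_le_of_ne hl ?_,
    lt_of_le_of_ne hm ?_, e⟩
  · rintro rfl
    obtain ⟨t, ht0, ht1, htm⟩ := small m hm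
    refine hray t ht0 ht1 (Or.inr ?_)
    exact mem_geod_of_direction hσ hs hs hzs hybu hyb hzs hws hm ⟨ht0.le, ht1⟩ htm
      (by rw [e]; simp)
  · rintro rfl
    obtain ⟨t, ht0, ht1, htm⟩ := small l hl
    refine hray t ht0 ht1 (Or.inl ?_)
    exact mem_geod_of_direction hσ hs hs hzs hyau hya hzs hws hl ⟨ht0.le, ht1⟩ htm
      (by rw [e]; simp)

end IsConeRegion

/-- The region `C` is a sector of one cell near `z`. -/
structure IsSector (K : TriangleComplex V) (z p q : K.Point) (C : Set K.Point) (u : Finset V)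
    (ya yb : K.Point) : Prop where
  cell_mem : u ∈ K.cells
  apex_mem : z ∈ K.cell u
  left_mem : ya ∈ K.cell u
  right_mem : yb ∈ K.cell u
  left_side : ya ∈ K.geod z p
  right_side : yb ∈ K.geod z q
  indep : LinearIndependent ℝ ![ya.1 - z.1, yb.1 - z.1]
  mem_region : ∀ w : K.Point, ∀ l m : ℝ, 0 ≤ l → 0 ≤ m → l + m ≤ 1 →
    w.1 - z.1 = l • (ya.1 - z.1) + m • (yb.1 - z.1) → w ∈ C
  of_near : ∃ ρ > 0, ∀ w ∈ C, K.pathDist z w < ρ → ∃ l m : ℝ, 0 ≤ l ∧ 0 ≤ m ∧ l + m ≤ 1 ∧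
    w.1 - z.1 = l • (ya.1 - z.1) + m • (yb.1 - z.1)

theorem LinearIndependent.pair_small {E : Type*} [NormedAddCommGroup E] [NormedSpace ℝ E]
    {a b : E} (h : LinearIndependent ℝ ![a, b]) : ∃ ε > 0, ∀ l m : ℝ, ‖l • a + m • b‖ < ε →
      |l| ≤ 1 / 2 ∧ |m| ≤ 1 / 2 := by
  let φ : ℝ × ℝ →ₗ[ℝ] E :=
    { toFun := fun x => x.1 • a + x.2 • b
      map_add' := fun x y => by simp only [Prod.fst_add, Prod.snd_add]; module
      map_smul' := fun c x => by
        simp only [Prod.smul_fst, Prod.smul_snd, RingHom.id_apply, smul_eq_mul]; module }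
  have hφ : LinearMap.ker φ = ⊥ := by
    rw [LinearMap.ker_eq_bot']
    rintro ⟨l, m⟩ hlm
    have := LinearIndependent.pair_iff.1 h l m hlm
    exact Prod.ext this.1 this.2
  obtain ⟨L, hL, hanti⟩ := φ.exists_antilipschitzWith hφ
  have hL' : (0 : ℝ) < L := hL
  refine ⟨1 / (2 * L), by positivity, fun l m hlm => ?_⟩
  have h1 := hanti.le_mul_dist (l, m) 0
  rw [dist_zero_right, map_zero, dist_zero_right] at h1
  have h2 : ‖(l, m)‖ ≤ 1 / 2 := by
    refine h1.trans ?_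
    have h3 : (L : ℝ) * ‖φ (l, m)‖ ≤ L * (1 / (2 * L)) := mul_le_mul_of_nonneg_left hlm.le hL'.le
    refine h3.trans (le_of_eq ?_)
    field_simp
  exact ⟨(norm_fst_le (l, m)).trans h2, (norm_snd_le (l, m)).trans h2⟩

namespace IsConeRegion

variable {z p q : K.Point} {C : Set K.Point} (H : K.IsConeRegion z p q C)
  (hσ : CATMetric K.pathDist σ)

include H hσ

/-- One direction pointing inside determines the cell `u` and the directions of both sides in it.
Any other point of `C` near `z` has a direction that is either a side direction or between the side
directions, and these are unique by `geod_direction`; so `C` has no further part near `z`. -/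
theorem exists_sector {w₀ : K.Point} {s₀ : Finset V} (hs₀ : s₀ ∈ K.cells) (hzs₀ : z ∈ K.cell s₀)
    (hws₀ : w₀ ∈ K.cell s₀) (hw₀ : w₀ ∈ C)
    (hray₀ : ∀ t : ℝ, 0 < t → t ≤ 1 → σ z w₀ t ∉ K.geod z p ∪ K.geod z q) :
    ∃ u ya yb, K.IsSector z p q C u ya yb := by
  obtain ⟨u, hu, hzu, ya, hya, yb, hyb, hyau, hybu, l₀, m₀, hl₀, hm₀, e₀⟩ :=
    H.direction_between hσ hs₀ hzs₀ hws₀ hw₀ hray₀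
  have small : ∀ c : ℝ, 0 ≤ c → ∃ t : ℝ, 0 < t ∧ t ≤ 1 ∧ t * c ≤ 1 := fun c hc =>
    ⟨1 / (c + 1), by positivity, by rw [div_le_one (by positivity)]; linarith, by
      rw [div_mul_eq_mul_div, one_mul, div_le_one (by positivity)]; linarith⟩
  -- `w₀` is not a nonnegative multiple of a side direction
  have hnot : ∀ c : ℝ, (∃ y ∈ K.geod z p ∪ K.geod z q, y ∈ K.cell u ∧
      w₀.1 - z.1 = c • (y.1 - z.1)) → c < 0 := by
    rintro c ⟨y, hy, hyu, e⟩
    by_contra hc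
    push Not at hc
    obtain ⟨t, ht0, ht1, htc⟩ := small c hc
    refine hray₀ t ht0 ht1 (hy.imp (fun h => ?_) fun h => ?_)
    · exact mem_geod_of_direction hσ hu hs₀ hzu hyu h hzs₀ hws₀ hc ⟨ht0.le, ht1⟩ htc e
    · exact mem_geod_of_direction hσ hu hs₀ hzu hyu h hzs₀ hws₀ hc ⟨ht0.le, ht1⟩ htc e
  -- The direction of `w₀` is a positive combination of the side directions but not a nonnegative
  -- multiple of either. If these were parallel, they would be opposite, and `w₀` would be a
  -- negative multiple of both, which is impossible.
  have hind : LinearIndependent ℝ ![ya.1 - z.1, yb.1 - z.1] := by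
    rw [LinearIndependent.pair_iff]
    intro a b hab
    -- if `a ≠ 0`, then `ya - z` is a multiple of `yb - z`
    have ha : a = 0 := by
      by_contra ha
      have e1 : ya.1 - z.1 = (-b / a) • (yb.1 - z.1) := by
        have : a • (ya.1 - z.1) = (-b) • (yb.1 - z.1) := by
          rw [neg_smul]; exact eq_neg_of_add_eq_zero_left hab
        rw [div_eq_inv_mul, mul_smul, ← this, smul_smul, inv_mul_cancel₀ ha, one_smul]
      have e2 : w₀.1 - z.1 = (l₀ * (-b / a) + m₀) • (yb.1 - z.1) := by
        rw [e₀, e1]; module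
      have h1 := hnot _ ⟨yb, Or.inr hyb, hybu, e2⟩
      have h2 : -b / a < 0 := by
        by_contra h; push Not at h
        have := mul_nonneg hl₀.le h
        linarith
      have h3 : b ≠ 0 := by rintro rfl; simp at h2
      have e3 : yb.1 - z.1 = (-b / a)⁻¹ • (ya.1 - z.1) := by
        rw [e1, smul_smul, inv_mul_cancel₀ h2.ne, one_smul]
      have e4 : w₀.1 - z.1 = (l₀ + m₀ * (-b / a)⁻¹) • (ya.1 - z.1) := by
        rw [e₀, e3]; module
      have h4 := hnot _ ⟨ya, Or.inl hya, hyau, e4⟩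
      have h5 : (-b / a) * (l₀ + m₀ * (-b / a)⁻¹) = l₀ * (-b / a) + m₀ := by
        rw [mul_add, mul_comm m₀, ← mul_assoc, mul_inv_cancel₀ h2.ne, one_mul, mul_comm]
      have h6 := mul_pos_of_neg_of_neg h2 h4
      linarith
    subst ha
    refine ⟨rfl, ?_⟩
    by_contra hb
    rw [zero_smul, zero_add, smul_eq_zero] at hab
    have e1 := hab.resolve_left hb
    have := hnot l₀ ⟨ya, Or.inl hya, hyau, by rw [e₀, e1]; simp⟩
    linarith
  have hpair := LinearIndependent.pair_iff.1 hind
  have hyaz : ya ≠ z := by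
    rintro rfl
    have := hpair 1 0 (by simp)
    exact one_ne_zero this.1
  have hybz : yb ≠ z := by
    rintro rfl
    have := hpair 0 1 (by simp)
    exact one_ne_zero this.2
  have hcoef : ∀ a b a' b' : ℝ, a • (ya.1 - z.1) + b • (yb.1 - z.1) =
      a' • (ya.1 - z.1) + b' • (yb.1 - z.1) → a = a' ∧ b = b' := by
    intro a b a' b' e
    have := hpair (a - a') (b - b') (by rw [sub_smul, sub_smul, ← sub_eq_zero.2 e]; abel)
    exact ⟨sub_eq_zero.1 this.1, sub_eq_zero.1 this.2⟩
  -- points inside the sector are not on the sides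
  have hinside : ∀ w : K.Point, w ∈ K.cell u → ∀ l m : ℝ, 0 < l → 0 < m →
      w.1 - z.1 = l • (ya.1 - z.1) + m • (yb.1 - z.1) → w ∉ K.geod z p ∪ K.geod z q := by
    intro w hwu l m hl hm e hw
    have hwz : w ≠ z := by
      rintro rfl
      have := (hpair l m (by rw [← e, sub_self])).1
      linarith
    rcases hw with hw | hw
    · obtain ⟨c, hc, e'⟩ := geod_direction hσ hu hu hzu hzu hyau hwu hya hw hyaz hwz
      have := (hcoef l m c 0 (by rw [← e, e']; simp)).2
      linarith
    · obtain ⟨c, hc, e'⟩ := geod_direction hσ hu hu hzu hzu hybu hwu hyb hw hybz hwz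
      have := (hcoef l m 0 c (by rw [← e, e']; simp)).1
      linarith
  have hcellu : ∀ w : K.Point, ∀ l m : ℝ, w.1 - z.1 = l • (ya.1 - z.1) + m • (yb.1 - z.1) →
      w ∈ K.cell u := by
    intro w l m e v hv
    have := congrFun e v
    simp only [Pi.sub_apply, Pi.add_apply, Pi.smul_apply, hzu v hv, hyau v hv, hybu v hv,
      sub_zero, smul_zero, add_zero] at this
    exact this
  -- a point of the region inside the sector
  obtain ⟨t, ht0, ht1, htc⟩ := small (l₀ + m₀) (by positivity)
  have htI : t ∈ Icc (0 : ℝ) 1 := ⟨ht0.le, ht1⟩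
  have ew : (σ z w₀ t).1 - z.1 = (t * l₀) • (ya.1 - z.1) + (t * m₀) • (yb.1 - z.1) := by
    rw [seg_val hσ hs₀ hzs₀ hws₀ htI, add_sub_cancel_left, e₀]; module
  have hwC : σ z w₀ t ∈ C := H.star hσ hw₀ htI
  have hwu := hcellu _ _ _ ew
  refine ⟨u, ya, yb, hu, hzu, hyau, hybu, hya, hyb, hind, ?_, ?_⟩
  · intro w l m hl hm hlm e
    have hwu' := hcellu w l m e
    rcases eq_or_lt_of_le hl with rfl | hl
    · have hmI : (1 : ℝ) * m ≤ 1 := by linarith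
      have := mem_geod_of_direction hσ hu hu hzu hybu hyb hzu hwu' hm (t := 1) (by simp) hmI
        (by rw [e]; simp)
      rw [hσ.one] at this
      exact H.sides_subset (Or.inr this)
    rcases eq_or_lt_of_le hm with rfl | hm
    · have hmI : (1 : ℝ) * l ≤ 1 := by linarith
      have := mem_geod_of_direction hσ hu hu hzu hyau hya hzu hwu' hl.le (t := 1) (by simp) hmI
        (by rw [e]; simp)
      rw [hσ.one] at this
      exact H.sides_subset (Or.inl this)
    -- The segment from a known inner point keeps both coefficients positive, so it avoids the
    -- sides.
    refine H.mem_of_seg hσ hwC fun s hs => ?_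
    refine hinside _ (seg_mem_cell hσ hu hwu hwu' hs) ((1 - s) * (t * l₀) + s * l)
      ((1 - s) * (t * m₀) + s * m) ?_ ?_ ?_
    · rcases eq_or_lt_of_le hs.1 with rfl | h
      · simp; positivity
      · have := mul_nonneg (sub_nonneg.2 hs.2) (mul_pos ht0 hl₀).le
        have := mul_pos h hl
        linarith
    · rcases eq_or_lt_of_le hs.1 with rfl | h
      · simp; positivity
      · have := mul_nonneg (sub_nonneg.2 hs.2) (mul_pos ht0 hm₀).le
        have := mul_pos h hm
        linarith
    · rw [seg_val hσ hu hwu hwu' hs]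
      have e5 : w.1 = z.1 + (l • (ya.1 - z.1) + m • (yb.1 - z.1)) := by rw [← e]; abel
      have e6 : (σ z w₀ t).1 = z.1 + ((t * l₀) • (ya.1 - z.1) + (t * m₀) • (yb.1 - z.1)) := by
        rw [← ew]; abel
      rw [e5, e6]; module
  · obtain ⟨ε, hε, hsmall⟩ := LinearIndependent.pair_small hind
    have hU : {w : K.Point | (∃ s ∈ K.cells, z ∈ K.cell s ∧ w ∈ K.cell s) ∧ dist w.1 z.1 < ε} ∈ 𝓝 z := by
      filter_upwards [eventually_common_cell z, Metric.ball_mem_nhds z hε] with w h1 h2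
      exact ⟨h1, h2⟩
    obtain ⟨ρ, hρ, hball⟩ := exists_ball_subset hσ hU
    refine ⟨ρ, hρ, fun w hw hwρ => ?_⟩
    obtain ⟨⟨s, hs, hzs, hws⟩, hdist⟩ := hball w hwρ
    suffices ∃ l m : ℝ, 0 ≤ l ∧ 0 ≤ m ∧ w.1 - z.1 = l • (ya.1 - z.1) + m • (yb.1 - z.1) by
      obtain ⟨l, m, hl, hm, e⟩ := this
      rw [dist_eq_norm, e] at hdist
      have := hsmall l m hdist
      rw [abs_of_nonneg hl, abs_of_nonneg hm] at this
      exact ⟨l, m, hl, hm, by linarith, e⟩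
    by_cases hwz : w = z
    · exact ⟨0, 0, le_rfl, le_rfl, by simp [hwz]⟩
    by_cases hr : ∃ t : ℝ, 0 < t ∧ t ≤ 1 ∧ σ z w t ∈ K.geod z p ∪ K.geod z q
    · obtain ⟨t, ht0, ht1, htS⟩ := hr
      have htI : t ∈ Icc (0 : ℝ) 1 := ⟨ht0.le, ht1⟩
      have hts := seg_mem_cell hσ hs hzs hws htI
      have htv := seg_val hσ hs hzs hws htI
      have htz : σ z w t ≠ z := by
        intro h
        have h2 := hσ.dist_left z w htI
        rw [h, hσ.self] at h2
        have := mul_pos ht0 (hσ.pos (Ne.symm hwz))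
        linarith
      have e3 : w.1 - z.1 = t⁻¹ • ((σ z w t).1 - z.1) := by
        rw [htv, add_sub_cancel_left, smul_smul, inv_mul_cancel₀ ht0.ne', one_smul]
      rcases htS with h | h
      · obtain ⟨c, hc, e⟩ := geod_direction hσ hu hs hzu hzs hyau hts hya h hyaz htz
        exact ⟨t⁻¹ * c, 0, by positivity, le_rfl, by rw [e3, e]; module⟩
      · obtain ⟨c, hc, e⟩ := geod_direction hσ hu hs hzu hzs hybu hts hyb h hybz htz
        exact ⟨0, t⁻¹ * c, le_rfl, by positivity, by rw [e3, e]; module⟩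
    · push Not at hr
      obtain ⟨u', hu', hzu', ya', hya', yb', hyb', hyau', hybu', l, m, hl, hm, e⟩ :=
        H.direction_between hσ hs hzs hws hw hr
      have ha : ∃ c : ℝ, 0 ≤ c ∧ ya'.1 - z.1 = c • (ya.1 - z.1) := by
        by_cases h : ya' = z
        · exact ⟨0, le_rfl, by simp [h]⟩
        · obtain ⟨c, hc, e⟩ := geod_direction hσ hu hu' hzu hzu' hyau hyau' hya hya' hyaz h
          exact ⟨c, hc.le, e⟩
      have hb : ∃ c : ℝ, 0 ≤ c ∧ yb'.1 - z.1 = c • (yb.1 - z.1) := by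
        by_cases h : yb' = z
        · exact ⟨0, le_rfl, by simp [h]⟩
        · obtain ⟨c, hc, e⟩ := geod_direction hσ hu hu' hzu hzu' hybu hybu' hyb hyb' hybz h
          exact ⟨c, hc.le, e⟩
      obtain ⟨c, hc, ec⟩ := ha
      obtain ⟨c', hc', ec'⟩ := hb
      exact ⟨l * c, m * c', by positivity, by positivity, by rw [e, ec, ec']; module⟩

end IsConeRegion

end TriangleComplex

/-! ### Paths across a fan -/

/-- `w` and `w'` are joined in `C` by points that divide the length `D` in every ratio. -/
def FineJoined {X : Type*} (d : X → X → ℝ) (C : Set X) (w w' : X) (D : ℝ) : Prop :=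
  ∀ s ∈ Icc (0 : ℝ) D, ∃ y ∈ C, d w y ≤ s ∧ d y w' ≤ D - s

namespace FineJoined

variable {X : Type*} {d : X → X → ℝ} {σ : X → X → ℝ → X} {C : Set X} {a b c : X} {D E : ℝ}

theorem symm (hσ : CATMetric d σ) (h : FineJoined d C a b D) : FineJoined d C b a D := by
  intro s hs
  obtain ⟨y, hy, h1, h2⟩ := h (D - s) ⟨by linarith [hs.2], by linarith [hs.1]⟩
  exact ⟨y, hy, by rw [hσ.comm]; linarith, by rwa [hσ.comm]⟩

theorem dist_le (hσ : CATMetric d σ) (h : FineJoined d C a b D) (hD : 0 ≤ D) : d a b ≤ D := by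
  obtain ⟨y, -, h1, h2⟩ := h 0 ⟨le_rfl, hD⟩
  linarith [hσ.tri a y b]

theorem trans (hσ : CATMetric d σ) (h : FineJoined d C a b D) (h' : FineJoined d C b c E) (hD : 0 ≤ D)
    (hE : 0 ≤ E) : FineJoined d C a c (D + E) := by
  intro s hs
  rcases le_or_gt s D with h1 | h1
  · obtain ⟨y, hy, h2, h3⟩ := h s ⟨hs.1, h1⟩
    exact ⟨y, hy, h2, by linarith [hσ.tri y b c, h'.dist_le hσ hE]⟩
  · obtain ⟨y, hy, h2, h3⟩ := h' (s - D) ⟨by linarith, by linarith [hs.2]⟩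
    exact ⟨y, hy, by linarith [hσ.tri a b y, h.dist_le hσ hD], by linarith⟩

/-- When the length is the distance, the dividing points are those of the geodesic by uniqueness.
This is how geodesics are shown to stay in `C`. -/
theorem seg_mem (hσ : CATMetric d σ) (h : FineJoined d C a b (d a b)) {t : ℝ}
    (ht : t ∈ Icc (0 : ℝ) 1) : σ a b t ∈ C := by
  have hn := hσ.nonneg a b
  obtain ⟨y, hy, h1, h2⟩ := h (t * d a b) ⟨mul_nonneg ht.1 hn, by nlinarith [ht.2]⟩
  rwa [← hσ.eq_seg ht h1 (by linarith)]

end FineJoined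

namespace Complex

/-- The determinant of two vectors of the plane. -/
def cross (a b : ℂ) : ℝ := a.re * b.im - a.im * b.re

/-- The segment from `X` to `X'` crosses the ray of `Z` at a ratio computed from determinants, and
the norm is convex along it. If `X` and `Z` are parallel, `h0` excludes opposite directions and `X`
itself is the crossing point. -/
theorem exists_crossing {X X' Z : ℂ} (h1 : 0 ≤ cross X Z) (h2 : 0 ≤ cross Z X')
    (h3 : 0 ≤ cross X X') (h0 : cross X Z = 0 → ∃ k : ℝ, 0 ≤ k ∧ X = k • Z) :
    ∃ k : ℝ, 0 ≤ k ∧ ‖X - k • Z‖ + ‖k • Z - X'‖ = ‖X - X'‖ ∧ ‖k • Z‖ ≤ max ‖X‖ ‖X'‖ := by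
  rcases eq_or_lt_of_le h1 with h | h
  · obtain ⟨k, hk, e⟩ := h0 h.symm
    exact ⟨k, hk, by rw [← e]; simp, by rw [← e]; exact le_max_left _ _⟩
  set N := cross X Z + cross Z X' with hN
  have hN0 : 0 < N := by linarith
  set τ := cross X Z / N with hτ
  have hτ0 : 0 ≤ τ := by positivity
  have hτ1 : τ ≤ 1 := by rw [hτ, div_le_one hN0]; linarith
  have e : (cross X X' / N) • Z = X + τ • (X' - X) := by
    have h4 : N • ((cross X X' / N) • Z) = N • (X + τ • (X' - X)) := by
      rw [smul_smul, mul_div_cancel₀ _ hN0.ne', smul_add, smul_smul, hτ, mul_div_cancel₀ _ hN0.ne', hN]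
      apply Complex.ext
      · simp only [cross, Complex.real_smul, Complex.add_re, Complex.mul_re, Complex.sub_re,
          Complex.ofReal_re, Complex.ofReal_im, Complex.sub_im]
        ring
      · simp only [cross, Complex.real_smul, Complex.add_im, Complex.mul_im, Complex.sub_re,
          Complex.ofReal_re, Complex.ofReal_im, Complex.sub_im]
        ring
    exact smul_right_injective ℂ hN0.ne' h4
  refine ⟨cross X X' / N, by positivity, ?_, ?_⟩
  · rw [e, show X - (X + τ • (X' - X)) = τ • (X - X') by module,
      show X + τ • (X' - X) - X' = (1 - τ) • (X - X') by module, norm_smul, norm_smul,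
      Real.norm_eq_abs, Real.norm_eq_abs, abs_of_nonneg hτ0, abs_of_nonneg (by linarith)]
    ring
  · rw [e, show X + τ • (X' - X) = (1 - τ) • X + τ • X' by module]
    refine (norm_add_le _ _).trans ?_
    rw [norm_smul, norm_smul, Real.norm_eq_abs, Real.norm_eq_abs, abs_of_nonneg hτ0,
      abs_of_nonneg (by linarith)]
    have := mul_le_mul_of_nonneg_left (le_max_left ‖X‖ ‖X'‖) (sub_nonneg.2 hτ1)
    have := mul_le_mul_of_nonneg_left (le_max_right ‖X‖ ‖X'‖) hτ0
    linarith

/-- The three lengths determine the inner products of the two vectors. -/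
theorem norm_combination {A B A' B' : ℂ} (h1 : ‖A‖ = ‖A'‖) (h2 : ‖B‖ = ‖B'‖)
    (h3 : ‖A - B‖ = ‖A' - B'‖) (l m : ℝ) : ‖l • A + m • B‖ = ‖l • A' + m • B'‖ := by
  have h4 : ‖A‖ ^ 2 = ‖A'‖ ^ 2 := by rw [h1]
  have h5 : ‖B‖ ^ 2 = ‖B'‖ ^ 2 := by rw [h2]
  have h6 : ‖A - B‖ ^ 2 = ‖A' - B'‖ ^ 2 := by rw [h3]
  rw [← sq_eq_sq₀ (norm_nonneg _) (norm_nonneg _)]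
  simp only [Complex.sq_norm, Complex.normSq_apply, Complex.real_smul, Complex.add_re,
    Complex.add_im, Complex.sub_re, Complex.sub_im, Complex.re_ofReal_mul,
    Complex.im_ofReal_mul] at *
  linear_combination (l ^ 2 + l * m) * h4 + (m ^ 2 + l * m) * h5 - l * m * h6

end Complex

theorem cos_triangleAngle {A B : ℂ} (hA : A ≠ 0) (hB : B ≠ 0) :
    ‖A - B‖ ^ 2 = ‖A‖ ^ 2 + ‖B‖ ^ 2 -
      2 * ‖A‖ * ‖B‖ * Real.cos (triangleAngle ‖A‖ ‖B‖ ‖A - B‖) := by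
  have hA' := norm_pos_iff.2 hA
  have hB' := norm_pos_iff.2 hB
  have h1 := norm_sub_le A B
  have h2 := abs_norm_sub_norm_le A B
  have h3 : (‖A‖ - ‖B‖) ^ 2 ≤ ‖A - B‖ ^ 2 := sq_le_sq' (by linarith [neg_abs_le (‖A‖ - ‖B‖)])
    ((le_abs_self _).trans h2)
  have h4 : ‖A - B‖ ^ 2 ≤ (‖A‖ + ‖B‖) ^ 2 := pow_le_pow_left₀ (norm_nonneg _) h1 2
  rw [triangleAngle, Real.cos_arccos]
  · field_simp; ring
  · rw [le_div_iff₀ (by positivity)]; linarith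
  · rw [div_le_one (by positivity)]; linarith

/-! ### Unrolling a fan in the plane -/

namespace TriangleComplex

variable {V : Type*} [Fintype V] {K : TriangleComplex V} {σ : K.Point → K.Point → ℝ → K.Point}

theorem mem_smallTriangle {v a b w : K.Point} : w ∈ K.smallTriangle v a b ↔
    ∃ l m : ℝ, 0 ≤ l ∧ 0 ≤ m ∧ l + m ≤ 1 ∧
      w.1 = v.1 + (l • (a.1 - v.1) + m • (b.1 - v.1)) := by
  rw [smallTriangle, Set.mem_ofPred_eq, convexHull_insert (by simp), convexHull_pair]
  simp only [mem_convexJoin, mem_singleton_iff, exists_eq_left]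
  constructor
  · rintro ⟨x, hx, hw⟩
    rw [segment_eq_image'] at hx hw
    obtain ⟨s, hs, rfl⟩ := hx
    obtain ⟨t, ht, e⟩ := hw
    refine ⟨t * (1 - s), t * s, mul_nonneg ht.1 (by linarith [hs.2]), mul_nonneg ht.1 hs.1,
      by linarith [ht.2], ?_⟩
    rw [← e]
    module
  · rintro ⟨l, m, hl, hm, hlm, e⟩
    have hs : m / (l + m) ∈ Icc (0 : ℝ) 1 := ⟨by positivity, div_le_one_of_le₀ (by linarith)
      (by positivity)⟩
    refine ⟨a.1 + (m / (l + m)) • (b.1 - a.1), ?_, ?_⟩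
    · rw [segment_eq_image']; exact ⟨_, hs, rfl⟩
    · rw [segment_eq_image']
      refine ⟨l + m, ⟨by positivity, hlm⟩, ?_⟩
      have e1 : (l + m) * (m / (l + m)) = m := by
        rcases eq_or_ne (l + m) 0 with h | h
        · have : m = 0 := by linarith
          simp [this]
        · exact mul_div_cancel₀ _ h
      rw [e]
      have : (l + m) • (a.1 + (m / (l + m)) • (b.1 - a.1) - v.1) =
        (l + m) • (a.1 - v.1) + ((l + m) * (m / (l + m))) • (b.1 - a.1) := by module
      simp only
      rw [this, e1]
      module

theorem exists_mem_smallTriangle (hσ : CATMetric K.pathDist σ) {v a b : K.Point} {s : Finset V}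
    (hs : s ∈ K.cells) (hv : v ∈ K.cell s) (ha : a ∈ K.cell s) (hb : b ∈ K.cell s) {l m : ℝ}
    (hl : 0 ≤ l) (hm : 0 ≤ m) (hlm : l + m ≤ 1) :
    ∃ w : K.Point, w ∈ K.cell s ∧ w.1 = v.1 + (l • (a.1 - v.1) + m • (b.1 - v.1)) := by
  have ht : m / (l + m) ∈ Icc (0 : ℝ) 1 := ⟨by positivity, div_le_one_of_le₀ (by linarith)
      (by positivity)⟩
  have hlmI : l + m ∈ Icc (0 : ℝ) 1 := ⟨by positivity, hlm⟩
  have hab := seg_mem_cell hσ hs ha hb ht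
  refine ⟨_, seg_mem_cell hσ hs hv hab hlmI, ?_⟩
  rw [seg_val hσ hs hv hab hlmI, seg_val hσ hs ha hb ht]
  have e1 : (l + m) * (m / (l + m)) = m := by
    rcases eq_or_ne (l + m) 0 with h | h
    · have : m = 0 := by linarith
      simp [this]
    · exact mul_div_cancel₀ _ h
  have : (l + m) • (a.1 + (m / (l + m)) • (b.1 - a.1) - v.1) =
    (l + m) • (a.1 - v.1) + ((l + m) * (m / (l + m))) • (b.1 - a.1) := by module
  rw [this, e1]
  module

/-- The sum of the first `i` angles of a fan. -/
def fanArg (v : K.Point) (c : ℕ → K.Point) (i : ℕ) : ℝ :=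
  ∑ k ∈ Finset.range i, triangleAngle (K.cellDist v (c k)) (K.cellDist v (c (k + 1)))
    (K.cellDist (c k) (c (k + 1)))

/-- The points of a fan that is unrolled in the plane. -/
def fanImage (v : K.Point) (c : ℕ → K.Point) (i : ℕ) : ℂ :=
  (K.cellDist v (c i) : ℂ) * Complex.exp (fanArg v c i * Complex.I)

theorem fanImage_re (v : K.Point) (c : ℕ → K.Point) (i : ℕ) :
    (fanImage v c i).re = K.cellDist v (c i) * Real.cos (fanArg v c i) := by
  rw [fanImage, Complex.re_ofReal_mul, Complex.exp_ofReal_mul_I_re]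

theorem fanImage_im (v : K.Point) (c : ℕ → K.Point) (i : ℕ) :
    (fanImage v c i).im = K.cellDist v (c i) * Real.sin (fanArg v c i) := by
  rw [fanImage, Complex.im_ofReal_mul, Complex.exp_ofReal_mul_I_im]

theorem norm_fanImage (v : K.Point) (c : ℕ → K.Point) (i : ℕ) :
    ‖fanImage v c i‖ = K.cellDist v (c i) := by
  rw [fanImage, norm_mul, Complex.norm_exp_ofReal_mul_I, mul_one, Complex.norm_real,
    Real.norm_eq_abs, abs_of_nonneg (cellDist_nonneg _ _)]

theorem cross_fanImage (v : K.Point) (c : ℕ → K.Point) (i j : ℕ) :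
    Complex.cross (fanImage v c i) (fanImage v c j) =
      K.cellDist v (c i) * K.cellDist v (c j) * Real.sin (fanArg v c j - fanArg v c i) := by
  rw [Complex.cross, fanImage_re, fanImage_re, fanImage_im, fanImage_im, Real.sin_sub]
  ring

theorem dist_fanImage_sq (v : K.Point) (c : ℕ → K.Point) (i j : ℕ) :
    ‖fanImage v c i - fanImage v c j‖ ^ 2 = K.cellDist v (c i) ^ 2 + K.cellDist v (c j) ^ 2 -
      2 * K.cellDist v (c i) * K.cellDist v (c j) * Real.cos (fanArg v c j - fanArg v c i) := by
  rw [Complex.sq_norm, Complex.normSq_apply, Complex.sub_re, Complex.sub_im, fanImage_re,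
    fanImage_re, fanImage_im, fanImage_im, Real.cos_sub]
  linear_combination K.cellDist v (c i) ^ 2 * Real.sin_sq_add_cos_sq (fanArg v c i) +
    K.cellDist v (c j) ^ 2 * Real.sin_sq_add_cos_sq (fanArg v c j)

theorem triangleAngle_nonneg (a b c : ℝ) : 0 ≤ triangleAngle a b c := Real.arccos_nonneg _

theorem fanArg_mono (v : K.Point) (c : ℕ → K.Point) : Monotone (fanArg v c) :=
  monotone_nat_of_le_succ fun i => by
    rw [fanArg, fanArg, Finset.sum_range_succ]
    exact le_add_of_nonneg_right (triangleAngle_nonneg _ _ _)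

theorem fanArg_zero (v : K.Point) (c : ℕ → K.Point) : fanArg v c 0 = 0 := by simp [fanArg]

theorem fanArg_succ_sub (v : K.Point) (c : ℕ → K.Point) (i : ℕ) :
    fanArg v c (i + 1) - fanArg v c i = triangleAngle (K.cellDist v (c i))
      (K.cellDist v (c (i + 1))) (K.cellDist (c i) (c (i + 1))) := by
  rw [fanArg, fanArg, Finset.sum_range_succ, add_sub_cancel_left]

/-- `w` lies in the `i`-th triangle of a fan, and `X` is its image in the plane. -/
def FanAt (v : K.Point) (c : ℕ → K.Point) (i : ℕ) (w : K.Point) (X : ℂ) : Prop :=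
  ∃ l m : ℝ, 0 ≤ l ∧ 0 ≤ m ∧ l + m ≤ 1 ∧
    w.1 = v.1 + (l • ((c i).1 - v.1) + m • ((c (i + 1)).1 - v.1)) ∧
    X = l • fanImage v c i + m • fanImage v c (i + 1)

namespace IsFan

variable {C : Set K.Point} {v : K.Point} {n : ℕ} {c : ℕ → K.Point}

section

variable (hσ : CATMetric K.pathDist σ) (hF : K.IsFan C v n c)

include hσ hF

theorem cellDist_pos {i : ℕ} (hi : i ≤ n) (hn : 0 < n) : 0 < K.cellDist v (c i) := by
  obtain ⟨s, hs, hv, h1, h2⟩ := (hF.2.1 (min i (n - 1)) (by omega)).1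
  have : c i ∈ K.cell s := by
    rcases Nat.lt_or_ge i n with h | h
    · rwa [Nat.min_eq_left (by omega)] at h1
    · rwa [Nat.min_eq_right (by omega), show n - 1 + 1 = i by omega] at h2
  rw [← pathDist_eq_cellDist hσ hs hv this]
  exact hσ.pos (hF.1 i hi).symm

theorem norm_fanImage_sub {i : ℕ} (hi : i < n) :
    ‖fanImage v c i - fanImage v c (i + 1)‖ = K.cellDist (c i) (c (i + 1)) := by
  obtain ⟨s, hs, hv, h1, h2⟩ := (hF.2.1 i hi).1
  obtain ⟨Z, hZ, -⟩ := K.exists_chart hs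
  have p1 := hF.cellDist_pos hσ hi.le (by omega)
  have p2 := hF.cellDist_pos hσ (show i + 1 ≤ n from hi) (by omega)
  rw [← sq_eq_sq₀ (norm_nonneg _) (cellDist_nonneg _ _), dist_fanImage_sq, fanArg_succ_sub]
  rw [hZ.cellDist_eq hv h1] at p1 ⊢
  rw [hZ.cellDist_eq hv h2] at p2 ⊢
  rw [hZ.cellDist_eq h1 h2]
  have := cos_triangleAngle (norm_pos_iff.1 p1) (norm_pos_iff.1 p2)
  rw [show ∀ a b c : ℂ, a - b - (a - c) = c - b from fun a b c => by ring, norm_sub_rev] at this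
  exact this.symm

theorem norm_eq {i : ℕ} (hi : i < n) {s : Finset V} (hs : s ∈ K.cells) (hv : v ∈ K.cell s)
    (h1 : c i ∈ K.cell s) (h2 : c (i + 1) ∈ K.cell s) {w w' : K.Point} (hw : w ∈ K.cell s)
    (hw' : w' ∈ K.cell s) {l m : ℝ}
    (e : w.1 - w'.1 = l • ((c i).1 - v.1) + m • ((c (i + 1)).1 - v.1)) :
    K.pathDist w w' = ‖l • fanImage v c i + m • fanImage v c (i + 1)‖ := by
  obtain ⟨Z, hZ, -⟩ := K.exists_chart hs
  rw [pathDist_eq_cellDist hσ hs hw hw', hZ.cellDist_eq hw hw', ← develop_sub, e, develop_add,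
    develop_smul, develop_smul, ← Complex.real_smul, ← Complex.real_smul]
  apply Complex.norm_combination
  · rw [norm_fanImage, cellDist_symm, hZ.cellDist_eq h1 hv, develop_sub]
  · rw [norm_fanImage, cellDist_symm, hZ.cellDist_eq h2 hv, develop_sub]
  · rw [hF.norm_fanImage_sub hσ hi, hZ.cellDist_eq h1 h2, develop_sub, develop_sub]
    congr 1
    ring

end

theorem fanAt_mem_cell {i : ℕ} {s : Finset V} (hv : v ∈ K.cell s)
    (h1 : c i ∈ K.cell s) (h2 : c (i + 1) ∈ K.cell s) {w : K.Point} {X : ℂ} (h : FanAt v c i w X) :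
    w ∈ K.cell s := by
  obtain ⟨l, m, -, -, -, e, -⟩ := h
  intro x hx
  rw [e]
  simp [hv x hx, h1 x hx, h2 x hx]

theorem fanAt_mem (hF : K.IsFan C v n c) {i : ℕ} (hi : i < n) {w : K.Point} {X : ℂ}
    (h : FanAt v c i w X) : w ∈ C := by
  obtain ⟨l, m, hl, hm, hlm, e, -⟩ := h
  exact (hF.2.1 i hi).2.2 (mem_smallTriangle.2 ⟨l, m, hl, hm, hlm, e⟩)

section

variable (hσ : CATMetric K.pathDist σ) (hF : K.IsFan C v n c)

include hσ hF

theorem fanAt_dist {i : ℕ} (hi : i < n) {w w' : K.Point} {X X' : ℂ} (h : FanAt v c i w X)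
    (h' : FanAt v c i w' X') : K.pathDist w w' = ‖X - X'‖ := by
  obtain ⟨s, hs, hv, h1, h2⟩ := (hF.2.1 i hi).1
  have hw := fanAt_mem_cell hv h1 h2 h
  have hw' := fanAt_mem_cell hv h1 h2 h'
  obtain ⟨l, m, hl, hm, hlm, e, rfl⟩ := h
  obtain ⟨l', m', hl', hm', hlm', e', rfl⟩ := h'
  rw [hF.norm_eq hσ hi hs hv h1 h2 hw hw' (l := l - l') (m := m - m') (by rw [e, e']; module)]
  congr 1
  module

theorem fanAt_norm {i : ℕ} (hi : i < n) {w : K.Point} {X : ℂ} (h : FanAt v c i w X) :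
    K.pathDist v w = ‖X‖ := by
  rw [hF.fanAt_dist hσ hi (w := v) (X := 0) ⟨0, 0, le_rfl, le_rfl, by simp, by simp, by simp⟩ h,
    zero_sub, norm_neg]

theorem fanAt_seg {i : ℕ} (hi : i < n) {w w' : K.Point} {X X' : ℂ} (h : FanAt v c i w X)
    (h' : FanAt v c i w' X') {t : ℝ} (ht : t ∈ Icc (0 : ℝ) 1) :
    FanAt v c i (σ w w' t) (X + t • (X' - X)) := by
  obtain ⟨s, hs, hv, h1, h2⟩ := (hF.2.1 i hi).1
  have hw := fanAt_mem_cell hv h1 h2 h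
  have hw' := fanAt_mem_cell hv h1 h2 h'
  obtain ⟨l, m, hl, hm, hlm, e, rfl⟩ := h
  obtain ⟨l', m', hl', hm', hlm', e', rfl⟩ := h'
  have t0 := ht.1
  have t1 : 0 ≤ 1 - t := by linarith [ht.2]
  refine ⟨(1 - t) * l + t * l', (1 - t) * m + t * m', by positivity, by positivity, ?_, ?_, ?_⟩
  · nlinarith
  · rw [seg_val hσ hs hw hw' ht, e, e']; module
  · module

theorem fanAt_scale {i : ℕ} (hi : i < n) {w : K.Point} {X : ℂ} (h : FanAt v c i w X) {t : ℝ}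
    (ht : t ∈ Icc (0 : ℝ) 1) : FanAt v c i (σ v w t) (t • X) := by
  have := hF.fanAt_seg hσ hi (w := v) (X := 0)
    ⟨0, 0, le_rfl, le_rfl, by simp, by simp, by simp⟩ h ht
  simpa using this

theorem fanAt_joined_same {i : ℕ} (hi : i < n) {w w' : K.Point} {X X' : ℂ}
    (h : FanAt v c i w X) (h' : FanAt v c i w' X') :
    FineJoined K.pathDist C w w' ‖X - X'‖ := by
  intro s hs
  have hD := hF.fanAt_dist hσ hi h h'
  rw [← hD] at hs ⊢
  have ht : s / K.pathDist w w' ∈ Icc (0 : ℝ) 1 :=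
    ⟨div_nonneg hs.1 (hσ.nonneg _ _), div_le_one_of_le₀ hs.2 (hσ.nonneg _ _)⟩
  have e : s / K.pathDist w w' * K.pathDist w w' = s := by
    rcases eq_or_ne (K.pathDist w w') 0 with h0 | h0
    · rw [h0] at hs ⊢
      rw [mul_zero]; exact le_antisymm hs.1 hs.2
    · exact div_mul_cancel₀ _ h0
  refine ⟨_, hF.fanAt_mem hi (hF.fanAt_seg hσ hi h h' ht), ?_, ?_⟩
  · rw [hσ.dist_left _ _ ht, e]
  · rw [hσ.dist_right _ _ ht, sub_mul, one_mul, e]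

variable (hπ : fanArg v c n ≤ Real.pi)

include hπ

/-- Since the total angle is at most `π`, the unrolled spokes are in counterclockwise order inside a
half plane. -/
theorem cross_nonneg {i j : ℕ} (hij : i ≤ j) (hj : j ≤ n) :
    0 ≤ Complex.cross (fanImage v c i) (fanImage v c j) := by
  rw [cross_fanImage]
  refine mul_nonneg (mul_nonneg (cellDist_nonneg _ _) (cellDist_nonneg _ _)) ?_
  apply Real.sin_nonneg_of_nonneg_of_le_pi
  · exact sub_nonneg.2 (fanArg_mono v c hij)
  · have h0 := fanArg_mono v c (Nat.zero_le i)
    rw [fanArg_zero] at h0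
    linarith [fanArg_mono v c hj]

theorem parallel_of_cross {i : ℕ} (hi : i < n)
    (h : Complex.cross (fanImage v c i) (fanImage v c (i + 1)) = 0) :
    ∃ k : ℝ, 0 ≤ k ∧ fanImage v c i = k • fanImage v c (i + 1) := by
  have p1 := hF.cellDist_pos hσ hi.le (by omega)
  have p2 := hF.cellDist_pos hσ (show i + 1 ≤ n from hi) (by omega)
  rw [cross_fanImage, fanArg_succ_sub] at h
  have h1 := (mul_eq_zero.1 h).resolve_left (by positivity)
  have h2 : triangleAngle (K.cellDist v (c i)) (K.cellDist v (c (i + 1)))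
      (K.cellDist (c i) (c (i + 1))) = 0 := by
    by_contra hne
    have h0 := triangleAngle_nonneg (K.cellDist v (c i)) (K.cellDist v (c (i + 1)))
      (K.cellDist (c i) (c (i + 1)))
    exact (Real.sin_pos_of_pos_of_lt_pi (lt_of_le_of_ne h0 (Ne.symm hne)) (hF.2.1 i hi).2.1).ne' h1
  have h3 := fanArg_succ_sub v c i
  rw [h2, sub_eq_zero] at h3
  refine ⟨K.cellDist v (c i) / K.cellDist v (c (i + 1)), by positivity, ?_⟩
  rw [fanImage, fanImage, h3, Complex.real_smul, ← mul_assoc, ← Complex.ofReal_mul,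
    div_mul_cancel₀ _ p2.ne']

theorem cross_fanAt_left {i j : ℕ} (hij : i + 1 ≤ j) (hj : j ≤ n) {w : K.Point} {X : ℂ}
    (h : FanAt v c i w X) : 0 ≤ Complex.cross X (fanImage v c j) := by
  obtain ⟨l, m, hl, hm, -, -, rfl⟩ := h
  have h1 := mul_nonneg hl (hF.cross_nonneg hσ hπ (show i ≤ j by omega) hj)
  have h2 := mul_nonneg hm (hF.cross_nonneg hσ hπ hij hj)
  simp only [Complex.cross, Complex.real_smul, Complex.add_re, Complex.add_im,
    Complex.re_ofReal_mul, Complex.im_ofReal_mul] at *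
  linarith

theorem cross_fanAt_right {i j : ℕ} (hij : i ≤ j) (hj : j < n) {w : K.Point} {X : ℂ}
    (h : FanAt v c j w X) : 0 ≤ Complex.cross (fanImage v c i) X := by
  obtain ⟨l, m, hl, hm, -, -, rfl⟩ := h
  have h1 := mul_nonneg hl (hF.cross_nonneg hσ hπ hij hj.le)
  have h2 := mul_nonneg hm (hF.cross_nonneg hσ hπ (show i ≤ j + 1 by omega) hj)
  simp only [Complex.cross, Complex.real_smul, Complex.add_re, Complex.add_im,
    Complex.re_ofReal_mul, Complex.im_ofReal_mul] at *
  linarith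

theorem cross_fanAt {i j : ℕ} (hij : i + 1 ≤ j) (hj : j < n) {w w' : K.Point} {X X' : ℂ}
    (h : FanAt v c i w X) (h' : FanAt v c j w' X') : 0 ≤ Complex.cross X X' := by
  have h1 := hF.cross_fanAt_left hσ hπ hij hj.le h
  have h2 := hF.cross_fanAt_left hσ hπ (show i + 1 ≤ j + 1 by omega) hj h
  obtain ⟨l, m, hl, hm, -, -, rfl⟩ := h'
  have h1 := mul_nonneg hl h1
  have h2 := mul_nonneg hm h2
  simp only [Complex.cross, Complex.real_smul, Complex.add_re, Complex.add_im,
    Complex.re_ofReal_mul, Complex.im_ofReal_mul] at *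
  linarith

/-- Induction on the number of triangles crossed: the planar segment from `X` to `X'` is cut where
it crosses the next spoke, and its pieces lift to `C`. So distances in the complex are at most those
in the unrolling. -/
theorem fanAt_joined_le {r : ℝ} (hr : ∀ k ≤ n, r ≤ K.cellDist v (c k)) (k : ℕ) :
    ∀ {i : ℕ} {w w' : K.Point} {X X' : ℂ}, i + k < n → FanAt v c i w X → FanAt v c (i + k) w' X' →
      ‖X‖ ≤ r → ‖X'‖ ≤ r → FineJoined K.pathDist C w w' ‖X - X'‖ := by
  induction k with
  | zero => intro i w w' X X' hi h h' _ _; exact hF.fanAt_joined_same hσ hi h h'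
  | succ k ih =>
    intro i w w' X X' hi h h' hX hX'
    have hi' : i < n := by omega
    have p := hF.cellDist_pos hσ (show i + 1 ≤ n by omega) (by omega)
    obtain ⟨κ, hκ, e1, e2⟩ := Complex.exists_crossing
      (hF.cross_fanAt_left hσ hπ le_rfl (show i + 1 ≤ n by omega) h)
      (hF.cross_fanAt_right hσ hπ (show i + 1 ≤ i + (k + 1) by omega) hi h')
      (hF.cross_fanAt hσ hπ (show i + 1 ≤ i + (k + 1) by omega) hi h h') (by
        intro h0
        obtain ⟨l, m, hl, hm, -, -, rfl⟩ := h
        have h3 : l * Complex.cross (fanImage v c i) (fanImage v c (i + 1)) = 0 := by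
          rw [← h0]
          simp only [Complex.cross, Complex.real_smul, Complex.add_re, Complex.add_im,
            Complex.re_ofReal_mul, Complex.im_ofReal_mul]
          ring
        rcases mul_eq_zero.1 h3 with h4 | h4
        · exact ⟨m, hm, by rw [h4]; simp⟩
        · obtain ⟨k', hk', e⟩ := hF.parallel_of_cross hσ hπ hi' h4
          exact ⟨l * k' + m, by positivity, by rw [e]; module⟩)
    -- The crossing point has norm at most `r`, and every spoke is at least that long; so it lies on
    -- the spoke itself.
    have hκ1 : κ ≤ 1 := by
      rw [norm_smul, Real.norm_eq_abs, abs_of_nonneg hκ, norm_fanImage] at e2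
      have h4 := e2.trans ((max_le hX hX').trans (hr (i + 1) (by omega)))
      by_contra h5
      push Not at h5
      nlinarith
    obtain ⟨s, hs, hv, h1, h2⟩ := (hF.2.1 i hi').1
    obtain ⟨y, -, ey⟩ := exists_mem_smallTriangle hσ hs hv h1 h2 le_rfl hκ (by linarith)
    have hy : FanAt v c i y (κ • fanImage v c (i + 1)) :=
      ⟨0, κ, le_rfl, hκ, by linarith, ey, by simp⟩
    have hy' : FanAt v c (i + 1) y (κ • fanImage v c (i + 1)) :=
      ⟨κ, 0, hκ, le_rfl, by linarith, by rw [ey]; module, by module⟩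
    rw [← e1]
    refine (hF.fanAt_joined_same hσ hi' h hy).trans hσ (ih (by omega) hy' ?_ ?_ hX')
      (norm_nonneg _) (norm_nonneg _)
    · rwa [show i + 1 + k = i + (k + 1) by ring]
    · exact e2.trans (max_le hX hX')

theorem fanAt_joined {r : ℝ} (hr : ∀ k ≤ n, r ≤ K.cellDist v (c k)) {i j : ℕ} (hi : i < n)
    (hj : j < n) {w w' : K.Point} {X X' : ℂ} (h : FanAt v c i w X) (h' : FanAt v c j w' X')
    (hX : ‖X‖ ≤ r) (hX' : ‖X'‖ ≤ r) : FineJoined K.pathDist C w w' ‖X - X'‖ := by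
  rcases Nat.le_total i j with hij | hij
  · obtain ⟨k, rfl⟩ := Nat.exists_eq_add_of_le hij
    exact hF.fanAt_joined_le hσ hπ hr k hj h h' hX hX'
  · obtain ⟨k, rfl⟩ := Nat.exists_eq_add_of_le hij
    rw [norm_sub_rev]
    exact (hF.fanAt_joined_le hσ hπ hr k hi h' h hX' hX).symm hσ

end

end IsFan

/-! ### Straight fans are half discs -/

namespace IsFan

variable {C : Set K.Point} {v a b : K.Point} {n : ℕ} {c : ℕ → K.Point} {r : ℝ}
  (hσ : CATMetric K.pathDist σ) (hF : K.IsFan C v n c)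

theorem exists_radius (hσ : CATMetric K.pathDist σ) (hF : K.IsFan C v n c) (hn : 0 < n) :
    ∃ r > 0, ∀ k ≤ n, r ≤ K.cellDist v (c k) := by
  obtain ⟨k, hk, hmin⟩ := (Finset.range (n + 1)).exists_min_image (fun k => K.cellDist v (c k))
    ⟨0, by simp⟩
  exact ⟨_, hF.cellDist_pos hσ (by simpa [Nat.lt_succ_iff] using hk) hn, fun j hj =>
    hmin j (by simpa [Nat.lt_succ_iff] using hj)⟩

theorem fanAt_left (c : ℕ → K.Point) (i : ℕ) : FanAt v c i (c i) (fanImage v c i) :=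
  ⟨1, 0, zero_le_one, le_rfl, by simp, by simp, by simp⟩

theorem fanAt_right (c : ℕ → K.Point) (i : ℕ) : FanAt v c i (c (i + 1)) (fanImage v c (i + 1)) :=
  ⟨0, 1, le_rfl, zero_le_one, by simp, by simp, by simp⟩

theorem fanImage_zero (c : ℕ → K.Point) : fanImage v c 0 = K.cellDist v (c 0) := by
  rw [fanImage, fanArg_zero]; simp

variable (hn : 0 < n) (hπ : fanArg v c n = Real.pi) (hab : v ∈ K.geod a b)
  (ha : c 0 ∈ K.geod v a) (hb : c n ∈ K.geod v b) (hr0 : 0 < r)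
  (hr : ∀ k ≤ n, r ≤ K.cellDist v (c k))

include hσ hF hn hπ hr0 hr

section

include hab ha hb

/-- With total angle `π` the first and last spokes unroll to opposite real rays. In the complex they
lie on the geodesic from `a` to `b` through `v`, so the points at distance `x` on either side are
`2x` apart. -/
theorem exists_diameter {x : ℝ} (hx : 0 ≤ x) (hxr : x ≤ r) : ∃ P P' : K.Point,
    FanAt v c 0 P x ∧ FanAt v c (n - 1) P' ((-x : ℝ) : ℂ) ∧ K.pathDist P P' = 2 * x ∧
      K.pathDist v P = x ∧ K.pathDist v P' = x := by
  have h0 := hr 0 (Nat.zero_le n)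
  have hn' := hr n le_rfl
  have p0 := hF.cellDist_pos hσ (Nat.zero_le n) hn
  have pn := hF.cellDist_pos hσ le_rfl hn
  have i0 : x / K.cellDist v (c 0) ∈ Icc (0 : ℝ) 1 :=
    ⟨by positivity, div_le_one_of_le₀ (by linarith) p0.le⟩
  have iN : x / K.cellDist v (c n) ∈ Icc (0 : ℝ) 1 :=
    ⟨by positivity, div_le_one_of_le₀ (by linarith) pn.le⟩
  have f0 := hF.fanAt_scale hσ hn (fanAt_left c 0) i0
  have e0 : (x / K.cellDist v (c 0)) • fanImage v c 0 = (x : ℂ) := by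
    rw [fanImage_zero, Complex.real_smul, ← Complex.ofReal_mul, div_mul_cancel₀ _ p0.ne']
  rw [e0] at f0
  have fN := hF.fanAt_scale hσ (show n - 1 < n by omega) (fanAt_right c (n - 1))
    (t := x / K.cellDist v (c n)) iN
  rw [show n - 1 + 1 = n by omega] at fN
  have eN : (x / K.cellDist v (c n)) • fanImage v c n = ((-x : ℝ) : ℂ) := by
    rw [fanImage, hπ, Complex.exp_pi_mul_I, Complex.real_smul, ← mul_assoc, ← Complex.ofReal_mul,
      div_mul_cancel₀ _ pn.ne']
    push_cast; ring
  rw [eN] at fN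
  have d0 := hF.fanAt_norm hσ hn f0
  have dN := hF.fanAt_norm hσ (show n - 1 < n by omega) fN
  rw [Complex.norm_real, Real.norm_eq_abs, abs_of_nonneg hx] at d0
  rw [Complex.norm_real, Real.norm_eq_abs, abs_neg, abs_of_nonneg hx] at dN
  refine ⟨_, _, f0, fN, ?_, d0, dN⟩
  have g0 := hσ.between_of_between ha (hσ.between_seg v (c 0) i0)
  have gN := hσ.between_of_between hb (hσ.between_seg v (c n) iN)
  set P := σ v (c 0) (x / K.cellDist v (c 0))
  set P' := σ v (c n) (x / K.cellDist v (c n))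
  have hab' : K.pathDist a v + K.pathDist v b = K.pathDist a b := hab
  have t1 := hσ.tri P v P'
  have t2 := hσ.tri a P b
  have t3 := hσ.tri P P' b
  rw [hσ.comm P v] at t1
  rw [hσ.comm P a] at g0
  rw [hσ.comm a v] at hab'
  rw [hσ.comm v a] at g0 hab'
  linarith

/-- Rigidity: the unrolling bounds the distances of `w` from both ends of a diameter from above,
while `cn` at its midpoint `v` bounds the sum of their squares from below. By the parallelogram law
the bounds coincide, so both are equalities. -/
theorem exists_real {x : ℝ} (hx : |x| ≤ r) : ∃ P, ∀ i < n, ∀ (w : K.Point) (X : ℂ),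
    FanAt v c i w X → ‖X‖ ≤ r → K.pathDist P w = ‖(x : ℂ) - X‖ := by
  have key : ∀ x : ℝ, 0 ≤ x → x ≤ r → ∃ P P', ∀ i < n, ∀ (w : K.Point) (X : ℂ),
      FanAt v c i w X → ‖X‖ ≤ r → K.pathDist P w = ‖(x : ℂ) - X‖ ∧
        K.pathDist P' w = ‖((-x : ℝ) : ℂ) - X‖ := by
    intro x hx hxr
    obtain ⟨P, P', hP, hP', hPP, d0, dN⟩ := hF.exists_diameter hσ hn hπ hab ha hb hr0 hr hx hxr
    refine ⟨P, P', fun i hi w X hw hX => ?_⟩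
    have nx : ‖(x : ℂ)‖ ≤ r := by
      rwa [Complex.norm_real, Real.norm_eq_abs, abs_of_nonneg hx]
    have nx' : ‖((-x : ℝ) : ℂ)‖ ≤ r := by
      rwa [Complex.norm_real, Real.norm_eq_abs, abs_neg, abs_of_nonneg hx]
    have u1 := (hF.fanAt_joined hσ hπ.le hr hn hi hP hw nx hX).dist_le hσ (norm_nonneg _)
    have u2 := (hF.fanAt_joined hσ hπ.le hr (show n - 1 < n by omega) hi hP' hw nx' hX).dist_le hσ
      (norm_nonneg _)
    have hv : v = σ P P' (1 / 2) := by
      apply hσ.eq_seg (by norm_num)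
      · rw [hσ.comm, d0, hPP]; linarith
      · rw [dN, hPP]; linarith
    have h1 := hσ.cn P P' w (1 / 2) (by norm_num)
    rw [← hv, hPP, hσ.comm w v, hF.fanAt_norm hσ hi hw, hσ.comm w P, hσ.comm w P'] at h1
    have e1 : ‖(x : ℂ) - X‖ ^ 2 + ‖((-x : ℝ) : ℂ) - X‖ ^ 2 = 2 * x ^ 2 + 2 * ‖X‖ ^ 2 := by
      simp only [Complex.sq_norm, Complex.normSq_apply, Complex.sub_re, Complex.sub_im,
        Complex.ofReal_re, Complex.ofReal_im]
      ring
    have n1 := hσ.nonneg P w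
    have n2 := hσ.nonneg P' w
    have s1 := pow_le_pow_left₀ n1 u1 2
    have s2 := pow_le_pow_left₀ n2 u2 2
    constructor
    · rw [← sq_eq_sq₀ n1 (norm_nonneg _)]; linarith
    · rw [← sq_eq_sq₀ n2 (norm_nonneg _)]; linarith
  rcases le_total 0 x with h | h
  · obtain ⟨P, P', hP⟩ := key x h (by rwa [abs_of_nonneg h] at hx)
    exact ⟨P, fun i hi w X hw hX => (hP i hi w X hw hX).1⟩
  · obtain ⟨P, P', hP⟩ := key (-x) (by linarith) (by rwa [abs_of_nonpos h] at hx)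
    exact ⟨P', fun i hi w X hw hX => by simpa using (hP i hi w X hw hX).2⟩

/-- The line through `X'` and `X` reaches the real axis at `x`, where distances are known by
`exists_real`, and the triangle inequality through that point gives the lower bound. As `x` may be
far away, everything is scaled into the disc by `t`, at the cost of Thales' inequality. -/
theorem norm_le_of_line {i j : ℕ} (hi : i < n) (hj : j < n) {w w' : K.Point} {X X' : ℂ}
    (h : FanAt v c i w X) (h' : FanAt v c j w' X') (hX : ‖X‖ ≤ r) (hX' : ‖X'‖ ≤ r) {x κ : ℝ}
    (hκ : κ ∈ Icc (0 : ℝ) 1) (e : X = x + κ • (X' - x)) : ‖X - X'‖ ≤ K.pathDist w w' := by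
  set t := r / (|x| + r) with ht
  have hpos : 0 < |x| + r := by have := abs_nonneg x; linarith
  have ht0 : 0 < t := by positivity
  have ht1 : t ≤ 1 := by rw [ht, div_le_one hpos]; linarith [abs_nonneg x]
  have htI : t ∈ Icc (0 : ℝ) 1 := ⟨ht0.le, ht1⟩
  have htx : |t * x| ≤ r := by
    rw [abs_mul, abs_of_pos ht0, ht, div_mul_eq_mul_div, div_le_iff₀ hpos]
    nlinarith [abs_nonneg x]
  obtain ⟨P, hP⟩ := hF.exists_real hσ hn hπ hab ha hb hr0 hr htx
  have hsc : ∀ Y : ℂ, ‖Y‖ ≤ r → ‖t • Y‖ ≤ r := fun Y hY => by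
    rw [norm_smul, Real.norm_eq_abs, abs_of_pos ht0]; nlinarith [norm_nonneg Y]
  have h1 := hP i hi _ _ (hF.fanAt_scale hσ hi h htI) (hsc X hX)
  have h2 := hP j hj _ _ (hF.fanAt_scale hσ hj h' htI) (hsc X' hX')
  have h3 := hσ.tri P (σ v w t) (σ v w' t)
  have h4 := hσ.thales v w w' htI
  have e1 : ((t * x : ℝ) : ℂ) - t • X = (t * κ) • (x - X') := by
    rw [e]; simp only [Complex.real_smul]; push_cast; ring
  have e2 : ((t * x : ℝ) : ℂ) - t • X' = t • (x - X') := by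
    simp only [Complex.real_smul]; push_cast; ring
  have e3 : X - X' = (1 - κ) • (x - X') := by
    rw [e]; module
  rw [h1, h2, e1, e2, norm_smul, norm_smul, Real.norm_eq_abs, Real.norm_eq_abs, abs_of_pos ht0,
    abs_of_nonneg (mul_nonneg ht0.le hκ.1)] at h3
  rw [e3, norm_smul, Real.norm_eq_abs, abs_of_nonneg (by linarith [hκ.2])]
  have : t * ((1 - κ) * ‖(x : ℂ) - X'‖) ≤ t * K.pathDist w w' := by linarith
  exact le_of_mul_le_mul_left this ht0

theorem norm_le_of_im_lt {i j : ℕ} (hi : i < n) (hj : j < n) {w w' : K.Point} {X X' : ℂ}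
    (h : FanAt v c i w X) (h' : FanAt v c j w' X') (hX : ‖X‖ ≤ r) (hX' : ‖X'‖ ≤ r)
    (h0 : 0 ≤ X.im) (hlt : X.im < X'.im) : ‖X - X'‖ ≤ K.pathDist w w' := by
  set κ := X.im / X'.im with hκ
  have hX'0 : 0 < X'.im := by linarith
  have hκ1 : κ < 1 := by rw [hκ, div_lt_one hX'0]; exact hlt
  have hκX : κ * X'.im = X.im := div_mul_cancel₀ _ hX'0.ne'
  refine hF.norm_le_of_line hσ hn hπ hab ha hb hr0 hr hi hj h h' hX hX'
    (x := (X.re - κ * X'.re) / (1 - κ)) (κ := κ) ⟨by positivity, hκ1.le⟩ ?_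
  have h1 : 1 - κ ≠ 0 := by linarith
  have h2 := div_mul_cancel₀ (X.re - κ * X'.re) h1
  apply Complex.ext
  · simp only [Complex.add_re, Complex.real_smul, Complex.re_ofReal_mul, Complex.sub_re,
      Complex.ofReal_re]
    linarith
  · simp only [Complex.add_im, Complex.real_smul, Complex.im_ofReal_mul, Complex.sub_im,
      Complex.ofReal_im]
    linarith

/-- When the line is parallel to the real axis, `X` is shrunk slightly towards `0`, which lowers its
imaginary part, and the error is let tend to zero. -/
theorem norm_le_dist {i j : ℕ} (hi : i < n) (hj : j < n) {w w' : K.Point} {X X' : ℂ}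
    (h : FanAt v c i w X) (h' : FanAt v c j w' X') (hX : ‖X‖ ≤ r) (hX' : ‖X'‖ ≤ r) :
    ‖X - X'‖ ≤ K.pathDist w w' := by
  wlog hle : X.im ≤ X'.im generalizing i j w w' X X'
  · rw [norm_sub_rev, hσ.comm]
    exact this hj hi h' h hX' hX (le_of_not_ge hle)
  have h0 : 0 ≤ X.im := by
    have h1 := hF.cross_fanAt_right hσ hπ.le (Nat.zero_le i) hi h
    rw [fanImage_zero, Complex.cross, Complex.ofReal_re, Complex.ofReal_im, zero_mul, sub_zero] at h1
    exact nonneg_of_mul_nonneg_right h1 (hF.cellDist_pos hσ (Nat.zero_le n) hn)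
  rcases eq_or_lt_of_le h0 with h00 | h00
  · refine hF.norm_le_of_line hσ hn hπ hab ha hb hr0 hr hi hj h h' hX hX' (x := X.re) (κ := 0)
      (by simp) ?_
    apply Complex.ext <;> simp [← h00]
  rcases eq_or_lt_of_le hle with he | hlt
  · apply le_of_forall_pos_le_add
    intro ε hε
    set s := 1 - ε / (2 * ‖X‖ + ε) with hs
    have hD : 0 < 2 * ‖X‖ + ε := by positivity
    have hs1 : s < 1 := by have : 0 < ε / (2 * ‖X‖ + ε) := by positivity
                           linarith
    have hs0 : 0 ≤ s := by
      have : ε / (2 * ‖X‖ + ε) ≤ 1 := by rw [div_le_one hD]; linarith [norm_nonneg X]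
      linarith
    have hsX : 2 * ((1 - s) * ‖X‖) ≤ ε := by
      rw [hs, sub_sub_cancel, div_mul_eq_mul_div, ← mul_div_assoc, div_le_iff₀ hD]
      nlinarith [norm_nonneg X]
    have hsI : s ∈ Icc (0 : ℝ) 1 := ⟨hs0, hs1.le⟩
    have e1 := hF.norm_le_of_im_lt hσ hn hπ hab ha hb hr0 hr hi hj (hF.fanAt_scale hσ hi h hsI) h'
      (by rw [norm_smul, Real.norm_eq_abs, abs_of_nonneg hs0]; nlinarith [norm_nonneg X]) hX'
      (by rw [Complex.real_smul, Complex.im_ofReal_mul]; positivity)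
      (by rw [Complex.real_smul, Complex.im_ofReal_mul]; nlinarith)
    have e2 := hσ.tri (σ v w s) w w'
    rw [hσ.dist_right v w hsI, hF.fanAt_norm hσ hi h] at e2
    have e3 := norm_sub_le_norm_sub_add_norm_sub X (s • X) X'
    rw [show X - s • X = (1 - s) • X by module, norm_smul, Real.norm_eq_abs,
      abs_of_pos (by linarith)] at e3
    linarith
  · exact hF.norm_le_of_im_lt hσ hn hπ hab ha hb hr0 hr hi hj h h' hX hX' h0 hlt

end

end IsFan

/-- Upper and lower bounds together make the unrolling of a fan with angle sum `π` isometric near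
`v`. The lifted planar segments then realize the distances, so geodesics between nearby points of
`C` stay in `C`. -/
theorem exists_halfDisc (hσ : CATMetric K.pathDist σ) {C : Set K.Point} {v a b : K.Point}
    (hab : v ∈ K.geod a b) (h : K.HasInnerAngle C v (K.geod v a) (K.geod v b) Real.pi) :
    ∃ r > 0, ∃ ψ : K.Point → ℂ, ∀ w ∈ C, ∀ w' ∈ C, K.pathDist v w < r → K.pathDist v w' < r →
      dist (ψ w) (ψ w') = K.pathDist w w' ∧ ∀ t ∈ Icc (0 : ℝ) 1, σ w w' t ∈ C := by
  classical
  obtain ⟨n, c, hF, ha, hb, hπ⟩ := h.1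
  replace hπ : fanArg v c n = Real.pi := hπ.symm
  have hn : 0 < n := by
    rcases Nat.eq_zero_or_pos n with rfl | h
    · rw [fanArg_zero] at hπ
      exact absurd hπ Real.pi_pos.ne
    · exact h
  obtain ⟨r, hr0, hr⟩ := hF.exists_radius hσ hn
  obtain ⟨ρ, hρ, hball⟩ := exists_ball_subset hσ hF.2.2
  have hrel : ∀ w : K.Point, ∃ X : ℂ, w ∈ C → K.pathDist v w < ρ → ∃ i < n, FanAt v c i w X := by
    intro w
    by_cases hw : w ∈ C ∧ K.pathDist v w < ρ
    · obtain ⟨i, hi, hwi⟩ := hball w hw.2 hw.1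
      obtain ⟨l, m, hl, hm, hlm, e⟩ := mem_smallTriangle.1 hwi
      exact ⟨_, fun _ _ => ⟨i, hi, l, m, hl, hm, hlm, e, rfl⟩⟩
    · exact ⟨0, fun h1 h2 => (hw ⟨h1, h2⟩).elim⟩
  choose ψ hψ using hrel
  refine ⟨min r ρ, lt_min hr0 hρ, ψ, fun w hw w' hw' hd hd' => ?_⟩
  obtain ⟨i, hi, h1⟩ := hψ w hw (hd.trans_le (min_le_right _ _))
  obtain ⟨j, hj, h2⟩ := hψ w' hw' (hd'.trans_le (min_le_right _ _))
  have n1 : ‖ψ w‖ ≤ r := by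
    rw [← hF.fanAt_norm hσ hi h1]; exact (hd.trans_le (min_le_left _ _)).le
  have n2 : ‖ψ w'‖ ≤ r := by
    rw [← hF.fanAt_norm hσ hj h2]; exact (hd'.trans_le (min_le_left _ _)).le
  have hJ := hF.fanAt_joined hσ hπ.le hr hi hj h1 h2 n1 n2
  have e : ‖ψ w - ψ w'‖ = K.pathDist w w' :=
    le_antisymm (hF.norm_le_dist hσ hn hπ hab ha hb hr0 hr hi hj h1 h2 n1 n2)
      (hJ.dist_le hσ (norm_nonneg _))
  refine ⟨by rw [dist_eq_norm, e], fun t ht => ?_⟩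
  rw [e] at hJ
  exact hJ.seg_mem hσ ht

/-! ### Flatness in the interior of a region -/

/-- Near `v` the set `C` is isometric to a subset of the plane. -/
def IsFlatAt (K : TriangleComplex V) (C : Set K.Point) (v : K.Point) : Prop :=
  ∃ r > 0, ∃ ψ : K.Point → ℂ, ∀ w ∈ C, ∀ w' ∈ C, K.pathDist v w < r → K.pathDist v w' < r →
    dist (ψ w) (ψ w') = K.pathDist w w'

theorem isClosed_cell (s : Finset V) : IsClosed (K.cell s) := by
  simp only [cell, Set.ofPred_forall]
  exact isClosed_iInter fun v => isClosed_iInter fun _ =>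
    isClosed_eq ((continuous_apply v).comp continuous_subtype_val) continuous_const

theorem continuous_develop (Z : V → ℂ) : Continuous fun w : K.Point => develop Z w.1 :=
  continuous_finsetSum _ fun v _ => (Complex.continuous_ofReal.comp
    ((continuous_apply v).comp continuous_subtype_val)).mul continuous_const

theorem exists_support (y : K.Point) : ∃ t ∈ K.cells, y ∈ K.openCell t ∧
    ∀ s ∈ K.cells, y ∈ K.cell s → t ⊆ s := by
  classical
  obtain ⟨s, hs, hys⟩ := exists_cell y
  have hsub : ∀ s, y ∈ K.cell s → (Finset.univ.filter fun v => 0 < y.1 v) ⊆ s := by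
    intro s hys v hv
    by_contra hvs
    rw [Finset.mem_filter, hys v hvs] at hv
    exact lt_irrefl _ hv.2
  refine ⟨Finset.univ.filter fun v => 0 < y.1 v, K.down_closed s hs _ (hsub s hys), ⟨?_, ?_⟩,
    fun s _ => hsub s⟩
  · intro v hv
    simp only [Finset.mem_filter, Finset.mem_univ, true_and, not_lt] at hv
    exact le_antisymm hv (y.2.1 v)
  · intro v hv
    simpa using hv

theorem isFlatAt_of_cell (hσ : CATMetric K.pathDist σ) {C : Set K.Point} {y : K.Point}
    {s : Finset V} (hs : s ∈ K.cells) (h : ∃ r > 0, ∀ w ∈ C, K.pathDist y w < r → w ∈ K.cell s) :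
    K.IsFlatAt C y := by
  obtain ⟨Z, hZ, -⟩ := K.exists_chart hs
  obtain ⟨r, hr, h⟩ := h
  refine ⟨r, hr, fun w => develop Z w.1, fun w hw w' hw' h1 h2 => ?_⟩
  rw [pathDist_eq_cellDist hσ hs (h w hw h1) (h w' hw' h2), hZ.cellDist_eq (h w hw h1) (h w' hw' h2),
    dist_eq_norm]

theorem exists_ball_common_cell (hσ : CATMetric K.pathDist σ) (y : K.Point) :
    ∃ r > 0, ∀ w, K.pathDist y w < r → ∃ s ∈ K.cells, y ∈ K.cell s ∧ w ∈ K.cell s :=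
  exists_ball_subset hσ (eventually_common_cell y)

theorem cell_mono {s t : Finset V} (h : s ⊆ t) : K.cell s ⊆ K.cell t := fun _ hw v hv =>
  hw v fun hvs => hv (h hvs)

section Triangle

variable [DecidableEq V] {a b r : V}

theorem sum_triangle (hab : a ≠ b) (har : a ≠ r) (hbr : b ≠ r) {M : Type*} [AddCommMonoid M]
    {f : V → M} (hf : ∀ v, v ∉ ({a, b, r} : Finset V) → f v = 0) : ∑ v, f v = f a + f b + f r := by
  rw [← Finset.sum_subset (Finset.subset_univ {a, b, r}) (fun v _ hv => hf v hv),
    Finset.sum_insert (by simp [hab, har]), Finset.sum_insert (by simp [hbr]),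
    Finset.sum_singleton, add_assoc]

/-- A chart of a triangle with a side on the real axis. -/
theorem exists_sided_chart (hs : ({a, b, r} : Finset V) ∈ K.cells) (hab : a ≠ b) (har : a ≠ r)
    (hbr : b ≠ r) : ∃ w : ℂ, 0 < w.im ∧ ∀ Z : V → ℂ, Z a = 0 → Z b = K.len a b →
      (Z r = w ∨ Z r = (starRingEnd ℂ) w) → K.IsChart {a, b, r} Z := by
  have hpos := K.len_pos _ hs a (by simp) b (by simp) hab
  obtain ⟨w, -, him, hw1, hw2⟩ := K.exists_apex hs hab har hbr
  refine ⟨w, him, fun Z ha hb hr => isChart_triangle ha hb hpos.le ?_ ?_⟩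
  · rcases hr with h | h
    · rw [h, hw1]
    · rw [h, Complex.norm_conj, hw1]
  · rcases hr with h | h
    · rw [h, hw2]
    · rw [h, ← hw2, ← Complex.norm_conj (w - _)]
      simp

/-- A perpendicular erected inside the triangle at a point of its side. The distances from its end
to points of the edge do not depend on the triangle. -/
theorem exists_perp (hs : ({a, b, r} : Finset V) ∈ K.cells) (hab : a ≠ b) (har : a ≠ r)
    (hbr : b ≠ r) {O : K.Point} (hO : O ∈ K.openCell {a, b}) : ∃ η₀ > 0, ∀ η, 0 < η → η ≤ η₀ →
      ∃ x ∈ K.cell {a, b, r}, 0 < x.1 r ∧ ∀ O' ∈ K.cell {a, b},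
        K.cellDist O' x ^ 2 = K.cellDist O' O ^ 2 + η ^ 2 := by
  obtain ⟨w, him, hw⟩ := exists_sided_chart hs hab har hbr
  set Z : V → ℂ := fun v => if v = b then (K.len a b : ℂ) else if v = r then w else 0 with hZ
  have hZa : Z a = 0 := by simp [hZ, hab, har]
  have hZb : Z b = K.len a b := by simp [hZ]
  have hZr : Z r = w := by simp [hZ, hbr.symm]
  have hchart := hw Z hZa hZb (Or.inl hZr)
  have hpos := K.len_pos _ hs a (by simp) b (by simp) hab
  set f := w.re / K.len a b with hf
  have hfL : f * K.len a b = w.re := div_mul_cancel₀ _ hpos.ne'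
  have hOa := hO.2 a (by simp)
  have hOb := hO.2 b (by simp)
  have hsub : K.cell ({a, b} : Finset V) ⊆ K.cell {a, b, r} := cell_mono (by
    intro v; simp only [Finset.mem_insert, Finset.mem_singleton]; tauto)
  set D := |1 - f| + |f| + 1 with hD
  have hD0 : 0 < D := by positivity
  -- The bound on the height keeps the barycentric coordinates of the constructed point nonnegative.
  refine ⟨w.im * (min (O.1 a) (O.1 b) / D), mul_pos him (div_pos (lt_min hOa hOb) hD0),
    fun η hη hη₀ => ?_⟩
  set k := η / w.im with hk
  have hk0 : 0 < k := by positivity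
  have hkD : k * D ≤ min (O.1 a) (O.1 b) := by
    rw [← le_div_iff₀ hD0, hk, div_le_iff₀' him]; exact hη₀
  have hka : k * (1 - f) ≤ O.1 a := by
    have := min_le_left (O.1 a) (O.1 b)
    have := mul_le_mul_of_nonneg_left (le_abs_self (1 - f)) hk0.le
    have := mul_nonneg hk0.le (abs_nonneg f)
    have : k * D = k * |1 - f| + k * |f| + k := by rw [hD]; ring
    linarith
  have hkb : k * f ≤ O.1 b := by
    have := min_le_right (O.1 a) (O.1 b)
    have := mul_le_mul_of_nonneg_left (le_abs_self f) hk0.le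
    have := mul_nonneg hk0.le (abs_nonneg (1 - f))
    have : k * D = k * |1 - f| + k * |f| + k := by rw [hD]; ring
    linarith
  -- The barycentric form of the altitude at `r`, whose foot divides the edge in the ratio `f`.
  set g : V → ℝ := fun v => if v = a then -(1 - f) else if v = b then -f else if v = r then 1 else 0
    with hg
  have hga : g a = -(1 - f) := by simp [hg]
  have hgb : g b = -f := by simp [hg, hab.symm]
  have hgr : g r = 1 := by simp [hg, har.symm, hbr.symm]
  have hg0 : ∀ v, v ∉ ({a, b, r} : Finset V) → g v = 0 := by
    intro v hv
    simp only [Finset.mem_insert, Finset.mem_singleton, not_or] at hv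
    simp [hg, hv]
  have hOr : O.1 r = 0 := hO.1 r (by simp [har.symm, hbr.symm])
  have hx0 : ∀ v, v ∉ ({a, b, r} : Finset V) → (O.1 + k • g) v = 0 := by
    intro v hv
    simp [hg0 v hv, hsub hO.1 v hv]
  have hgdev : develop Z g = w.im * Complex.I := by
    rw [develop, sum_triangle hab har hbr (fun v hv => by simp [hg0 v hv]), hga, hgb, hgr, hZa, hZb,
      hZr, mul_zero, zero_add, Complex.ofReal_one, one_mul, ← Complex.ofReal_mul, neg_mul, hfL]
    apply Complex.ext <;> simp
  let x : K.Point := ⟨O.1 + k • g, by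
    refine ⟨fun v => ?_, ?_, _, hs, hx0⟩
    · by_cases hv : v ∈ ({a, b, r} : Finset V)
      · simp only [Finset.mem_insert, Finset.mem_singleton] at hv
        rcases hv with rfl | rfl | rfl
        · simp only [Pi.add_apply, Pi.smul_apply, smul_eq_mul, hga]; linarith
        · simp only [Pi.add_apply, Pi.smul_apply, smul_eq_mul, hgb]; linarith
        · simp only [Pi.add_apply, Pi.smul_apply, smul_eq_mul, hgr, hOr]; linarith
      · exact (hx0 v hv).ge
    · have : ∑ v, g v = 0 := by rw [sum_triangle hab har hbr hg0, hga, hgb, hgr]; ring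
      simp only [Pi.add_apply, Pi.smul_apply, smul_eq_mul, Finset.sum_add_distrib,
        ← Finset.mul_sum, this, O.2.2.1, mul_zero, add_zero]⟩
  refine ⟨x, hx0, ?_, fun O' hO' => ?_⟩
  · change 0 < (O.1 + k • g) r
    simp only [Pi.add_apply, Pi.smul_apply, smul_eq_mul, hgr, hOr]; linarith
  · have hreal : ∀ y ∈ K.cell ({a, b} : Finset V), (develop Z y.1).im = 0 := by
      intro y hy
      have hyr : y.1 r = 0 := hy r (by simp [har.symm, hbr.symm])
      rw [develop, sum_triangle hab har hbr (fun v hv => by simp [hsub hy v hv]), hZa, hZb, hyr]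
      simp
    rw [hchart.cellDist_eq (hsub hO') (show x ∈ K.cell _ from hx0), hchart.cellDist_eq (hsub hO') (hsub hO.1)]
    change ‖develop Z O'.1 - develop Z (O.1 + k • g)‖ ^ 2 = _
    rw [develop_add, develop_smul, hgdev, Complex.sq_norm, Complex.sq_norm, Complex.normSq_apply,
      Complex.normSq_apply]
    simp only [Complex.sub_re, Complex.sub_im, Complex.add_re, Complex.add_im,
      Complex.re_ofReal_mul, Complex.im_ofReal_mul, Complex.I_re, Complex.I_im, hreal _ hO',
      hreal _ hO.1]
    have : k * w.im = η := div_mul_cancel₀ _ him.ne'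
    rw [mul_one, this]
    ring

/-- The two triangles are developed on opposite sides of their common edge on the real axis. -/
theorem isFlatAt_of_two_triangles (hσ : CATMetric K.pathDist σ) (C : Set K.Point) {y : K.Point}
    {r₁ r₂ : V} (hab : a ≠ b) (ha₁ : a ≠ r₁) (hb₁ : b ≠ r₁) (ha₂ : a ≠ r₂) (hb₂ : b ≠ r₂)
    (h₁₂ : r₁ ≠ r₂) (hs₁ : ({a, b, r₁} : Finset V) ∈ K.cells)
    (hs₂ : ({a, b, r₂} : Finset V) ∈ K.cells) (hy : y ∈ K.openCell {a, b})
    (hcells : ∀ s ∈ K.cells, y ∈ K.cell s → s ⊆ {a, b, r₁} ∨ s ⊆ {a, b, r₂}) :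
    K.IsFlatAt C y := by
  obtain ⟨w₁, him₁, hw₁⟩ := exists_sided_chart hs₁ hab ha₁ hb₁
  obtain ⟨w₂, him₂, hw₂⟩ := exists_sided_chart hs₂ hab ha₂ hb₂
  set L := K.len a b with hL
  have hpos : 0 < L := K.len_pos _ hs₁ a (by simp) b (by simp) hab
  set Z : V → ℂ := fun v => if v = b then (L : ℂ) else if v = r₁ then w₁ else
    if v = r₂ then (starRingEnd ℂ) w₂ else 0 with hZ
  have hZa : Z a = 0 := by simp [hZ, hab, ha₁, ha₂]
  have hZb : Z b = L := by simp [hZ]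
  have hZ₁ : Z r₁ = w₁ := by simp [hZ, hb₁.symm]
  have hZ₂ : Z r₂ = (starRingEnd ℂ) w₂ := by simp [hZ, hb₂.symm, h₁₂.symm]
  have hc₁ := hw₁ Z hZa hZb (Or.inl hZ₁)
  have hc₂ := hw₂ Z hZa hZb (Or.inr hZ₂)
  have d₁ : ∀ w ∈ K.cell {a, b, r₁}, develop Z w.1 = w.1 b * L + w.1 r₁ * w₁ := by
    intro w hw
    rw [develop, sum_triangle hab ha₁ hb₁ (fun v hv => by simp [hw v hv]), hZa, hZb, hZ₁, mul_zero,
      zero_add]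
  have d₂ : ∀ w ∈ K.cell {a, b, r₂}, develop Z w.1 = w.1 b * L + w.1 r₂ * (starRingEnd ℂ) w₂ := by
    intro w hw
    rw [develop, sum_triangle hab ha₂ hb₂ (fun v hv => by simp [hw v hv]), hZa, hZb, hZ₂, mul_zero,
      zero_add]
  have i₁ : ∀ w ∈ K.cell {a, b, r₁}, 0 ≤ (develop Z w.1).im := by
    intro w hw
    rw [d₁ w hw]
    simpa using mul_nonneg (w.2.1 r₁) him₁.le
  have i₂ : ∀ w ∈ K.cell {a, b, r₂}, (develop Z w.1).im ≤ 0 := by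
    intro w hw
    rw [d₂ w hw]
    simpa using mul_nonneg (w.2.1 r₂) him₂.le
  have e₁ : K.cell ({a, b} : Finset V) ⊆ K.cell {a, b, r₁} := cell_mono (by
    intro v; simp only [Finset.mem_insert, Finset.mem_singleton]; tauto)
  have e₂ : K.cell ({a, b} : Finset V) ⊆ K.cell {a, b, r₂} := cell_mono (by
    intro v; simp only [Finset.mem_insert, Finset.mem_singleton]; tauto)
  have hya := hy.2 a (by simp)
  have hyb := hy.2 b (by simp)
  have hyr : y.1 r₁ = 0 := hy.1 r₁ (by simp [ha₁.symm, hb₁.symm])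
  have hysum : y.1 a + y.1 b = 1 := by
    have := y.2.2.1
    rwa [sum_triangle hab ha₁ hb₁ (e₁ hy.1), hyr, add_zero] at this
  have hyre : (develop Z y.1).re = y.1 b * L := by
    rw [d₁ y (e₁ hy.1), hyr]; simp
  have hU : {w : K.Point | (∃ s ∈ K.cells, y ∈ K.cell s ∧ w ∈ K.cell s) ∧
      0 < (develop Z w.1).re ∧ (develop Z w.1).re < L} ∈ 𝓝 y := by
    have hc : Continuous fun w : K.Point => (develop Z w.1).re :=
      Complex.continuous_re.comp (continuous_develop Z)
    filter_upwards [eventually_common_cell y,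
      hc.continuousAt.eventually (lt_mem_nhds (hyre ▸ mul_pos hyb hpos : 0 < (develop Z y.1).re)),
      hc.continuousAt.eventually (gt_mem_nhds
        (show (develop Z y.1).re < L by rw [hyre]; nlinarith))] with w h1 h2 h3
    exact ⟨h1, h2, h3⟩
  obtain ⟨ρ, hρ, hball⟩ := exists_ball_subset hσ hU
  have hmem : ∀ w, K.pathDist y w < ρ → w ∈ K.cell {a, b, r₁} ∨ w ∈ K.cell {a, b, r₂} := by
    intro w hw
    obtain ⟨⟨s, hs, hys, hws⟩, -⟩ := hball w hw
    exact (hcells s hs hys).imp (fun h => cell_mono h hws) (fun h => cell_mono h hws)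
  have cross : ∀ w w' : K.Point, K.pathDist y w < ρ → K.pathDist y w' < ρ →
      w ∈ K.cell {a, b, r₁} → w' ∈ K.cell {a, b, r₂} →
      ‖develop Z w.1 - develop Z w'.1‖ = K.pathDist w w' := by
    intro w w' hw hw' hw₁ hw₂
    apply le_antisymm
    -- By connectedness the geodesic passes through a point of both triangles, which splits its
    -- length into two planar ones.
    · have hpre : IsPreconnected (σ w w' '' Icc (0 : ℝ) 1) :=
        isPreconnected_Icc.image _ (continuousOn_seg hσ w w')
      obtain ⟨_, ⟨t, ht, rfl⟩, hm₁, hm₂⟩ := isPreconnected_closed_iff.1 hpre _ _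
        (isClosed_cell {a, b, r₁}) (isClosed_cell {a, b, r₂})
        (by rintro _ ⟨t, ht, rfl⟩; exact hmem _ (hσ.ball_convex hw hw' ht))
        ⟨w, ⟨0, by simp, hσ.zero w w'⟩, hw₁⟩ ⟨w', ⟨1, by simp, hσ.one w w'⟩, hw₂⟩
      rw [← hσ.between_seg w w' ht, pathDist_eq_cellDist hσ hs₁ hw₁ hm₁,
        pathDist_eq_cellDist hσ hs₂ hm₂ hw₂, hc₁.cellDist_eq hw₁ hm₁, hc₂.cellDist_eq hm₂ hw₂]
      exact norm_sub_le_norm_sub_add_norm_sub _ _ _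
    · set P := develop Z w.1 with hP
      set Q := develop Z w'.1 with hQ
      have hPi := i₁ w hw₁
      have hQi := i₂ w' hw₂
      obtain ⟨-, hP0, hPL⟩ := hball w hw
      obtain ⟨-, hQ0, hQL⟩ := hball w' hw'
      -- The planar segment meets the real axis between `0` and `L`, hence on the edge, and so it
      -- lifts to the two triangles.
      have hτ : ∃ τ ∈ Icc (0 : ℝ) 1, P.im + τ * (Q.im - P.im) = 0 := by
        rcases eq_or_lt_of_le hPi with h | h
        · exact ⟨0, by simp, by rw [hP, ← h]; ring⟩
        · have : 0 < P.im - Q.im := by linarith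
          refine ⟨P.im / (P.im - Q.im), ⟨by positivity, ?_⟩, ?_⟩
          · rw [div_le_one this]; linarith
          · have := div_mul_cancel₀ P.im this.ne'
            linarith
      obtain ⟨τ, hτ, hτ0⟩ := hτ
      have hX0 : 0 ≤ P.re + τ * (Q.re - P.re) := by
        nlinarith [mul_nonneg hτ.1 hQ0.le, mul_nonneg (sub_nonneg.2 hτ.2) hP0.le]
      have hXL : P.re + τ * (Q.re - P.re) ≤ L := by
        nlinarith [mul_nonneg hτ.1 (sub_nonneg.2 hQL.le),
          mul_nonneg (sub_nonneg.2 hτ.2) (sub_nonneg.2 hPL.le)]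
      have hxI : (P.re + τ * (Q.re - P.re)) / L ∈ Icc (0 : ℝ) 1 :=
        ⟨by positivity, div_le_one_of_le₀ hXL hpos.le⟩
      have hva := singleton_mem hs₁ (show a ∈ ({a, b, r₁} : Finset V) by simp)
      have hvb := singleton_mem hs₁ (show b ∈ ({a, b, r₁} : Finset V) by simp)
      have hcab : ({a, b} : Finset V) ∈ K.cells := K.down_closed _ hs₁ _ (by
        intro v; simp only [Finset.mem_insert, Finset.mem_singleton]; tauto)
      have ma := vertexPoint_mem_cell hva (show a ∈ ({a, b} : Finset V) by simp)
      have mb := vertexPoint_mem_cell hvb (show b ∈ ({a, b} : Finset V) by simp)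
      have hm := seg_mem_cell hσ hcab ma mb hxI
      have hmv := seg_val hσ hcab ma mb hxI
      set m := σ (vertexPoint a hva) (vertexPoint b hvb) ((P.re + τ * (Q.re - P.re)) / L)
      have hmb : m.1 b = (P.re + τ * (Q.re - P.re)) / L := by
        rw [hmv]
        simp [vertexPoint, hab.symm]
      have hm₁ : m.1 r₁ = 0 := hm r₁ (by simp [ha₁.symm, hb₁.symm])
      have hX : develop Z m.1 = P + τ • (Q - P) := by
        rw [d₁ m (e₁ hm), hmb, hm₁, Complex.ofReal_zero, zero_mul, add_zero, ← Complex.ofReal_mul,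
          div_mul_cancel₀ _ hpos.ne']
        apply Complex.ext
        · simp
        · simp only [Complex.ofReal_im, Complex.add_im, Complex.real_smul, Complex.im_ofReal_mul,
            Complex.sub_im]
          exact hτ0.symm
      refine (hσ.tri w m w').trans (le_of_eq ?_)
      rw [pathDist_eq_cellDist hσ hs₁ hw₁ (e₁ hm),
        pathDist_eq_cellDist hσ hs₂ (e₂ hm) hw₂, hc₁.cellDist_eq hw₁ (e₁ hm),
        hc₂.cellDist_eq (e₂ hm) hw₂, hX, ← hP, ← hQ,
        show P - (P + τ • (Q - P)) = τ • (P - Q) by module,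
        show P + τ • (Q - P) - Q = (1 - τ) • (P - Q) by module, norm_smul, norm_smul,
        Real.norm_eq_abs, Real.norm_eq_abs, abs_of_nonneg hτ.1, abs_of_nonneg (by linarith [hτ.2])]
      ring
  refine ⟨ρ, hρ, fun w => develop Z w.1, fun w _ w' _ hw hw' => ?_⟩
  simp only [dist_eq_norm]
  rcases hmem w hw with h | h <;> rcases hmem w' hw' with h' | h'
  · rw [pathDist_eq_cellDist hσ hs₁ h h', hc₁.cellDist_eq h h']
  · exact cross w w' hw hw' h h'
  · rw [norm_sub_rev, cross w' w hw' hw h' h, pathDist_symm]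
  · rw [pathDist_eq_cellDist hσ hs₂ h h', hc₂.cellDist_eq h h']

/-- Three triangles cannot meet along an edge near a point where the region is flat. -/
theorem not_three_triangles_of_isFlatAt (hσ : CATMetric K.pathDist σ) {C : Set K.Point}
    {v y : K.Point} (hab : a ≠ b) {r : Fin 3 → V} (har : ∀ i, a ≠ r i) (hbr : ∀ i, b ≠ r i)
    (hr : Function.Injective r) (hs : ∀ i, ({a, b, r i} : Finset V) ∈ K.cells)
    (hv : v ∈ K.cell {a, b}) (hy : y ∈ K.openCell {a, b}) (hvy : v ≠ y)
    (hC : ∀ t : ℝ, 0 < t → t ≤ 1 → ∃ ρ > 0, ∀ w, K.pathDist (σ v y t) w < ρ → w ∈ C)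
    (hflat : K.IsFlatAt C v) : False := by
  obtain ⟨R, hR, ψ, hψ⟩ := hflat
  have he : ({a, b} : Finset V) ∈ K.cells := K.down_closed _ (hs 0) _ (by
    intro v; simp only [Finset.mem_insert, Finset.mem_singleton]; tauto)
  have hd := hσ.pos hvy
  set t := min 1 (R / (2 * K.pathDist v y)) with ht
  have ht0 : 0 < t := lt_min one_pos (by positivity)
  have ht1 : t ≤ 1 := min_le_left _ _
  have htR : t * K.pathDist v y ≤ R / 2 := by
    have h1 : t ≤ R / (2 * K.pathDist v y) := min_le_right _ _
    rw [le_div_iff₀ (by positivity)] at h1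
    linarith
  have htI : t ∈ Icc (0 : ℝ) 1 := ⟨ht0.le, ht1⟩
  have htI' : t / 2 ∈ Icc (0 : ℝ) 1 := ⟨by linarith, by linarith⟩
  have hO : σ v y t ∈ K.openCell {a, b} := by
    refine ⟨seg_mem_cell hσ he hv hy.1 htI, fun x hx => ?_⟩
    rw [seg_val hσ he hv hy.1 htI]
    simp only [Pi.add_apply, Pi.smul_apply, Pi.sub_apply, smul_eq_mul]
    have := mul_pos ht0 (hy.2 x hx)
    have := mul_nonneg (sub_nonneg.2 ht1) (v.2.1 x)
    linarith
  have hO' := seg_mem_cell hσ he hv hy.1 htI'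
  have dO := hσ.dist_left v y htI
  have dO' := hσ.dist_left v y htI'
  have hdd := hσ.seg v y _ htI' _ htI
  rw [abs_sub_comm, abs_of_pos (by linarith)] at hdd
  obtain ⟨ρ, hρ, hOC⟩ := hC t ht0 ht1
  obtain ⟨ρ', hρ', hOC'⟩ := hC (t / 2) (by linarith) (by linarith)
  set O := σ v y t
  set O' := σ v y (t / 2)
  have mO : O ∈ C := hOC O (by rwa [hσ.self])
  have mO' : O' ∈ C := hOC' O' (by rwa [hσ.self])
  choose η₀ hη₀ H using fun i => exists_perp (hs i) hab (har i) (hbr i) hO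
  set η := min (min (η₀ 0) (min (η₀ 1) (η₀ 2))) (min (ρ / 2) (R / 4)) with hη
  have hη0 : 0 < η := lt_min (lt_min (hη₀ 0) (lt_min (hη₀ 1) (hη₀ 2))) (by positivity)
  have hηρ : η < ρ := by
    have : η ≤ ρ / 2 := (min_le_right _ _).trans (min_le_left _ _)
    linarith
  have hηR : η ≤ R / 4 := (min_le_right _ _).trans (min_le_right _ _)
  have hηi : ∀ i, η ≤ η₀ i := by
    intro i
    have h0 : η ≤ min (η₀ 0) (min (η₀ 1) (η₀ 2)) := min_le_left _ _
    rw [le_min_iff, le_min_iff] at h0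
    fin_cases i
    exacts [h0.1, h0.2.1, h0.2.2]
  choose x hx hxr hxd using fun i => H i η hη0 (hηi i)
  have hsub : ∀ i, K.cell ({a, b} : Finset V) ⊆ K.cell {a, b, r i} := fun i => cell_mono (by
    intro v; simp only [Finset.mem_insert, Finset.mem_singleton]; tauto)
  have D : ∀ i, ∀ Q ∈ K.cell ({a, b} : Finset V),
      K.pathDist Q (x i) ^ 2 = K.pathDist Q O ^ 2 + η ^ 2 := fun i Q hQ => by
    rw [pathDist_eq_cellDist hσ (hs i) (hsub i hQ) (hx i), pathDist_eq_cellDist hσ he hQ hO.1]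
    exact hxd i Q hQ
  have D0 : ∀ i, K.pathDist O (x i) = η := fun i => by
    have := D i O hO.1
    rw [hσ.self] at this
    rw [← sq_eq_sq₀ (hσ.nonneg _ _) hη0.le]; linarith
  have D1 : ∀ i j, K.pathDist O' (x i) = K.pathDist O' (x j) := fun i j => by
    rw [← sq_eq_sq₀ (hσ.nonneg _ _) (hσ.nonneg _ _), D i O' hO', D j O' hO']
  have xC : ∀ i, x i ∈ C := fun i => hOC _ (by rw [D0]; exact hηρ)
  have xR : ∀ i, K.pathDist v (x i) < R := fun i => by
    have := hσ.tri v O (x i)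
    rw [D0] at this
    linarith
  have OR : K.pathDist v O < R := by linarith
  have OR' : K.pathDist v O' < R := by rw [dO']; linarith
  have hcO : ψ O ≠ ψ O' := by
    intro e
    have := hψ O mO O' mO' OR OR'
    rw [e, dist_self, hσ.comm, hdd] at this
    have := mul_pos (show 0 < t - t / 2 by linarith) hd
    linarith
  have hne : ∀ i j, i ≠ j → ψ (x i) ≠ ψ (x j) := by
    intro i j hij e
    have := hψ _ (xC i) _ (xC j) (xR i) (xR j)
    rw [e, dist_self] at this
    have e2 := hσ.eq_of _ _ this.symm
    have h1 := hxr i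
    rw [e2, hx j (r i) (by
      simp only [Finset.mem_insert, Finset.mem_singleton, not_or]
      exact ⟨(har i).symm, (hbr i).symm, fun h => hij (hr h)⟩)] at h1
    exact lt_irrefl _ h1
  have E0 : ∀ i, dist (ψ (x i)) (ψ O) = η := fun i => by
    rw [hψ _ (xC i) _ mO (xR i) OR, hσ.comm, D0]
  have E1 : ∀ i, dist (ψ (x i)) (ψ O') = K.pathDist O' (x 0) := fun i => by
    rw [hψ _ (xC i) _ mO' (xR i) OR', hσ.comm, D1 i 0]
  -- The three points `x i` have equal distances to `O` and equal distances to `O'`; two circles in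
  -- the plane meet in at most two points.
  rcases EuclideanGeometry.eq_of_dist_eq_of_dist_eq_of_finrank_eq_two
    (by exact Complex.finrank_real_complex) hcO (hne 0 1 (by decide)) (E0 0) (E0 1) (E0 2) (E1 0)
    (E1 1) (E1 2) with h | h
  · exact hne 2 0 (by decide) h
  · exact hne 2 1 (by decide) h

end Triangle

theorem vertexPoint_self (v : V) (hv : ({v} : Finset V) ∈ K.cells) :
    (vertexPoint v hv).1 v = 1 := isVertexAt_vertexPoint hv

theorem vertexPoint_of_ne {v x : V} (hv : ({v} : Finset V) ∈ K.cells) (h : x ≠ v) :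
    (vertexPoint v hv).1 x = 0 :=
  vertexPoint_mem_cell hv (Finset.mem_singleton_self v) x (by simpa using h)

theorem cell_of_edge [DecidableEq V] {a b : V} (hab : a ≠ b) {s : Finset V} (hs : s ∈ K.cells)
    (h : {a, b} ⊆ s) : s = {a, b} ∨ ∃ r, a ≠ r ∧ b ≠ r ∧ s = {a, b, r} := by
  by_cases hne : s = {a, b}
  · exact Or.inl hne
  right
  obtain ⟨r, hrs, hr⟩ := Finset.exists_of_ssubset (lt_of_le_of_ne h (Ne.symm hne))
  simp only [Finset.mem_insert, Finset.mem_singleton, not_or] at hr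
  refine ⟨r, Ne.symm hr.1, Ne.symm hr.2, (Finset.eq_of_subset_of_card_le ?_ ?_).symm⟩
  · intro x hx
    simp only [Finset.mem_insert, Finset.mem_singleton] at hx
    rcases hx with rfl | rfl | rfl
    · exact h (by simp)
    · exact h (by simp)
    · exact hrs
  · rw [Finset.card_eq_three.2 ⟨a, b, r, hab, Ne.symm hr.1, Ne.symm hr.2, rfl⟩]
    exact K.card_le s hs

theorem mem_geod_of_mem_geod (hσ : CATMetric K.pathDist σ) {z p a b y : K.Point}
    (ha : a ∈ K.geod z p) (hb : b ∈ K.geod z p) (hy : y ∈ K.geod a b) : y ∈ K.geod z p := by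
  wlog hle : K.pathDist z a ≤ K.pathDist z b generalizing a b
  · exact this hb ha (by rwa [geod_symm]) (le_of_not_ge hle)
  have h1 : K.pathDist z a + K.pathDist a b = K.pathDist z b := hσ.between_linear hb ha hle
  have hb' : K.pathDist z b + K.pathDist b p = K.pathDist z p := hb
  have hy' : K.pathDist a y + K.pathDist y b = K.pathDist a b := hy
  change K.pathDist z y + K.pathDist y p = K.pathDist z p
  linarith [hσ.tri z a y, hσ.tri y b p, hσ.tri z y p]

/-- A region bounded by two geodesics that is a proper sector at its apex and straight along the
two sides. -/
structure IsStraightCone (K : TriangleComplex V) (z p q : K.Point) (C : Set K.Point) : Prop where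
  region : K.IsConeRegion z p q C
  sector : ∃ u ya yb, K.IsSector z p q C u ya yb
  left : ∀ v ∈ K.geod z p, v ≠ z → v ≠ p →
    K.HasInnerAngle C v (K.geod v z) (K.geod v p) Real.pi
  right : ∀ v ∈ K.geod z q, v ≠ z → v ≠ q →
    K.HasInnerAngle C v (K.geod v z) (K.geod v q) Real.pi

theorem IsSector.symm {z p q ya yb : K.Point} {C : Set K.Point} {u : Finset V}
    (h : K.IsSector z p q C u ya yb) : K.IsSector z q p C u yb ya where
  cell_mem := h.cell_mem
  apex_mem := h.apex_mem
  left_mem := h.right_mem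
  right_mem := h.left_mem
  left_side := h.right_side
  right_side := h.left_side
  indep := LinearIndependent.pair_symm_iff.1 h.indep
  mem_region w l m hl hm hlm e := h.mem_region w m l hm hl (by linarith) (by rw [e, add_comm])
  of_near := by
    obtain ⟨ρ, hρ, H⟩ := h.of_near
    refine ⟨ρ, hρ, fun w hw hd => ?_⟩
    obtain ⟨l, m, hl, hm, hlm, e⟩ := H w hw hd
    exact ⟨m, l, hm, hl, by linarith, by rw [e, add_comm]⟩

theorem IsSector.left_ne {z p q ya yb : K.Point} {C : Set K.Point} {u : Finset V}
    (h : K.IsSector z p q C u ya yb) : ya ≠ z := by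
  rintro rfl
  have := h.indep.ne_zero 0
  simp at this

theorem IsSector.right_ne {z p q ya yb : K.Point} {C : Set K.Point} {u : Finset V}
    (h : K.IsSector z p q C u ya yb) : yb ≠ z := h.symm.left_ne

namespace IsStraightCone

variable {z p q : K.Point} {C : Set K.Point}

theorem symm (H : K.IsStraightCone z p q C) : K.IsStraightCone z q p C where
  region := H.region.symm
  sector := by
    obtain ⟨u, ya, yb, h⟩ := H.sector
    exact ⟨u, yb, ya, h.symm⟩
  left := H.right
  right := H.left

variable (H : K.IsStraightCone z p q C) (hσ : CATMetric K.pathDist σ)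

include H hσ

/-- If the sides shared a further point, they would share their beginning, against the independence
of their directions. -/
theorem eq_apex {y : K.Point} (hp : y ∈ K.geod z p) (hq : y ∈ K.geod z q) : y = z := by
  by_contra hne
  obtain ⟨u, ya, yb, S⟩ := H.sector
  obtain ⟨r, hr, hball⟩ := exists_ball_common_cell hσ z
  have hd := hσ.pos (Ne.symm hne)
  set t := min 1 (r / (2 * K.pathDist z y)) with ht
  have ht0 : 0 < t := lt_min one_pos (by positivity)
  have htI : t ∈ Icc (0 : ℝ) 1 := ⟨ht0.le, min_le_left _ _⟩
  have htr : t * K.pathDist z y < r := by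
    have h1 : t ≤ r / (2 * K.pathDist z y) := min_le_right _ _
    rw [le_div_iff₀ (by positivity)] at h1
    linarith
  have hdt := hσ.dist_left z y htI
  obtain ⟨s, hs, hzs, hys⟩ := hball _ (by rw [hdt]; exact htr)
  have hyne : σ z y t ≠ z := by
    intro e
    rw [e, hσ.self] at hdt
    have := mul_pos ht0 hd
    linarith
  have m1 := hσ.between_of_between hp (hσ.between_seg z y htI)
  have m2 := hσ.between_of_between hq (hσ.between_seg z y htI)
  obtain ⟨c, hc, e⟩ := geod_direction hσ S.cell_mem hs S.apex_mem hzs S.left_mem hys S.left_side m1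
    S.left_ne hyne
  obtain ⟨c', hc', e'⟩ := geod_direction hσ S.cell_mem hs S.apex_mem hzs S.right_mem hys
    S.right_side m2 S.right_ne hyne
  have := (LinearIndependent.pair_iff.1 S.indep c (-c') (by rw [← e, neg_smul, ← e']; abel)).1
  linarith

theorem isFlatAt_apex : K.IsFlatAt C z := by
  obtain ⟨u, ya, yb, S⟩ := H.sector
  obtain ⟨ρ, hρ, hnear⟩ := S.of_near
  refine isFlatAt_of_cell hσ S.cell_mem ⟨ρ, hρ, fun w hw hd => ?_⟩
  obtain ⟨l, m, -, -, -, e⟩ := hnear w hw hd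
  intro v hv
  have := congrFun e v
  simp only [Pi.sub_apply, Pi.add_apply, Pi.smul_apply, S.apex_mem v hv, S.left_mem v hv,
    S.right_mem v hv, sub_zero, smul_zero, add_zero] at this
  exact this

theorem exists_halfDisc_left {v : K.Point} (hv : v ∈ K.geod z p) (hz : v ≠ z) (hp : v ≠ p) :
    ∃ r > 0, ∃ ψ : K.Point → ℂ, ∀ w ∈ C, ∀ w' ∈ C, K.pathDist v w < r → K.pathDist v w' < r →
      dist (ψ w) (ψ w') = K.pathDist w w' ∧ ∀ t ∈ Icc (0 : ℝ) 1, σ w w' t ∈ C :=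
  exists_halfDisc hσ hv (H.left v hv hz hp)

theorem isFlatAt_left {v : K.Point} (hv : v ∈ K.geod z p) (hz : v ≠ z) (hp : v ≠ p) :
    K.IsFlatAt C v := by
  obtain ⟨r, hr, ψ, h⟩ := H.exists_halfDisc_left hσ hv hz hp
  exact ⟨r, hr, ψ, fun w hw w' hw' h1 h2 => (h w hw w' hw' h1 h2).1⟩

/-- If one of the points where the edge meets the two sides is not an end `p` or `q`, the region is
flat there, which excludes three triangles. If they are `p` and `q`, the sides must enter all three
triangles, hence one side enters two of them. -/
theorem not_three_triangles_aux [DecidableEq V] {a b : V} (hab : a ≠ b) {r : Fin 3 → V}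
    (har : ∀ i, a ≠ r i) (hbr : ∀ i, b ≠ r i) (hr : Function.Injective r)
    (hs : ∀ i, ({a, b, r i} : Finset V) ∈ K.cells) {y : K.Point} (hy : y ∈ K.openCell {a, b})
    (hyC : y ∈ C) (hyS : y ∉ K.geod z p ∪ K.geod z q) {y₁ y₂ : K.Point}
    (h₁ : y₁ ∈ K.geod z p) (h₂ : y₂ ∈ K.geod z q) (hc₁ : y₁ ∈ K.cell {a, b})
    (hc₂ : y₂ ∈ K.cell {a, b}) (hbet : y ∈ K.geod y₁ y₂)
    (hC₁ : ∀ t : ℝ, 0 < t → t ≤ 1 → σ y₁ y t ∈ C ∧ σ y₁ y t ∉ K.geod z p ∪ K.geod z q)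
    (hC₂ : ∀ t : ℝ, 0 < t → t ≤ 1 → σ y₂ y t ∈ C ∧ σ y₂ y t ∉ K.geod z p ∪ K.geod z q) :
    False := by
  have hball : ∀ {v : K.Point}, (∀ t : ℝ, 0 < t → t ≤ 1 →
      σ v y t ∈ C ∧ σ v y t ∉ K.geod z p ∪ K.geod z q) → ∀ t : ℝ, 0 < t → t ≤ 1 →
      ∃ ρ > 0, ∀ w, K.pathDist (σ v y t) w < ρ → w ∈ C := by
    intro v hv t h0 h1
    obtain ⟨ρ, hρ, h⟩ := H.region.exists_ball hσ (hv t h0 h1).1 (hv t h0 h1).2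
    exact ⟨ρ, hρ, fun w hw => (h w hw).1⟩
  have hz₁ : y₁ ≠ z := by
    rintro rfl
    exact hyS (Or.inr (mem_geod_of_mem_geod hσ (left_mem_geod _ _) h₂ hbet))
  have hz₂ : y₂ ≠ z := by
    rintro rfl
    exact hyS (Or.inl (mem_geod_of_mem_geod hσ h₁ (left_mem_geod _ _) hbet))
  have hy₁ : y₁ ≠ y := by rintro rfl; exact hyS (Or.inl h₁)
  have hy₂ : y₂ ≠ y := by rintro rfl; exact hyS (Or.inr h₂)
  by_cases hp : y₁ = p
  swap
  · exact not_three_triangles_of_isFlatAt hσ hab har hbr hr hs hc₁ hy hy₁ (hball hC₁)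
      (H.isFlatAt_left hσ h₁ hz₁ hp)
  by_cases hq : y₂ = q
  swap
  · exact not_three_triangles_of_isFlatAt hσ hab har hbr hr hs hc₂ hy hy₂ (hball hC₂)
      (H.symm.isFlatAt_left hσ h₂ hz₂ hq)
  subst hp hq
  have hsub : ∀ i, K.cell ({a, b} : Finset V) ⊆ K.cell {a, b, r i} := fun i => cell_mono (by
    intro v; simp only [Finset.mem_insert, Finset.mem_singleton]; tauto)
  -- the sides meet all three triangles
  have hit : ∀ i, ∃ w ∈ K.geod z y₁ ∪ K.geod z y₂, w ∈ K.cell {a, b, r i} ∧ 0 < w.1 (r i) := by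
    intro i
    have hri : r i ∈ ({a, b, r i} : Finset V) := by simp
    have hv := singleton_mem (hs i) hri
    obtain ⟨t, ht0, ht1, htS, -⟩ := H.region.first_hit_vertex hσ hyC hyS hv
    have htI : t ∈ Icc (0 : ℝ) 1 := ⟨ht0.le, ht1⟩
    refine ⟨_, htS, seg_mem_cell hσ (hs i) (hsub i hy.1) (vertexPoint_mem_cell hv hri) htI, ?_⟩
    rw [seg_val hσ (hs i) (hsub i hy.1) (vertexPoint_mem_cell hv hri) htI]
    have h0 : y.1 (r i) = 0 := hy.1 _ (by simp [(har i).symm, (hbr i).symm])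
    simp [vertexPoint, h0, ht0]
  choose w hwS hwc hw using hit
  -- A geodesic that ends on the edge and has entered one of the triangles remains in it, since
  -- cells are convex; so it cannot later visit the inside of another.
  have key : ∀ P ∈ K.cell ({a, b} : Finset V), ∀ i j, i ≠ j → w i ∈ K.geod z P →
      w j ∈ K.geod z P → False := by
    intro P hP i j hij hi hj
    wlog hle : K.pathDist z (w i) ≤ K.pathDist z (w j) generalizing i j
    · exact this j i hij.symm hj hi (le_of_not_ge hle)
    have h1 : K.pathDist z (w i) + K.pathDist (w i) (w j) = K.pathDist z (w j) :=
      hσ.between_linear hj hi hle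
    have h2 : K.pathDist z (w i) + K.pathDist (w i) P = K.pathDist z P := hi
    have h3 : K.pathDist z (w j) + K.pathDist (w j) P = K.pathDist z P := hj
    have h4 : w j ∈ K.geod (w i) P := by
      change K.pathDist (w i) (w j) + K.pathDist (w j) P = K.pathDist (w i) P
      linarith
    obtain ⟨t, ht, e⟩ := (mem_geod_iff hσ).1 h4
    have h5 := seg_mem_cell hσ (hs i) (hwc i) (hsub i hP) ht
    rw [← e] at h5
    have h6 := h5 (r j) (by
      simp only [Finset.mem_insert, Finset.mem_singleton, not_or]
      exact ⟨(har j).symm, (hbr j).symm, fun h => hij (hr h).symm⟩)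
    exact (hw j).ne' h6
  have k₁ := key _ hc₁
  have k₂ := key _ hc₂
  rcases hwS 0 with h0 | h0 <;> rcases hwS 1 with h1 | h1 <;> rcases hwS 2 with h2 | h2
  all_goals
    first
    | exact k₁ 0 1 (by decide) h0 h1
    | exact k₁ 0 2 (by decide) h0 h2
    | exact k₁ 1 2 (by decide) h1 h2
    | exact k₂ 0 1 (by decide) h0 h1
    | exact k₂ 0 2 (by decide) h0 h2
    | exact k₂ 1 2 (by decide) h1 h2

/-- Walking from `y` along the edge in both directions leads to points of the sides. They cannot be
on the same side, because then `y` would lie on it. -/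
theorem not_three_triangles [DecidableEq V] {a b : V} (hab : a ≠ b) {r : Fin 3 → V}
    (har : ∀ i, a ≠ r i) (hbr : ∀ i, b ≠ r i) (hr : Function.Injective r)
    (hs : ∀ i, ({a, b, r i} : Finset V) ∈ K.cells) {y : K.Point} (hy : y ∈ K.openCell {a, b})
    (hyC : y ∈ C) (hyS : y ∉ K.geod z p ∪ K.geod z q) : False := by
  have he : ({a, b} : Finset V) ∈ K.cells := K.down_closed _ (hs 0) _ (by
    intro v; simp only [Finset.mem_insert, Finset.mem_singleton]; tauto)
  have ma : a ∈ ({a, b} : Finset V) := by simp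
  have mb : b ∈ ({a, b} : Finset V) := by simp
  have hva := singleton_mem he ma
  have hvb := singleton_mem he mb
  have rev : ∀ (x : K.Point) (t : ℝ), 0 < t → t ≤ 1 → (∀ s, 0 ≤ s → s < t →
      σ y x s ∈ C ∧ σ y x s ∉ K.geod z p ∪ K.geod z q) → ∀ s : ℝ, 0 < s → s ≤ 1 →
      σ (σ y x t) y s ∈ C ∧ σ (σ y x t) y s ∉ K.geod z p ∪ K.geod z q := by
    intro x t ht0 ht1 h s hs0 hs1
    have hsI : 1 - s ∈ Icc (0 : ℝ) 1 := ⟨by linarith, by linarith⟩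
    have e := hσ.seg_symm y (σ y x t) hsI
    rw [sub_sub_cancel, hσ.seg_seg y x ⟨ht0.le, ht1⟩ hsI] at e
    rw [e]
    exact h _ (mul_nonneg hsI.1 ht0.le) (by nlinarith)
  obtain ⟨t₁, h10, h11, h1S, h1lt⟩ := H.region.first_hit_vertex hσ hyC hyS hva
  obtain ⟨t₂, h20, h21, h2S, h2lt⟩ := H.region.first_hit_vertex hσ hyC hyS hvb
  have ca := vertexPoint_mem_cell hva ma
  have cb := vertexPoint_mem_cell hvb mb
  have I₁ : t₁ ∈ Icc (0 : ℝ) 1 := ⟨h10.le, h11⟩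
  have I₂ : t₂ ∈ Icc (0 : ℝ) 1 := ⟨h20.le, h21⟩
  have c₁ := seg_mem_cell hσ he hy.1 ca I₁
  have c₂ := seg_mem_cell hσ he hy.1 cb I₂
  have v₁ := seg_val hσ he hy.1 ca I₁
  have v₂ := seg_val hσ he hy.1 cb I₂
  have R₁ := rev _ t₁ h10 h11 h1lt
  have R₂ := rev _ t₂ h20 h21 h2lt
  set y₁ := σ y (vertexPoint a hva) t₁
  set y₂ := σ y (vertexPoint b hvb) t₂
  have hsum : y.1 a + y.1 b = 1 := by
    have := y.2.2.1
    rwa [← Finset.sum_subset (Finset.subset_univ {a, b}) (fun v _ hv => hy.1 v hv),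
      Finset.sum_pair hab] at this
  have hya := hy.2 a ma
  have hyb := hy.2 b mb
  have hbet : y ∈ K.geod y₁ y₂ := by
    rw [mem_geod_iff hσ]
    -- `y₁ - y = t₁ y_b (e_a - e_b)` and `y₂ - y = t₂ y_a (e_b - e_a)`
    have hD : 0 < t₁ * y.1 b + t₂ * y.1 a := by positivity
    have hI : t₁ * y.1 b / (t₁ * y.1 b + t₂ * y.1 a) ∈ Icc (0 : ℝ) 1 :=
      ⟨by positivity, by rw [div_le_one hD]; nlinarith⟩
    refine ⟨_, hI, Subtype.ext ?_⟩
    rw [seg_val hσ he c₁ c₂ hI, v₁, v₂]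
    have hk := div_mul_cancel₀ (t₁ * y.1 b) hD.ne'
    set k := t₁ * y.1 b / (t₁ * y.1 b + t₂ * y.1 a)
    have ea : y.1 a = 1 - y.1 b := by linarith
    funext x
    simp only [Pi.add_apply, Pi.smul_apply, Pi.sub_apply, smul_eq_mul]
    by_cases hxa : x = a
    · subst hxa
      rw [vertexPoint_self, vertexPoint_of_ne hvb hab, ea]
      rw [ea] at hk
      linarith
    · by_cases hxb : x = b
      · subst hxb
        rw [vertexPoint_self, vertexPoint_of_ne hva hxa]
        rw [ea] at hk
        linarith
      · rw [vertexPoint_of_ne hva hxa, vertexPoint_of_ne hvb hxb, hy.1 x (by simp [hxa, hxb])]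
        ring
  rcases h1S with h1 | h1 <;> rcases h2S with h2 | h2
  · exact hyS (Or.inl (mem_geod_of_mem_geod hσ h1 h2 hbet))
  · exact H.not_three_triangles_aux hσ hab har hbr hr hs hy hyC hyS h1 h2 c₁ c₂ hbet R₁ R₂
  · rw [union_comm] at hyS
    simp only [union_comm (K.geod z p)] at R₁ R₂
    exact H.symm.not_three_triangles_aux hσ hab har hbr hr hs hy hyC hyS h1 h2 c₁ c₂ hbet R₁ R₂
  · exact hyS (Or.inr (mem_geod_of_mem_geod hσ h1 h2 hbet))

/-- The point is not a vertex, so it lies in an open triangle or in an open edge; by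
`not_three_triangles` such an edge is in at most two triangles. -/
theorem isFlatAt_interior {y : K.Point} (hyC : y ∈ C) (hyS : y ∉ K.geod z p ∪ K.geod z q) :
    K.IsFlatAt C y := by
  classical
  obtain ⟨t, ht, hyt, hmin⟩ := exists_support y
  have one : ∀ s ∈ K.cells, (∀ s' ∈ K.cells, t ⊆ s' → s' ⊆ s) → K.IsFlatAt C y := by
    intro s hs h
    obtain ⟨r, hr, hball⟩ := exists_ball_common_cell hσ y
    refine isFlatAt_of_cell hσ hs ⟨r, hr, fun w _ hd => ?_⟩
    obtain ⟨s', hs', hys', hws'⟩ := hball w hd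
    exact cell_mono (h s' hs' (hmin s' hs' hys')) hws'
  have hsum : ∑ v ∈ t, y.1 v = 1 := by
    have := y.2.2.1
    rwa [← Finset.sum_subset (Finset.subset_univ t) (fun v _ hv => hyt.1 v hv)] at this
  have hcard := K.card_le t ht
  interval_cases hc : t.card
  · rw [Finset.card_eq_zero] at hc
    rw [hc] at hsum
    simp at hsum
  · obtain ⟨v, rfl⟩ := Finset.card_eq_one.1 hc
    rw [Finset.sum_singleton] at hsum
    exact (hyS (H.region.vertex v y hsum hyC)).elim
  · obtain ⟨a, b, hab, rfl⟩ := Finset.card_eq_two.1 hc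
    by_cases h1 : ∃ r₁, a ≠ r₁ ∧ b ≠ r₁ ∧ ({a, b, r₁} : Finset V) ∈ K.cells
    swap
    · refine one _ ht fun s' hs' hts' => ?_
      rcases cell_of_edge hab hs' hts' with rfl | ⟨r, h1', h2', rfl⟩
      · exact subset_rfl
      · exact (h1 ⟨r, h1', h2', hs'⟩).elim
    obtain ⟨r₁, ha₁, hb₁, hs₁⟩ := h1
    by_cases h2 : ∃ r₂, r₁ ≠ r₂ ∧ a ≠ r₂ ∧ b ≠ r₂ ∧ ({a, b, r₂} : Finset V) ∈ K.cells
    swap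
    · refine one _ hs₁ fun s' hs' hts' => ?_
      rcases cell_of_edge hab hs' hts' with rfl | ⟨r, h1', h2', rfl⟩
      · intro v; simp only [Finset.mem_insert, Finset.mem_singleton]; tauto
      · by_cases h : r₁ = r
        · rw [h]
        · exact (h2 ⟨r, h, h1', h2', hs'⟩).elim
    obtain ⟨r₂, h₁₂, ha₂, hb₂, hs₂⟩ := h2
    refine isFlatAt_of_two_triangles hσ C hab ha₁ hb₁ ha₂ hb₂ h₁₂ hs₁ hs₂ hyt fun s hs hys => ?_
    rcases cell_of_edge hab hs (hmin s hs hys) with rfl | ⟨r, har, hbr, rfl⟩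
    · left
      intro v; simp only [Finset.mem_insert, Finset.mem_singleton]; tauto
    · by_cases e1 : r = r₁
      · left; rw [e1]
      by_cases e2 : r = r₂
      · right; rw [e2]
      exfalso
      refine H.not_three_triangles hσ hab (r := ![r, r₁, r₂]) ?_ ?_ ?_ ?_ hyt hyC hyS
      · intro i; fin_cases i <;> assumption
      · intro i; fin_cases i <;> assumption
      · intro i j hij
        fin_cases i <;> fin_cases j <;> simp_all
      · intro i; fin_cases i <;> assumption
  · refine one t ht fun s' hs' hts' => ?_
    rw [Finset.eq_of_subset_of_card_le hts' (by rw [hc]; exact K.card_le s' hs')]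

theorem isFlatAt {y : K.Point} (hyC : y ∈ C) (hp : y ≠ p) (hq : y ≠ q) : K.IsFlatAt C y := by
  by_cases hz : y = z
  · rw [hz]; exact H.isFlatAt_apex hσ
  by_cases hyS : y ∈ K.geod z p ∪ K.geod z q
  · rcases hyS with h | h
    · exact H.isFlatAt_left hσ h hz hp
    · exact H.symm.isFlatAt_left hσ h hz hq
  · exact H.isFlatAt_interior hσ hyC hyS

theorem exists_convex_ball {y : K.Point} (hyC : y ∈ C) (hp : y ≠ p) (hq : y ≠ q) :
    ∃ r > 0, ∀ a ∈ C, ∀ b ∈ C, K.pathDist y a < r → K.pathDist y b < r →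
      ∀ t ∈ Icc (0 : ℝ) 1, σ a b t ∈ C := by
  by_cases hz : y = z
  · subst hz
    obtain ⟨u, ya, yb, S⟩ := H.sector
    obtain ⟨ρ, hρ, hnear⟩ := S.of_near
    refine ⟨ρ, hρ, fun w hw w' hw' hd hd' t ht => ?_⟩
    have hcell : ∀ w : K.Point, ∀ l m : ℝ, w.1 - y.1 = l • (ya.1 - y.1) + m • (yb.1 - y.1) →
        w ∈ K.cell u := by
      intro w l m e v hv
      have := congrFun e v
      simp only [Pi.sub_apply, Pi.add_apply, Pi.smul_apply, S.apex_mem v hv, S.left_mem v hv,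
        S.right_mem v hv, sub_zero, smul_zero, add_zero] at this
      exact this
    obtain ⟨l, m, hl, hm, hlm, e⟩ := hnear w hw hd
    obtain ⟨l', m', hl', hm', hlm', e'⟩ := hnear w' hw' hd'
    have t0 := ht.1
    have t1 : 0 ≤ 1 - t := by linarith [ht.2]
    refine S.mem_region _ ((1 - t) * l + t * l') ((1 - t) * m + t * m') (by positivity)
      (by positivity) (by nlinarith) ?_
    rw [seg_val hσ S.cell_mem (hcell _ _ _ e) (hcell _ _ _ e') ht]
    rw [sub_eq_iff_eq_add] at e e'
    rw [e, e']; module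
  by_cases hyS : y ∈ K.geod z p ∪ K.geod z q
  · rcases hyS with h | h
    · obtain ⟨r, hr, ψ, hψ⟩ := H.exists_halfDisc_left hσ h hz hp
      exact ⟨r, hr, fun a ha b hb h1 h2 => (hψ a ha b hb h1 h2).2⟩
    · obtain ⟨r, hr, ψ, hψ⟩ := H.symm.exists_halfDisc_left hσ h hz hq
      exact ⟨r, hr, fun a ha b hb h1 h2 => (hψ a ha b hb h1 h2).2⟩
  · obtain ⟨r, hr, h⟩ := H.region.exists_ball hσ hyC hyS
    exact ⟨r, hr, fun a _ b _ h1 h2 t ht => (h _ (hσ.ball_convex h1 h2 ht)).1⟩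

end IsStraightCone

/-! ### Sectors and angles -/

theorem IsFan.not_parallel (hσ : CATMetric K.pathDist σ) {C : Set K.Point} {v : K.Point} {n : ℕ}
    {c : ℕ → K.Point} (hF : K.IsFan C v n c) {i : ℕ} (hi : i < n)
    (hθ : 0 < triangleAngle (K.cellDist v (c i)) (K.cellDist v (c (i + 1)))
      (K.cellDist (c i) (c (i + 1)))) :
    LinearIndependent ℝ ![(c i).1 - v.1, (c (i + 1)).1 - v.1] := by
  obtain ⟨s, hs, hv, h1, h2⟩ := (hF.2.1 i hi).1
  have hcross : 0 < Complex.cross (fanImage v c i) (fanImage v c (i + 1)) := by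
    rw [cross_fanImage, fanArg_succ_sub]
    exact mul_pos (mul_pos (hF.cellDist_pos hσ hi.le (by omega)) (hF.cellDist_pos hσ hi (by omega)))
      (Real.sin_pos_of_pos_of_lt_pi hθ (hF.2.1 i hi).2.1)
  rw [LinearIndependent.pair_iff]
  intro l m e
  have h := hF.norm_eq hσ hi hs hv h1 h2 hv hv (l := l) (m := m) (by rw [e, sub_self])
  rw [hσ.self] at h
  have h0 := norm_eq_zero.1 h.symm
  have re := congrArg Complex.re h0
  have im := congrArg Complex.im h0
  simp only [Complex.real_smul, Complex.add_re, Complex.add_im, Complex.re_ofReal_mul,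
    Complex.im_ofReal_mul, Complex.zero_re, Complex.zero_im] at re im
  rw [Complex.cross] at hcross
  constructor
  · have : l * ((fanImage v c i).re * (fanImage v c (i + 1)).im -
      (fanImage v c i).im * (fanImage v c (i + 1)).re) = 0 := by
      linear_combination (fanImage v c (i + 1)).im * re - (fanImage v c (i + 1)).re * im
    exact (mul_eq_zero.1 this).resolve_right hcross.ne'
  · have : m * ((fanImage v c i).re * (fanImage v c (i + 1)).im -
      (fanImage v c i).im * (fanImage v c (i + 1)).re) = 0 := by
      linear_combination (fanImage v c i).re * im - (fanImage v c i).im * re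
    exact (mul_eq_zero.1 this).resolve_right hcross.ne'

/-- A positive angle sum requires a nondegenerate triangle in the fan. It contains three points in
pairwise different directions from `z`, and the two sides can start in at most two of them; the
third direction points inside. -/
theorem IsConeRegion.exists_sector_of_angle (hσ : CATMetric K.pathDist σ) {z p q : K.Point}
    {C : Set K.Point} (H : K.IsConeRegion z p q C) {α : ℝ} (hα : 0 < α)
    (h : K.HasInnerAngle C z (K.geod z p) (K.geod z q) α) :
    ∃ u ya yb, K.IsSector z p q C u ya yb := by
  obtain ⟨n, c, hF, -, -, hsum⟩ := h.1
  rw [hsum] at hα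
  obtain ⟨i, hi, hθ⟩ := Finset.exists_lt_of_sum_lt (f := fun _ => (0 : ℝ)) (by simpa using hα)
  rw [Finset.mem_range] at hi
  have hind := hF.not_parallel hσ hi hθ
  obtain ⟨s, hs, hv, h1, h2⟩ := (hF.2.1 i hi).1
  obtain ⟨w, hw, ew⟩ := exists_mem_smallTriangle hσ hs hv h1 h2 (l := 1 / 2) (m := 1 / 2)
    (by norm_num) (by norm_num) (by norm_num)
  have hpair := LinearIndependent.pair_iff.1 hind
  -- three points in pairwise different directions
  have hT := (hF.2.1 i hi).2.2
  have key : ∀ a : K.Point, a ∈ K.cell s → a ∈ C →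
      (∃ u ya yb, K.IsSector z p q C u ya yb) ∨
        ∃ t : ℝ, 0 < t ∧ t ≤ 1 ∧ σ z a t ∈ K.geod z p ∪ K.geod z q := by
    intro a has haC
    by_cases hr : ∃ t : ℝ, 0 < t ∧ t ≤ 1 ∧ σ z a t ∈ K.geod z p ∪ K.geod z q
    · exact Or.inr hr
    · push Not at hr
      exact Or.inl (H.exists_sector hσ hs hv has haC hr)
  have dir : ∀ (a b P : K.Point) (t t' : ℝ), a ∈ K.cell s → b ∈ K.cell s → a ≠ z → b ≠ z → 0 < t →
      t ≤ 1 → 0 < t' → t' ≤ 1 → σ z a t ∈ K.geod z P → σ z b t' ∈ K.geod z P →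
      ∃ k l : ℝ, 0 < k ∧ k • (b.1 - z.1) + l • (a.1 - z.1) = 0 := by
    intro a b P t t' ha hb haz hbz ht0 ht1 ht0' ht1' hP hP'
    have tI : t ∈ Icc (0 : ℝ) 1 := ⟨ht0.le, ht1⟩
    have tI' : t' ∈ Icc (0 : ℝ) 1 := ⟨ht0'.le, ht1'⟩
    have ne : ∀ (x : K.Point) (r : ℝ), r ∈ Icc (0 : ℝ) 1 → 0 < r → x ≠ z → σ z x r ≠ z := by
      intro x r hr hr0 hx e
      have := hσ.dist_left z x hr
      rw [e, hσ.self] at this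
      have := mul_pos hr0 (hσ.pos hx.symm)
      linarith
    obtain ⟨k, hk, e⟩ := geod_direction hσ hs hs hv hv (seg_mem_cell hσ hs hv ha tI)
      (seg_mem_cell hσ hs hv hb tI') hP hP' (ne a t tI ht0 haz) (ne b t' tI' ht0' hbz)
    rw [seg_val hσ hs hv ha tI, seg_val hσ hs hv hb tI', add_sub_cancel_left, add_sub_cancel_left]
      at e
    exact ⟨t', -(k * t), ht0', by rw [e]; module⟩
  have n1 := hF.1 i hi.le
  have n2 := hF.1 (i + 1) hi
  have ew' : w.1 - z.1 = (1 / 2 : ℝ) • ((c i).1 - z.1) + (1 / 2 : ℝ) • ((c (i + 1)).1 - z.1) := by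
    rw [ew, add_sub_cancel_left]
  have n3 : w ≠ z := by
    rintro rfl
    have := (hpair (1 / 2) (1 / 2) (by rw [← ew', sub_self])).1
    norm_num at this
  have q12 : ∀ k l : ℝ, 0 < k →
      k • ((c (i + 1)).1 - z.1) + l • ((c i).1 - z.1) ≠ 0 := by
    intro k l hk e
    exact hk.ne' (hpair l k (by rw [add_comm]; exact e)).2
  have q13 : ∀ k l : ℝ, 0 < k → k • (w.1 - z.1) + l • ((c i).1 - z.1) ≠ 0 := by
    intro k l hk e
    rw [ew'] at e
    have := (hpair (k / 2 + l) (k / 2) (by rw [← e]; module)).2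
    linarith
  have q23 : ∀ k l : ℝ, 0 < k → k • (w.1 - z.1) + l • ((c (i + 1)).1 - z.1) ≠ 0 := by
    intro k l hk e
    rw [ew'] at e
    have := (hpair (k / 2) (k / 2 + l) (by rw [← e]; module)).1
    linarith
  rcases key _ h1 (hT (mem_smallTriangle.2 ⟨1, 0, by simp, by simp, by simp, by simp⟩)) with
    h | ⟨t₁, a₁, b₁, m₁⟩
  · exact h
  rcases key _ h2 (hT (mem_smallTriangle.2 ⟨0, 1, by simp, by simp, by simp, by simp⟩)) with
    h | ⟨t₂, a₂, b₂, m₂⟩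
  · exact h
  rcases key _ hw (hT (mem_smallTriangle.2 ⟨1 / 2, 1 / 2, by norm_num, by norm_num, by norm_num,
    ew⟩)) with h | ⟨t₃, a₃, b₃, m₃⟩
  · exact h
  have r12 : ∀ P, σ z (c i) t₁ ∈ K.geod z P → σ z (c (i + 1)) t₂ ∈ K.geod z P → False := by
    intro P hP hP'
    obtain ⟨k, l, hk, e⟩ := dir _ _ P _ _ h1 h2 n1 n2 a₁ b₁ a₂ b₂ hP hP'
    exact q12 k l hk e
  have r13 : ∀ P, σ z (c i) t₁ ∈ K.geod z P → σ z w t₃ ∈ K.geod z P → False := by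
    intro P hP hP'
    obtain ⟨k, l, hk, e⟩ := dir _ _ P _ _ h1 hw n1 n3 a₁ b₁ a₃ b₃ hP hP'
    exact q13 k l hk e
  have r23 : ∀ P, σ z (c (i + 1)) t₂ ∈ K.geod z P → σ z w t₃ ∈ K.geod z P → False := by
    intro P hP hP'
    obtain ⟨k, l, hk, e⟩ := dir _ _ P _ _ h2 hw n2 n3 a₂ b₂ a₃ b₃ hP hP'
    exact q23 k l hk e
  exfalso
  rcases m₁ with m₁ | m₁ <;> rcases m₂ with m₂ | m₂ <;> rcases m₃ with m₃ | m₃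
  all_goals
    first
    | exact r12 _ m₁ m₂
    | exact r13 _ m₁ m₃
    | exact r23 _ m₂ m₃

/-- The images of the sides of a sector in a chart. -/
theorem IsSector.exists_chart {z p q ya yb : K.Point} {C : Set K.Point} {u : Finset V}
    (S : K.IsSector z p q C u ya yb) : ∃ Z : V → ℂ, K.IsChart u Z ∧
      Complex.cross (develop Z (ya.1 - z.1)) (develop Z (yb.1 - z.1)) ≠ 0 := by
  obtain ⟨Z, hZ, hinj⟩ := K.exists_chart S.cell_mem
  refine ⟨Z, hZ, fun h0 => ?_⟩
  have key : ∀ l m : ℝ, l • develop Z (ya.1 - z.1) + m • develop Z (yb.1 - z.1) = 0 →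
      l = 0 ∧ m = 0 := by
    intro l m e
    refine LinearIndependent.pair_iff.1 S.indep l m (hinj _ ?_ ?_ ?_)
    · intro v hv
      simp [S.apex_mem v hv, S.left_mem v hv, S.right_mem v hv]
    · simp [Finset.sum_add_distrib, ← Finset.mul_sum, Finset.sum_sub_distrib, ya.2.2.1, yb.2.2.1,
        z.2.2.1]
    · rw [develop_add, develop_smul, develop_smul, ← Complex.real_smul, ← Complex.real_smul, e]
  rw [Complex.cross] at h0
  set A := develop Z (ya.1 - z.1)
  set B := develop Z (yb.1 - z.1)
  have h1 := key B.im (-A.im) (by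
    apply Complex.ext
    · simp only [Complex.real_smul, Complex.add_re, Complex.re_ofReal_mul, Complex.zero_re]
      linarith
    · simp only [Complex.real_smul, Complex.add_im, Complex.im_ofReal_mul, Complex.zero_im]
      ring)
  have h2 := key B.re (-A.re) (by
    apply Complex.ext
    · simp only [Complex.real_smul, Complex.add_re, Complex.re_ofReal_mul, Complex.zero_re]
      ring
    · simp only [Complex.real_smul, Complex.add_im, Complex.im_ofReal_mul, Complex.zero_im]
      linarith)
  have hA : A = 0 := Complex.ext (by simpa using h2.2) (by simpa using h1.2)
  have := (key 1 0 (by rw [hA]; simp)).1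
  exact one_ne_zero this

namespace IsStraightCone

variable {z p q : K.Point} {C : Set K.Point} (H : K.IsStraightCone z p q C)
  (hσ : CATMetric K.pathDist σ)

include H hσ

theorem exists_flatCone {u : Finset V} {ya yb : K.Point} (S : K.IsSector z p q C u ya yb)
    {Z : V → ℂ} (hZ : K.IsChart u Z)
    (hcross : Complex.cross (develop Z (ya.1 - z.1)) (develop Z (yb.1 - z.1)) ≠ 0) :
    ∃ f : K.Point → ℂ, FlatCone K.pathDist σ C z p q f ∧
      f ya = develop Z (ya.1 - z.1) ∧ f yb = develop Z (yb.1 - z.1) := by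
  have hzC : z ∈ C := H.region.sides_subset (Or.inl (left_mem_geod _ _))
  have hstar : ∀ x ∈ C, ∀ t ∈ Icc (0 : ℝ) 1, σ z x t ∈ C := fun x hx t ht =>
    H.region.star hσ hx ht
  obtain ⟨M, hM⟩ := exists_pathDist_le hσ z
  obtain ⟨ρ, hρ, hnear⟩ := S.of_near
  have hcell : ∀ w ∈ C, K.pathDist z w < ρ → w ∈ K.cell u := by
    intro w hw hd
    obtain ⟨l, m, -, -, -, e⟩ := hnear w hw hd
    intro v hv
    have := congrFun e v
    simp only [Pi.sub_apply, Pi.add_apply, Pi.smul_apply, S.apex_mem v hv, S.left_mem v hv,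
      S.right_mem v hv, sub_zero, smul_zero, add_zero] at this
    exact this
  have hκ : ∀ a ∈ C, ∀ b ∈ C, K.pathDist z a < ρ → K.pathDist z b < ρ →
      dist (develop Z (a.1 - z.1)) (develop Z (b.1 - z.1)) = K.pathDist a b := by
    intro a ha b hb h1 h2
    rw [pathDist_eq_cellDist hσ S.cell_mem (hcell a ha h1) (hcell b hb h2),
      hZ.cellDist_eq (hcell a ha h1) (hcell b hb h2), dist_eq_norm, develop_sub, develop_sub]
    congr 1
    ring
  obtain ⟨f, hlip, hhom, hfκ, hnorm⟩ := hσ.exists_log (κ := fun w => develop Z (w.1 - z.1)) hρ hzC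
    hstar (fun x _ => hM x) (by simp [develop]) hκ
  -- Both sides are homogeneous along geodesics from `z` and agree near `z`.
  have hval : ∀ y ∈ C, y ∈ K.cell u → f y = develop Z (y.1 - z.1) := by
    intro y hyC hyu
    have hn := hσ.nonneg z y
    set t := min 1 (ρ / (2 * (K.pathDist z y + 1))) with ht
    have ht0 : 0 < t := lt_min one_pos (by positivity)
    have htI : t ∈ Icc (0 : ℝ) 1 := ⟨ht0.le, min_le_left _ _⟩
    have htr : t * K.pathDist z y < ρ := by
      have h1 : t ≤ ρ / (2 * (K.pathDist z y + 1)) := min_le_right _ _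
      rw [le_div_iff₀ (by positivity)] at h1
      linarith
    have h1 := hfκ _ (hstar y hyC t htI) (by rwa [hσ.dist_left z y htI])
    rw [hhom y hyC t htI, seg_val hσ S.cell_mem S.apex_mem hyu htI, add_sub_cancel_left,
      develop_smul] at h1
    exact mul_left_cancel₀ (by exact_mod_cast ht0.ne') h1
  have hyaC := H.region.sides_subset (Or.inl S.left_side)
  have hybC := H.region.sides_subset (Or.inr S.right_side)
  have hfa := hval ya hyaC S.left_mem
  have hfb := hval yb hybC S.right_mem
  have hpC : p ∈ C := H.region.sides_subset (Or.inl (right_mem_geod _ _))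
  have hqC : q ∈ C := H.region.sides_subset (Or.inr (right_mem_geod _ _))
  refine ⟨f, ⟨hσ, hpC, hqC, hstar, fun x hx => H.region.closed hσ hx, hlip, hhom, hnorm, ?_, ?_, ?_,
    ?_⟩, hfa, hfb⟩
  · intro y hy hyfr
    refine hσ.isometric_near hstar hhom ⟨ρ, hρ, fun a ha b hb h1 h2 => ?_⟩ hy fun t ht =>
      H.isFlatAt hσ (hstar y hy t ht) (hyfr t ht).1 (hyfr t ht).2
    rw [hfκ a ha h1, hfκ b hb h2, hκ a ha b hb h1 h2]
  · exact fun y hy hp hq => H.exists_convex_ball hσ hy hp hq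
  · intro y hy hA hB
    obtain ⟨r, hr, h⟩ := H.region.exists_ball hσ hy (by
      rintro (h | h)
      · obtain ⟨t, ht, e⟩ := (mem_geod_iff hσ).1 h; exact hA t ht e
      · obtain ⟨t, ht, e⟩ := (mem_geod_iff hσ).1 h; exact hB t ht e)
    exact ⟨r, hr, fun a ha => (h a ha).1⟩
  · intro h0
    obtain ⟨s, hs, es⟩ := (mem_geod_iff hσ).1 S.left_side
    obtain ⟨t, ht, et⟩ := (mem_geod_iff hσ).1 S.right_side
    rw [← hfa, ← hfb, es, et, hhom p hpC s hs, hhom q hqC t ht] at hcross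
    apply hcross
    rw [Complex.cross]
    simp only [Complex.re_ofReal_mul, Complex.im_ofReal_mul]
    linear_combination s * t * h0

end IsStraightCone

/-! ### The region is filled by the geodesics to the base -/

theorem sum_smul_single {s : Finset V} {g : V → ℝ} (hg : ∀ v, v ∉ s → g v = 0) [DecidableEq V] :
    ∑ v ∈ s, g v • (Pi.single v 1 : V → ℝ) = g := by
  funext x
  rw [Finset.sum_apply]
  by_cases hx : x ∈ s
  · rw [Finset.sum_eq_single x (fun b _ hb => by simp [Ne.symm hb]) (fun h => (h hx).elim)]
    simp
  · rw [hg x hx]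
    refine Finset.sum_eq_zero fun v hv => ?_
    have : x ≠ v := fun h => hx (h ▸ hv)
    simp [this]

/-- A convex set that contains a beginning of every segment from `y` to a vertex of the complex
is a neighbourhood of `y`. -/
theorem mem_nhds_of_convex (hσ : CATMetric K.pathDist σ) {T : Set K.Point} {y : K.Point}
    (hconv : ∀ a ∈ T, ∀ b ∈ T, ∀ t ∈ Icc (0 : ℝ) 1, σ a b t ∈ T) {τ : ℝ} (hτ0 : 0 < τ) (hτ1 : τ ≤ 1)
    (h : ∀ (v : V) (hv : ({v} : Finset V) ∈ K.cells), σ y (vertexPoint v hv) τ ∈ T) : T ∈ 𝓝 y := by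
  classical
  -- This makes `w` a convex combination of the points at ratio `τ` from `y` to the vertices of a
  -- common cell.
  have hnb : ∀ᶠ w in 𝓝 y, ∀ v, 0 ≤ w.1 v - (1 - τ) * y.1 v := by
    rw [eventually_all]
    intro v
    rcases eq_or_lt_of_le (y.2.1 v) with h0 | h0
    · exact Eventually.of_forall fun w => by rw [← h0, mul_zero, sub_zero]; exact w.2.1 v
    · have : Continuous fun w : K.Point => w.1 v := (continuous_apply v).comp continuous_subtype_val
      filter_upwards [this.continuousAt.eventually
        (lt_mem_nhds (show (1 - τ) * y.1 v < y.1 v by nlinarith))] with w hw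
      linarith
  filter_upwards [hnb, eventually_common_cell y] with w hw hcell
  obtain ⟨s, hs, hys, hws⟩ := hcell
  have hτI : τ ∈ Icc (0 : ℝ) 1 := ⟨hτ0.le, hτ1⟩
  have hW : Convex ℝ {x : V → ℝ | ∃ P ∈ T, P ∈ K.cell s ∧ P.1 = x} := by
    rw [convex_iff_segment_subset]
    rintro _ ⟨P, hP, hPs, rfl⟩ _ ⟨Q, hQ, hQs, rfl⟩
    rw [segment_eq_image']
    rintro _ ⟨t, ht, rfl⟩
    exact ⟨_, hconv P hP Q hQ t ht, seg_mem_cell hσ hs hPs hQs ht, seg_val hσ hs hPs hQs ht⟩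
  set g : V → ℝ := fun v => (w.1 v - (1 - τ) * y.1 v) / τ with hg
  have hsum : ∀ x : K.Point, x ∈ K.cell s → ∑ v ∈ s, x.1 v = 1 := by
    intro x hx
    have := x.2.2.1
    rwa [← Finset.sum_subset (Finset.subset_univ s) (fun v _ hv => hx v hv)] at this
  have hgs : ∀ v, v ∉ s → g v = 0 := fun v hv => by simp [hg, hws v hv, hys v hv]
  have hg1 : ∑ v ∈ s, g v = 1 := by
    simp only [hg]
    rw [← Finset.sum_div, Finset.sum_sub_distrib, ← Finset.mul_sum, hsum w hws, hsum y hys]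
    field_simp
    ring
  have hmem := hW.sum_mem (t := s) (w := g)
    (z := fun v => y.1 + τ • ((Pi.single v 1 : V → ℝ) - y.1))
    (fun v _ => div_nonneg (hw v) hτ0.le) hg1 (fun v hv => by
      have hvs := vertexPoint_mem_cell (singleton_mem hs hv) hv
      refine ⟨_, h v (singleton_mem hs hv), seg_mem_cell hσ hs hys hvs hτI, ?_⟩
      rw [seg_val hσ hs hys hvs hτI]
      rfl)
  obtain ⟨P, hP, -, e⟩ := hmem
  have : ∑ v ∈ s, g v • (y.1 + τ • ((Pi.single v 1 : V → ℝ) - y.1)) = w.1 := by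
    have e1 : ∀ v ∈ s, g v • (y.1 + τ • ((Pi.single v 1 : V → ℝ) - y.1)) =
        (g v * (1 - τ)) • y.1 + τ • (g v • (Pi.single v 1 : V → ℝ)) := fun v _ => by module
    rw [Finset.sum_congr rfl e1, Finset.sum_add_distrib, ← Finset.sum_smul, ← Finset.sum_mul, hg1,
      one_mul, ← Finset.smul_sum, sum_smul_single hgs]
    funext x
    simp only [Pi.add_apply, Pi.smul_apply, smul_eq_mul, hg]
    rw [mul_div_cancel₀ _ hτ0.ne']
    ring
  rw [this] at e
  rwa [← Subtype.ext e]

namespace IsConeRegion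

variable {z p q : K.Point} {C : Set K.Point} {f : K.Point → ℂ} (H : K.IsConeRegion z p q C)
  (F : FlatCone K.pathDist σ C z p q f)

include F

theorem isClosed_fill : IsClosed (FlatCone.fill σ z p q) := by
  have hσ := F.cat
  have hcont : ContinuousOn (fun x : ℝ × ℝ => σ z (σ p q x.1) x.2) (Icc 0 1 ×ˢ Icc 0 1) := by
    refine continuousOn_of_pathDist hσ fun x hx ε hε => ?_
    have hn := hσ.nonneg p q
    have hn' := hσ.nonneg z (σ p q x.1)
    have hc : Tendsto (fun y : ℝ × ℝ => |x.1 - y.1| * K.pathDist p q +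
        |x.2 - y.2| * K.pathDist z (σ p q x.1)) (𝓝 x) (𝓝 0) := by
      have : Continuous (fun y : ℝ × ℝ => |x.1 - y.1| * K.pathDist p q +
        |x.2 - y.2| * K.pathDist z (σ p q x.1)) := by fun_prop
      simpa using this.tendsto x
    filter_upwards [self_mem_nhdsWithin,
      mem_nhdsWithin_of_mem_nhds (hc.eventually (gt_mem_nhds hε))] with y hy hlt
    refine lt_of_le_of_lt ?_ hlt
    have h1 := hσ.tri (σ z (σ p q x.1) x.2) (σ z (σ p q x.1) y.2) (σ z (σ p q y.1) y.2)
    have h2 := hσ.thales z (σ p q x.1) (σ p q y.1) hy.2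
    rw [hσ.seg p q _ hx.1 _ hy.1] at h2
    rw [hσ.seg z _ _ hx.2 _ hy.2] at h1
    have h3 : y.2 * (|x.1 - y.1| * K.pathDist p q) ≤ 1 * (|x.1 - y.1| * K.pathDist p q) :=
      mul_le_mul_of_nonneg_right hy.2.2 (by positivity)
    linarith
  have : FlatCone.fill σ z p q = (fun x : ℝ × ℝ => σ z (σ p q x.1) x.2) '' (Icc 0 1 ×ˢ Icc 0 1) := by
    ext x
    constructor
    · rintro ⟨τ, hτ, s, hs, rfl⟩
      exact ⟨(τ, s), ⟨hτ, hs⟩, rfl⟩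
    · rintro ⟨⟨τ, s⟩, ⟨hτ, hs⟩, rfl⟩
      exact ⟨τ, hτ, s, hs, rfl⟩
  rw [this]
  exact ((isCompact_Icc.prod isCompact_Icc).image_of_continuousOn hcont).isClosed

theorem sides_subset_fill : K.geod z p ∪ K.geod z q ⊆ FlatCone.fill σ z p q := by
  have hσ := F.cat
  rintro y (hy | hy)
  · obtain ⟨t, ht, rfl⟩ := (mem_geod_iff hσ).1 hy
    exact ⟨0, by simp, t, ht, by rw [hσ.zero]⟩
  · obtain ⟨t, ht, rfl⟩ := (mem_geod_iff hσ).1 hy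
    exact ⟨1, by simp, t, ht, by rw [hσ.one]⟩

include H

/-- Towards every vertex the geodesic from `y` meets a side, which belongs to the filled triangle.
By convexity its beginnings do too, up to a common ratio because there are finitely many vertices.
-/
theorem fill_mem_nhds {y : K.Point} (hy : y ∈ FlatCone.fill σ z p q)
    (hyS : y ∉ K.geod z p ∪ K.geod z q) : FlatCone.fill σ z p q ∈ 𝓝 y := by
  have hσ := F.cat
  have hyC := F.fill_subset hy
  have hit : ∀ v : V, ∃ τ : ℝ, 0 < τ ∧ τ ≤ 1 ∧ ∀ hv : ({v} : Finset V) ∈ K.cells,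
      σ y (vertexPoint v hv) τ ∈ FlatCone.fill σ z p q := by
    intro v
    by_cases hv : ({v} : Finset V) ∈ K.cells
    · obtain ⟨t, h0, h1, hS, -⟩ := H.first_hit_vertex hσ hyC hyS hv
      exact ⟨t, h0, h1, fun _ => sides_subset_fill F hS⟩
    · exact ⟨1, one_pos, le_rfl, fun h => (hv h).elim⟩
  choose τ h0 h1 hτ using hit
  have hne : (Finset.univ : Finset V).Nonempty := by
    obtain ⟨v, -⟩ : ∃ v, y.1 v ≠ 0 := by
      by_contra hne
      push Not at hne
      have := y.2.2.1
      simp [hne] at this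
    exact ⟨v, Finset.mem_univ v⟩
  obtain ⟨v₀, -, hmin⟩ := Finset.exists_min_image _ τ hne
  refine mem_nhds_of_convex hσ (fun a ha b hb t ht => F.fill_convex ha hb ht) (h0 v₀) (h1 v₀)
    fun v hv => ?_
  have hle := hmin v (Finset.mem_univ v)
  have hI : τ v₀ / τ v ∈ Icc (0 : ℝ) 1 :=
    ⟨(div_pos (h0 v₀) (h0 v)).le, by rwa [div_le_one (h0 v)]⟩
  have := F.fill_convex hy (hτ v hv) hI
  rwa [hσ.seg_seg y _ ⟨(h0 v).le, h1 v⟩ hI, div_mul_cancel₀ _ (h0 v).ne'] at this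

/-- Inside the component that defines `C`, the filled triangle is open and closed, and it contains
the midpoint of the base. -/
theorem eq_fill : C = FlatCone.fill σ z p q := by
  have hσ := F.cat
  refine Subset.antisymm ?_ F.fill_subset
  obtain ⟨y₀, hy₀, hC⟩ := H.region_eq
  set S := K.geod z p ∪ K.geod z q with hS
  -- the midpoint of the base is not on the sides
  have hhalf : (1 / 2 : ℝ) ∈ Icc (0 : ℝ) 1 := by norm_num
  have hm : σ p q (1 / 2) ∈ FlatCone.fill σ z p q := ⟨1 / 2, hhalf, 1, by simp, by rw [hσ.one]⟩
  have hfm := F.map_base hhalf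
  have hmS : σ p q (1 / 2) ∉ S := by
    have hre := congrArg Complex.re hfm
    have him := congrArg Complex.im hfm
    simp only [Complex.add_re, Complex.add_im, Complex.re_ofReal_mul, Complex.im_ofReal_mul,
      Complex.sub_re, Complex.sub_im] at hre him
    rintro (h | h)
    · obtain ⟨t, ht, e⟩ := (mem_geod_iff hσ).1 h
      rw [e, F.hom p F.fst_mem t ht, Complex.re_ofReal_mul] at hre
      rw [e, F.hom p F.fst_mem t ht, Complex.im_ofReal_mul] at him
      exact F.indep (by linear_combination 2 * (f p).im * hre - 2 * (f p).re * him)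
    · obtain ⟨t, ht, e⟩ := (mem_geod_iff hσ).1 h
      rw [e, F.hom q F.snd_mem t ht, Complex.re_ofReal_mul] at hre
      rw [e, F.hom q F.snd_mem t ht, Complex.im_ofReal_mul] at him
      exact F.indep (by linear_combination 2 * (f q).re * him - 2 * (f q).im * hre)
  have hmD : σ p q (1 / 2) ∈ connectedComponentIn Sᶜ y₀ := by
    have := F.fill_subset hm
    rw [hC] at this
    exact this.resolve_left hmS
  intro x hx
  rw [hC] at hx
  rcases hx with hx | hx
  · exact sides_subset_fill F hx
  have hpre : IsPreconnected (connectedComponentIn Sᶜ y₀) := isPreconnected_connectedComponentIn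
  by_contra hxT
  have hopen : IsOpen (interior (FlatCone.fill σ z p q)) := isOpen_interior
  obtain ⟨w, -, h1, h2⟩ := hpre _ _ hopen (isClosed_fill F).isOpen_compl (by
      intro w hw
      by_cases hwT : w ∈ FlatCone.fill σ z p q
      · left
        rw [mem_interior_iff_mem_nhds]
        exact H.fill_mem_nhds F hwT (connectedComponentIn_subset _ _ hw)
      · exact Or.inr hwT)
    ⟨_, hmD, mem_interior_iff_mem_nhds.2 (H.fill_mem_nhds F hm hmS)⟩ ⟨x, hx, hxT⟩
  exact h2 (interior_subset h1)

end IsConeRegion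

end TriangleComplex

/-! ### The inner angle at the apex -/

theorem triangleAngle_norm (A B : ℂ) :
    triangleAngle ‖A‖ ‖B‖ ‖A - B‖ = InnerProductGeometry.angle A B := by
  rw [triangleAngle, InnerProductGeometry.angle]
  congr 1
  have := norm_sub_sq_real A B
  rw [mul_assoc, show ‖A‖ ^ 2 + ‖B‖ ^ 2 - ‖A - B‖ ^ 2 = 2 * inner ℝ A B by linarith,
    mul_div_mul_left _ _ two_ne_zero]

namespace TriangleComplex

variable {V : Type*} [Fintype V] {K : TriangleComplex V} {σ : K.Point → K.Point → ℝ → K.Point}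
  {z p q ya yb : K.Point} {C : Set K.Point} {u : Finset V} {Z : V → ℂ}

/-- The angle of a fan that fills a sector is at least the angle of the sector. -/
theorem IsSector.angle_le (hσ : CATMetric K.pathDist σ) (H : K.IsStraightCone z p q C)
    (S : K.IsSector z p q C u ya yb) (hZ : K.IsChart u Z) {n : ℕ} {c : ℕ → K.Point}
    (hF : K.IsFan C z n c) (h0 : c 0 ∈ K.geod z p) (hn : c n ∈ K.geod z q) :
    InnerProductGeometry.angle (develop Z (ya.1 - z.1)) (develop Z (yb.1 - z.1)) ≤
      fanArg z c n := by
  set A := develop Z (ya.1 - z.1) with hA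
  set B := develop Z (yb.1 - z.1) with hB
  by_contra hlt
  push Not at hlt
  have hπ : fanArg z c n ≤ Real.pi := hlt.le.trans (InnerProductGeometry.angle_le_pi _ _)
  have hn0 : 0 < n := by
    rcases Nat.eq_zero_or_pos n with rfl | h
    · exact (hF.1 0 le_rfl (H.eq_apex hσ h0 hn)).elim
    · exact h
  obtain ⟨r, hr0, hr⟩ := hF.exists_radius hσ hn0
  obtain ⟨s, hs, hzs, h1s, -⟩ := (hF.2.1 0 hn0).1
  obtain ⟨s', hs', hzs', -, h2s⟩ := (hF.2.1 (n - 1) (by omega)).1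
  rw [show n - 1 + 1 = n by omega] at h2s
  obtain ⟨k, hk, ek⟩ := geod_direction hσ S.cell_mem hs S.apex_mem hzs S.left_mem h1s S.left_side h0
    S.left_ne (hF.1 0 (Nat.zero_le n))
  obtain ⟨k', hk', ek'⟩ := geod_direction hσ S.cell_mem hs' S.apex_mem hzs' S.right_mem h2s
    S.right_side hn S.right_ne (hF.1 n le_rfl)
  have hcell : ∀ w y : K.Point, y ∈ K.cell u → ∀ l : ℝ, w.1 - z.1 = l • (y.1 - z.1) →
      w ∈ K.cell u := by
    intro w y hy l e v hv
    have := congrFun e v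
    simp only [Pi.sub_apply, Pi.smul_apply, S.apex_mem v hv, hy v hv, sub_zero, smul_zero] at this
    exact this
  have hc0 := hcell _ _ S.left_mem _ ek
  have hcn := hcell _ _ S.right_mem _ ek'
  have p0 := hF.cellDist_pos hσ (Nat.zero_le n) hn0
  have pn := hF.cellDist_pos hσ le_rfl hn0
  set t := r / (K.cellDist z (c 0) + K.cellDist z (c n)) with ht
  have ht0 : 0 < t := by positivity
  have htD : t * (K.cellDist z (c 0) + K.cellDist z (c n)) = r := div_mul_cancel₀ _ (by positivity)
  have htI : t ∈ Icc (0 : ℝ) 1 :=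
    ⟨ht0.le, by rw [ht, div_le_one (by positivity)]; linarith [hr 0 (Nat.zero_le n)]⟩
  have f0 := hF.fanAt_scale hσ hn0 (IsFan.fanAt_left c 0) htI
  have fn := hF.fanAt_scale hσ (show n - 1 < n by omega) (IsFan.fanAt_right c (n - 1)) htI
  rw [show n - 1 + 1 = n by omega] at fn
  -- The unrolled fan bounds the distance of two points on the sides. In the cell this distance is
  -- given by the law of cosines with the sector angle, so a smaller fan angle would contradict the
  -- monotonicity of the cosine.
  have hd := (hF.fanAt_joined hσ hπ hr hn0 (by omega) f0 fn
    (by rw [norm_smul, norm_fanImage, Real.norm_eq_abs, abs_of_pos ht0]; nlinarith)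
    (by rw [norm_smul, norm_fanImage, Real.norm_eq_abs, abs_of_pos ht0]; nlinarith)).dist_le hσ
    (norm_nonneg _)
  have e0 : develop Z (c 0).1 - develop Z z.1 = k • A := by
    rw [← develop_sub, ek, develop_smul, Complex.real_smul]
  have en : develop Z (c n).1 - develop Z z.1 = k' • B := by
    rw [← develop_sub, ek', develop_smul, Complex.real_smul]
  rw [pathDist_eq_cellDist hσ S.cell_mem (seg_mem_cell hσ S.cell_mem S.apex_mem hc0 htI)
    (seg_mem_cell hσ S.cell_mem S.apex_mem hcn htI),
    hZ.cellDist_eq (seg_mem_cell hσ S.cell_mem S.apex_mem hc0 htI)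
    (seg_mem_cell hσ S.cell_mem S.apex_mem hcn htI), seg_val hσ S.cell_mem S.apex_mem hc0 htI,
    seg_val hσ S.cell_mem S.apex_mem hcn htI, develop_add, develop_add, develop_smul, develop_smul,
    develop_sub, develop_sub, e0, en, add_sub_add_left_eq_sub, ← Complex.real_smul,
    ← Complex.real_smul, ← smul_sub, ← smul_sub, norm_smul, norm_smul] at hd
  have hd' := le_of_mul_le_mul_left hd (norm_pos_iff.2 ht0.ne')
  have hsq := pow_le_pow_left₀ (norm_nonneg _) hd' 2
  have n0 : K.cellDist z (c 0) = ‖k • A‖ := by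
    rw [cellDist_symm, hZ.cellDist_eq hc0 S.apex_mem, e0]
  have nn : K.cellDist z (c n) = ‖k' • B‖ := by
    rw [cellDist_symm, hZ.cellDist_eq hcn S.apex_mem, en]
  have hang : InnerProductGeometry.angle (k • A) (k' • B) = InnerProductGeometry.angle A B := by
    rw [InnerProductGeometry.angle_smul_left_of_pos _ _ hk,
      InnerProductGeometry.angle_smul_right_of_pos _ _ hk']
  have hA0 : k • A ≠ 0 := by rw [← norm_pos_iff, ← n0]; exact p0
  have hB0 : k' • B ≠ 0 := by rw [← norm_pos_iff, ← nn]; exact pn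
  rw [cos_triangleAngle hA0 hB0, triangleAngle_norm, hang, dist_fanImage_sq, fanArg_zero, sub_zero,
    n0, nn] at hsq
  have h2 : Real.cos (fanArg z c n) ≤ Real.cos (InnerProductGeometry.angle A B) := by
    have h3 : (2 * ‖k • A‖ * ‖k' • B‖) * Real.cos (fanArg z c n) ≤
      (2 * ‖k • A‖ * ‖k' • B‖) * Real.cos (InnerProductGeometry.angle A B) := by linarith
    exact le_of_mul_le_mul_left h3 (by rw [n0] at p0; rw [nn] at pn; positivity)
  have h4 := Real.strictAntiOn_cos ⟨by
    have := fanArg_mono z c (Nat.zero_le n)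
    rwa [fanArg_zero] at this, hπ⟩
    ⟨InnerProductGeometry.angle_nonneg _ _, InnerProductGeometry.angle_le_pi _ _⟩ hlt
  linarith

/-- The triangle `z, ya, yb` alone is a fan, and by `angle_le` no fan has a smaller sum. Comparison
with the given angle `α` also shows that its angle is less than `π`, as a fan requires. -/
theorem IsSector.hasInnerAngle (hσ : CATMetric K.pathDist σ) (H : K.IsStraightCone z p q C)
    (S : K.IsSector z p q C u ya yb) (hZ : K.IsChart u Z) {α : ℝ} (hα : α < Real.pi)
    (h : K.HasInnerAngle C z (K.geod z p) (K.geod z q) α) :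
    K.HasInnerAngle C z (K.geod z p) (K.geod z q)
      (InnerProductGeometry.angle (develop Z (ya.1 - z.1)) (develop Z (yb.1 - z.1))) := by
  have hangle : triangleAngle (K.cellDist z ya) (K.cellDist z yb) (K.cellDist ya yb) =
      InnerProductGeometry.angle (develop Z (ya.1 - z.1)) (develop Z (yb.1 - z.1)) := by
    rw [← triangleAngle_norm, cellDist_symm z ya, cellDist_symm z yb,
      hZ.cellDist_eq S.left_mem S.apex_mem, hZ.cellDist_eq S.right_mem S.apex_mem,
      hZ.cellDist_eq S.left_mem S.right_mem, develop_sub, develop_sub, sub_sub_sub_cancel_right]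
  have hlow : ∀ s ∈ {S | ∃ (n : ℕ) (c : ℕ → K.Point), K.IsFan C z n c ∧ c 0 ∈ K.geod z p ∧
      c n ∈ K.geod z q ∧ S = ∑ i ∈ Finset.range n, triangleAngle (K.cellDist z (c i))
        (K.cellDist z (c (i + 1))) (K.cellDist (c i) (c (i + 1)))},
      InnerProductGeometry.angle (develop Z (ya.1 - z.1)) (develop Z (yb.1 - z.1)) ≤ s := by
    rintro _ ⟨n, c, hF, h0, hn, rfl⟩
    exact S.angle_le hσ H hZ hF h0 hn
  refine ⟨⟨1, fun i => if i = 0 then ya else yb, ⟨?_, ?_, ?_⟩, by simpa using S.left_side,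
    by simpa using S.right_side, by simp [hangle]⟩, hlow⟩
  · intro i _
    by_cases hi : i = 0
    · simpa [hi] using S.left_ne
    · simpa [hi] using S.right_ne
  · intro i hi
    obtain rfl : i = 0 := by omega
    refine ⟨⟨u, S.cell_mem, S.apex_mem, by simpa using S.left_mem, by simpa using S.right_mem⟩, ?_,
      ?_⟩
    · simp only [zero_add, one_ne_zero, if_true, if_false, hangle]
      exact (hlow α h.1).trans_lt hα
    · intro w hw
      obtain ⟨l, m, hl, hm, hlm, e⟩ := mem_smallTriangle.1 hw
      exact S.mem_region w l m hl hm hlm (by rw [e, add_sub_cancel_left]; simp)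
  · obtain ⟨ρ, hρ, hnear⟩ := S.of_near
    filter_upwards [eventually_pathDist_lt z hρ] with w hd hw
    obtain ⟨l, m, hl, hm, hlm, e⟩ := hnear w hw hd
    refine ⟨0, one_pos, mem_smallTriangle.2 ⟨l, m, hl, hm, hlm, ?_⟩⟩
    simp only [zero_add, one_ne_zero, if_true, if_false]
    rw [← e, add_sub_cancel]

/-- Every vertex lies on a side of some cone. If that is another cone, a vertex in this region is a
common point of two cones and hence on sides of both. So no vertex is inside the region. -/
theorem IsShortestPathMap.isStraightCone (hσ : CATMetric K.pathDist σ) {x : K.Point}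
    {M : Set K.Cone} (hM : K.IsShortestPathMap x M) {c : K.Cone} (hc : c ∈ M) :
    K.IsStraightCone c.apex c.fst c.snd c.region := by
  have hreg : K.IsConeRegion c.apex c.fst c.snd c.region := by
    refine ⟨c.region_eq, fun v y hv hy => ?_⟩
    obtain ⟨c', hc', hy'⟩ := hM.vertex v y hv
    by_cases h : c = c'
    · subst h; exact hy'
    · obtain ⟨y₀, -, e⟩ := c'.region_eq
      exact (hM.inter c hc c' hc' h ⟨hy, by rw [e]; exact Or.inl hy'⟩).1
  obtain ⟨α, hα0, -, hα⟩ := c.angle_apex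
  exact ⟨hreg, hreg.exists_sector_of_angle hσ hα0 hα, hM.straight_fst c hc, hM.straight_snd c hc⟩

theorem image_geod {f : K.Point → ℂ} (F : FlatCone K.pathDist σ C z p q f) :
    f '' K.geod z p = segment ℝ (f z) (f p) := by
  rw [segment_eq_image', F.map_apex]
  ext X
  constructor
  · rintro ⟨y, hy, rfl⟩
    obtain ⟨t, ht, rfl⟩ := (mem_geod_iff F.cat).1 hy
    exact ⟨t, ht, by rw [F.hom p F.fst_mem t ht]; simp⟩
  · rintro ⟨t, ht, rfl⟩
    exact ⟨_, F.cat.between_seg z p ht, by rw [F.hom p F.fst_mem t ht]; simp⟩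

/-- The angle at the apex is the angle between the images of the sides. -/
theorem IsSector.angle_eq {f : K.Point → ℂ} (S : K.IsSector z p q C u ya yb)
    (F : FlatCone K.pathDist σ C z p q f) :
    InnerProductGeometry.angle (f ya) (f yb) = InnerProductGeometry.angle (f p) (f q) := by
  have hσ := F.cat
  obtain ⟨s, hs, es⟩ := (mem_geod_iff hσ).1 S.left_side
  obtain ⟨t, ht, et⟩ := (mem_geod_iff hσ).1 S.right_side
  have hs0 : 0 < s := lt_of_le_of_ne hs.1 (by
    rintro rfl; exact S.left_ne (by rw [es, hσ.zero]))
  have ht0 : 0 < t := lt_of_le_of_ne ht.1 (by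
    rintro rfl; exact S.right_ne (by rw [et, hσ.zero]))
  rw [es, et, F.hom p F.fst_mem s hs, F.hom q F.snd_mem t ht, ← Complex.real_smul,
    ← Complex.real_smul, InnerProductGeometry.angle_smul_left_of_pos _ _ hs0,
    InnerProductGeometry.angle_smul_right_of_pos _ _ ht0]

end TriangleComplex

/-! ### The unfolding of a cone of the shortest path map -/

theorem mainTheorem7 {V : Type*} [Fintype V] (K : TriangleComplex V)
    (hplanar : K.IsPlanar) (hcat : K.IsCAT0) (x : K.Point)
    (M : Set K.Cone) (hM : K.IsShortestPathMap x M) (c : K.Cone) (hc : c ∈ M) :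
    ∃ f : K.Point → EPlane,
      (∀ a ∈ c.region, ∀ b ∈ c.region, dist (f a) (f b) = K.pathDist a b) ∧
      AffineIndependent ℝ ![f c.apex, f c.fst, f c.snd] ∧
      f '' c.region = convexHull ℝ {f c.apex, f c.fst, f c.snd} ∧
      f '' K.geod c.apex c.fst = segment ℝ (f c.apex) (f c.fst) ∧
      f '' K.geod c.apex c.snd = segment ℝ (f c.apex) (f c.snd) ∧
      K.HasInnerAngle c.region c.apex (K.geod c.apex c.fst) (K.geod c.apex c.snd)
        (EuclideanGeometry.angle (f c.fst) (f c.apex) (f c.snd)) := by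
  obtain ⟨σ, hσ⟩ := hcat.exists_catMetric
  have H := hM.isStraightCone hσ hc
  obtain ⟨u, ya, yb, S⟩ := H.sector
  obtain ⟨Z, hZ, hcross⟩ := S.exists_chart
  obtain ⟨f, F, hfa, hfb⟩ := H.exists_flatCone hσ S hZ hcross
  have hfill := H.region.eq_fill F
  let g : ℂ ≃ₗᵢ[ℝ] EPlane := Complex.orthonormalBasisOneI.repr
  have himage : ∀ (T : Set K.Point), (fun y => g (f y)) '' T = g.toLinearEquiv.toLinearMap '' (f '' T) :=
    fun T => (image_image _ _ _).symm
  have hseg : ∀ a b : ℂ, g.toLinearEquiv.toLinearMap '' segment ℝ a b = segment ℝ (g a) (g b) :=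
    fun a b => image_segment ℝ g.toLinearEquiv.toLinearMap.toAffineMap a b
  refine ⟨fun y => g (f y), ?_, ?_, ?_, ?_, ?_, ?_⟩
  · intro a ha b hb
    rw [g.dist_map]
    exact F.isom_fill (hfill ▸ ha) (hfill ▸ hb)
  · rw [affineIndependent_iff_not_collinear_set]
    beta_reduce
    rw [F.map_apex, map_zero]
    intro hcol
    obtain ⟨v, hv⟩ := (collinear_iff_of_mem (p₀ := (0 : EPlane)) (by simp)).1 hcol
    obtain ⟨a, ha⟩ := hv (g (f c.fst)) (by simp)
    obtain ⟨b, hb⟩ := hv (g (f c.snd)) (by simp)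
    rw [vadd_eq_add, add_zero] at ha hb
    have ha' : f c.fst = a • g.symm v := by rw [← map_smul, ← ha, g.symm_apply_apply]
    have hb' : f c.snd = b • g.symm v := by rw [← map_smul, ← hb, g.symm_apply_apply]
    apply F.indep
    rw [ha', hb']
    simp only [Complex.real_smul, Complex.re_ofReal_mul, Complex.im_ofReal_mul]
    ring
  · rw [himage, hfill, F.image_fill, LinearMap.image_convexHull]
    simp only [image_insert_eq, image_singleton]
    rfl
  · rw [himage, TriangleComplex.image_geod F, hseg]
  · rw [himage, TriangleComplex.image_geod F.symm, hseg]
  · obtain ⟨α, -, hαπ, hα⟩ := c.angle_apex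
    have := S.hasInnerAngle hσ H hZ hαπ hα
    rw [← hfa, ← hfb, S.angle_eq F] at this
    rw [EuclideanGeometry.angle]
    beta_reduce
    rw [F.map_apex, map_zero, vsub_eq_sub, vsub_eq_sub, sub_zero, sub_zero]
    rwa [show InnerProductGeometry.angle (g (f c.fst)) (g (f c.snd)) =
      InnerProductGeometry.angle (f c.fst) (f c.snd) from g.toLinearIsometry.angle_map _ _]

end
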